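/- **Setting.** Let $(\Omega,\mathcal F,(\mathcal F_t)_{t\ge 0},P)$ be a filtered probability space carrying claim times $0=T_0<T_1<T_2<\cdots$ with independent exponential interarrival times of mean $1/\lambda>0$, and claim sizes $Y_1,Y_2,\dots\ge 0$, i.i.d. with law $Q$ and independent of the claim times; the claim arrivals are adapted to $(\mathcal F_t)$, and for every $t$ the claims arriving after $t$ (times and sizes) are independent of $\mathcal F_t$. Put $S(t)=\sum_{i:\,T_i\le t}Y_i$. Let $g:\mathbb R\to\mathbb R$ be Lipschitz continuous and let $\delta>0$. For $x\ge 0$, an admissible dividend scheme is a nondecreasing càdlàg $(\mathcal F_t)$-adapted process $D$ with $D(0-)=0$, whose controlled (adapted) surplus process $X$, with $X(0-)=x$, satisfies almost surely $$X(t)=x+\int_0^t g(X(s))\,ds-S(t)-D(t),\qquad t\ge 0,$$ and in which no lump sum payment exceeds the surplus available at that moment: with $\tau=\inf\{t\ge0: X(t)<0\}$ ($\inf\varnothing=\infty$), almost surely $$\Delta D(t)\le \max\{X(t-)-\Delta S(t),\,0\}\qquad\text{for all } 0\le t\le\tau .$$ Put $J(x,D)=E\int_{[0,\tau]}e^{-\delta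 t}\,dD(t)$ (including the payment $\Delta D(0)=D(0)$) and $V(x)=\sup_D J(x,D)\in[0,\infty]$, the supremum being over all schemes admissible for $x$. Let $$\mathcal A h(x)=g(x)h'(x)-\lambda h(x)+\lambda\int_{[0,\infty)}h(x-y)\,dQ(y).$$ **Theorem 4.2.** Let $\varphi:\mathbb R\to[0,\infty)$ vanish on $(-\infty,0)$, be continuously differentiable on $[0,\infty)$ (with the one-sided derivative at $0$), and satisfy $$\max\{(\mathcal A-\delta)\varphi(x),\,1-\varphi'(x)\}=0,\qquad x>0.$$ (a) $\varphi(x)\ge V(x)$ for every $x\ge 0$. (b) Let $\mathcal C=\{x\ge 0: 1-\varphi'(x)<0\}$. Let $x\ge 0$, and let $D^*$ be an admissible dividend scheme for $x$, with controlled surplus process $X^*$, ruin time $\tau$, continuous part $D^{*c}$, and $\beta_N=\inf\{t\ge0:|X^*(t)|\ge N\}$. Suppose that almost surely 1. $X^*(t)\in\overline{\mathcal C}$ for Lebesgue almost all $0\le t\le\tau$; 2. $\int_0^t[\varphi'(X^*(s))-1]\,dD^{*c}(s)=0$ for every finite $0\le t\le\tau$; 3. $\varphi(X^*(s))-\varphi\big(X^*(s-)-\Delta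 S(s)\big)=-\Delta D^*(s)$ for every finite $0\le s\le\tau$ with $\Delta D^*(s)\ne0$; and that 4. $\lim_{N\to\infty}E\big[e^{-\delta(\tau\wedge N\wedge\beta_N)}\varphi\big(X^*(\tau\wedge N\wedge\beta_N)\big)\big]=0$. Then $\varphi(x)=V(x)=J(x,D^*)$; that is, $D^*$ is optimal for the initial surplus $x$. In particular, if such a scheme exists for every $x\ge0$, then $\varphi=V$ on $[0,\infty)$. -/

import Mathlib

open MeasureTheory ProbabilityTheory Filter Topology
open scoped ENNReal NNReal

noncomputable section

namespace Dividend

/-- The jump `Δf(t) = f(t) - f(t-)` of a path having left limits. Paths are indexed by `ℝ` and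
carry the value `f(0-)` on the negative half-line, so that `t = 0` needs no convention. -/
def jump (f : ℝ → ℝ) (t : ℝ) : ℝ := f t - Function.leftLim f t

/-- The Lebesgue–Stieltjes measure `dDᶜ` of the continuous part `Dᶜ(t) = D(t) - ∑_{s ≤ t} ΔD(s)`
of a nondecreasing càdlàg path: `dD` with its atoms, which are the jump times of `D`, removed. -/
def contMeasure (D : StieltjesFunction ℝ) : Measure ℝ :=
  D.measure.restrict {t | jump D t = 0}

/-- Derivative of a function on `[0, ∞)`: the ordinary derivative at `x > 0`, the right derivative
at `x = 0`. -/
def dplus (φ : ℝ → ℝ) (x : ℝ) : ℝ := derivWithin φ (Set.Ici 0) x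

/-- `τ = inf {t ≥ 0 : X(t) < 0}`, with `inf ∅ = ∞`. -/
def ruinTime (X : ℝ → ℝ) : ℝ≥0∞ :=
  ⨅ (t : ℝ) (_ : 0 ≤ t ∧ X t < 0), ENNReal.ofReal t

/-- `β_N = inf {t ≥ 0 : |X(t)| ≥ N}`, with `inf ∅ = ∞`. -/
def exitTime (X : ℝ → ℝ) (N : ℕ) : ℝ≥0∞ :=
  ⨅ (t : ℝ) (_ : 0 ≤ t ∧ (N : ℝ) ≤ |X t|), ENNReal.ofReal t

/-- The finite time `τ ∧ N ∧ β_N`. -/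
def localTime (X : ℝ → ℝ) (N : ℕ) : ℝ :=
  (min (ruinTime X) (min (N : ℝ≥0∞) (exitTime X N))).toReal

/-- The number of claims that occur in the time interval `(s, t]` and whose size is in `B`, when
the `k`-th claim (`k = 0, 1, …`) has size `Y k` and occurs at time `T (k + 1)`. -/
def claimCount {Ω : Type*} (T Y : ℕ → Ω → ℝ) (s t : ℝ) (B : Set ℝ) (ω : Ω) : ℝ≥0∞ :=
  ∑' k, Set.indicator {k : ℕ | s < T (k + 1) ω ∧ T (k + 1) ω ≤ t ∧ Y k ω ∈ B} (fun _ => 1) k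

/-- The σ-algebra of the claim arrivals (times and sizes) strictly after time `t`. -/
abbrev futureClaims {Ω : Type*} (T Y : ℕ → Ω → ℝ) (t : ℝ) : MeasurableSpace Ω :=
  ⨆ (u : ℝ) (B : Set ℝ) (_ : MeasurableSet B),
    MeasurableSpace.comap (claimCount T Y t u B) inferInstance

/-- The data of a piecewise-deterministic compound Poisson surplus model on a filtered probability
space: premium rate `g`, claim arrival intensity `lam`, claim size distribution `Q`, force of
interest `δ`, claim times `T` and claim sizes `Y`. -/
structure RiskModel (Ω : Type*) [mΩ : MeasurableSpace Ω] where
  /-- the probability measure -/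
  P : Measure Ω
  prob : IsProbabilityMeasure P
  /-- the filtration -/
  ℱ : Filtration ℝ≥0 mΩ
  /-- the drift of the surplus between claims -/
  g : ℝ → ℝ
  /-- Lipschitz continuity; it entails linear growth -/
  g_lipschitz : ∃ K : ℝ≥0, LipschitzWith K g
  lam : ℝ
  lam_pos : 0 < lam
  δ : ℝ
  δ_pos : 0 < δ
  /-- the law of a claim size -/
  Q : Measure ℝ
  Q_prob : IsProbabilityMeasure Q
  Q_nonneg : Q (Set.Iio 0) = 0
  /-- `T 0 = 0`, and `T (k + 1)` is the time of the `k`-th claim, `k = 0, 1, …` -/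
  T : ℕ → Ω → ℝ
  /-- `Y k` is the size of the `k`-th claim, `k = 0, 1, …` -/
  Y : ℕ → Ω → ℝ
  T_zero : ∀ ω, T 0 ω = 0
  T_measurable : ∀ k, Measurable (T k)
  Y_measurable : ∀ k, Measurable (Y k)
  /-- interarrival times are exponential with mean `1 / lam` -/
  gap_law : ∀ k, P.map (fun ω => T (k + 1) ω - T k ω) = expMeasure lam
  Y_law : ∀ k, P.map (Y k) = Q
  /-- all interarrival times and all claim sizes are mutually independent -/
  indep : iIndepFun
    (Sum.elim (fun k ω => T (k + 1) ω - T k ω) Y : ℕ ⊕ ℕ → Ω → ℝ) P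
  /-- the claims (counting process and sizes) are adapted to the filtration -/
  claims_adapted : ∀ (t : ℝ≥0) (B : Set ℝ), MeasurableSet B →
    Measurable[ℱ t] (claimCount T Y 0 t B)
  /-- the claims form a marked Poisson process relative to the filtration: what happens up to
  time `t` is independent of the claims after time `t` -/
  nonanticipating : ∀ t : ℝ≥0, Indep (ℱ t) (futureClaims T Y t) P

namespace RiskModel

variable {Ω : Type*} [MeasurableSpace Ω] (M : RiskModel Ω)

/-- The aggregate claims `∑_{i=1}^{N(t)} Y_i` up to time `t`. -/
def claims (ω : Ω) (t : ℝ) : ℝ :=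
  ∑' k, Set.indicator {k : ℕ | M.T (k + 1) ω ≤ t} (fun k => M.Y k ω) k

/-- The generator `𝒜 h (x) = g(x) h'(x) - λ h(x) + λ ∫_{[0,∞)} h(x - y) dQ(y)`. -/
def generator (h : ℝ → ℝ) (x : ℝ) : ℝ :=
  M.g x * dplus h x - M.lam * h x + M.lam * ∫ y in Set.Ici 0, h (x - y) ∂M.Q

/-- The surplus just before a dividend payment at time `t`: `X(t-)` less the claim, if any, that
occurs at time `t`. -/
def surplusBeforePayment (X : Ω → ℝ → ℝ) (ω : Ω) (t : ℝ) : ℝ :=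
  Function.leftLim (X ω) t - jump (M.claims ω) t

/-- `D` is an admissible dividend scheme for the initial surplus `x`, and `X` is the surplus
process controlled by `D`. `StieltjesFunction ℝ` is the type of nondecreasing right-continuous
functions on `ℝ`. -/
structure IsAdmissible (x : ℝ) (D : Ω → StieltjesFunction ℝ) (X : Ω → ℝ → ℝ) : Prop where
  /-- `D(0-) = 0` -/
  D_neg : ∀ ω, ∀ t < 0, D ω t = 0
  D_adapted : ∀ t : ℝ≥0, Measurable[M.ℱ t] (fun ω => D ω t)
  X_adapted : ∀ t : ℝ≥0, Measurable[M.ℱ t] (fun ω => X ω t)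
  /-- `X(0-) = x` -/
  X_neg : ∀ᵐ ω ∂M.P, ∀ t < 0, X ω t = x
  X_integrable : ∀ᵐ ω ∂M.P, ∀ t, 0 ≤ t →
    IntervalIntegrable (fun s => M.g (X ω s)) volume 0 t
  /-- `X(t) = x + ∫₀ᵗ g(X(s)) ds - ∑_{i=1}^{N(t)} Y_i - D(t)` -/
  X_eq : ∀ᵐ ω ∂M.P, ∀ t, 0 ≤ t →
    X ω t = x + (∫ s in (0 : ℝ)..t, M.g (X ω s)) - M.claims ω t - D ω t
  /-- up to ruin, a lump sum dividend does not exceed the current surplus -/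
  payment_le : ∀ᵐ ω ∂M.P, ∀ t, 0 ≤ t → ENNReal.ofReal t ≤ ruinTime (X ω) →
    jump (D ω) t ≤ max (M.surplusBeforePayment X ω t) 0

/-- `J = E ∫_{[0, τ]} e^{-δ t} dD(t)`, the payment `ΔD(0) = D(0)` at time `0` being included. -/
def performance (D : Ω → StieltjesFunction ℝ) (X : Ω → ℝ → ℝ) : ℝ≥0∞ :=
  ∫⁻ ω, ∫⁻ t in {t : ℝ | 0 ≤ t ∧ ENNReal.ofReal t ≤ ruinTime (X ω)},
    ENNReal.ofReal (Real.exp (-M.δ * t)) ∂(D ω).measure ∂M.P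

/-- The value function `V(x)`, the supremum of `J` over all admissible schemes. -/
def value (x : ℝ) : ℝ≥0∞ :=
  ⨆ (D : Ω → StieltjesFunction ℝ) (X : Ω → ℝ → ℝ) (_ : M.IsAdmissible x D X), M.performance D X

end RiskModel

/-- The continuation region `𝒞 = {x ≥ 0 : 1 - φ'(x) < 0}`. -/
def continuationRegion (φ : ℝ → ℝ) : Set ℝ := {x | 0 ≤ x ∧ 1 - dplus φ x < 0}

end Dividend

end

/-! The proof is Dynkin's formula, carried out by hand. Put σ = τ ∧ N ∧ β_N. Along almost every
path, `chain_rule` expands e^{-δσ}φ(X(σ)) - φ(x) into a drift integral, the changes of φ at the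
claims, and the loss of value caused by dividends. In expectation, `lintegral_tsum_claims` replaces
the sum over claims by an integral against λ ds dQ, so that drift and claims together contribute the
integral of e^{-δs}(𝒜 - δ)φ(X(s)), which is at most 0. Since φ' ≥ 1, the divided differences of φ
are at least 1, and the loss dominates the discounted dividends. Thus E[terminal value] + E[loss] ≤
φ(x) (`lintegral_value`). Dropping the terminal value and letting N → ∞ by monotone convergence
gives (a). Under conditions 1–3 both inequalities become equalities, and condition 4 removes the
terminal value: this is (b).

Three points need care. First, φ jumps at 0, so the chain rule is applied to a C¹ extension of φ
from [0, ∞). Before σ the surplus is nonnegative, and a lump sum payment cannot make it negative;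
hence the extension matters only at a claim that occurs exactly at σ, where the error cancels
(`sum_claims_extend`).

Second, the compensation formula needs predictable integrands, whereas the filtration is neither
complete nor right-continuous. The interval up to σ is predictable only up to a null set. For the
hitting of the closed set {|X| ≥ N} this rests on a capacity argument
(`nullMeasurableSet_projection`).

Third, nothing is assumed integrable. Every identity is arranged with nonnegative terms in `ℝ≥0∞`,
and the terms finally cancelled have finite expectation because the left limits of the surplus stay
in [0, N] up to σ. -/

namespace Dividend

/-! ### Erlang densities -/

/-- The Erlang density of shape `k + 1` and rate `r`. -/
noncomputable def erlangPDF (r : ℝ) (k : ℕ) (t : ℝ) : ℝ≥0∞ :=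
  ENNReal.ofReal (if 0 ≤ t then r ^ (k + 1) * (t ^ k / k.factorial) * Real.exp (-(r * t)) else 0)

lemma measurable_erlangPDF (r : ℝ) (k : ℕ) : Measurable (erlangPDF r k) := by
  unfold erlangPDF
  exact (Measurable.ite measurableSet_Ici (by fun_prop) measurable_const).ennreal_ofReal

lemma erlangPDF_zero (r : ℝ) : erlangPDF r 0 = exponentialPDF r := by
  ext t
  simp [erlangPDF, exponentialPDF_eq]

/-- The two exponential factors combine to e^{-ru}, which does not depend on t, so only t^k is
integrated over [0, u]. This is the induction step for the law of the claim times. -/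
lemma lintegral_erlangPDF_mul_exponentialPDF {r : ℝ} (hr : 0 < r) (k : ℕ) (u : ℝ) :
    ∫⁻ t, erlangPDF r k t * exponentialPDF r (u - t) = erlangPDF r (k + 1) u := by
  rcases lt_or_ge u 0 with hu | hu
  · have h0 : ∀ t, erlangPDF r k t * exponentialPDF r (u - t) = 0 := by
      intro t
      rcases lt_or_ge t 0 with ht | ht
      · simp [erlangPDF, not_le.2 ht]
      · rw [exponentialPDF_of_neg (by linarith), mul_zero]
    simp only [h0, lintegral_zero]
    simp [erlangPDF, not_le.2 hu]
  have h1 : ∀ t, erlangPDF r k t * exponentialPDF r (u - t) =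
      (Set.Icc 0 u).indicator (fun t => ENNReal.ofReal
        (r ^ (k + 2) * Real.exp (-(r * u)) / k.factorial * t ^ k)) t := by
    intro t
    by_cases ht : t ∈ Set.Icc 0 u
    · rw [Set.indicator_of_mem ht, exponentialPDF_of_nonneg (by linarith [ht.2]), erlangPDF,
        if_pos ht.1, ← ENNReal.ofReal_mul (by have := ht.1; positivity)]
      congr 1
      have : Real.exp (-(r * u)) = Real.exp (-(r * t)) * Real.exp (-(r * (u - t))) := by
        rw [← Real.exp_add]; ring_nf
      rw [this]; ring
    · rw [Set.indicator_of_notMem ht]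
      rcases lt_or_ge t 0 with h | h
      · simp [erlangPDF, not_le.2 h]
      · rw [exponentialPDF_of_neg, mul_zero]
        by_contra h2
        exact ht ⟨h, by linarith⟩
  simp_rw [h1]
  rw [lintegral_indicator measurableSet_Icc, ← ofReal_integral_eq_lintegral_ofReal]
  · rw [integral_Icc_eq_integral_Ioc, ← intervalIntegral.integral_of_le hu,
      intervalIntegral.integral_const_mul, integral_pow, erlangPDF, if_pos hu, Nat.factorial_succ]
    congr 1
    push_cast
    field_simp
    ring
  · exact (Continuous.continuousOn (by fun_prop)).integrableOn_Icc
  · filter_upwards [ae_restrict_mem measurableSet_Icc] with t ht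
    have := ht.1
    positivity

/-- The powers of rt sum to e^{rt}, which cancels the factor e^{-rt}. The total density of all claim
times is therefore constant: the claims have intensity r with respect to Lebesgue measure. -/
lemma tsum_erlangPDF {r : ℝ} (hr : 0 < r) {t : ℝ} (ht : 0 ≤ t) :
    ∑' k, erlangPDF r k t = ENNReal.ofReal r := by
  have hs : HasSum (fun k : ℕ => r ^ (k + 1) * (t ^ k / k.factorial) * Real.exp (-(r * t))) r := by
    have h := ((NormedSpace.expSeries_div_hasSum_exp (r * t)).mul_left r).mul_right
      (Real.exp (-(r * t)))
    rw [← Real.exp_eq_exp_ℝ, mul_assoc, ← Real.exp_add] at h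
    simp only [add_neg_cancel, Real.exp_zero, mul_one] at h
    convert! h using 2 with k
    rw [mul_pow]
    ring
  simp only [erlangPDF, if_pos ht]
  rw [← ENNReal.ofReal_tsum_of_nonneg _ hs.summable, hs.tsum_eq]
  intro k
  positivity

/-! ### Laws of the claim times and mean measure of the claims -/

namespace RiskModel

variable {Ω : Type*} [mΩ : MeasurableSpace Ω] (M : RiskModel Ω)

lemma isProbabilityMeasure_P : IsProbabilityMeasure M.P := M.prob

lemma isProbabilityMeasure_Q : IsProbabilityMeasure M.Q := M.Q_prob

attribute [instance] isProbabilityMeasure_P isProbabilityMeasure_Q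

/-- The family of all interarrival times and all claim sizes. -/
def data : ℕ ⊕ ℕ → Ω → ℝ := Sum.elim (fun k ω => M.T (k + 1) ω - M.T k ω) M.Y

lemma measurable_data (i : ℕ ⊕ ℕ) : Measurable (M.data i) := by
  rcases i with k | k
  · exact (M.T_measurable _).sub (M.T_measurable _)
  · exact M.Y_measurable k

lemma sum_data (k : ℕ) :
    ∑ i ∈ (Finset.range k).map Function.Embedding.inl, M.data i = M.T k := by
  ext ω
  rw [Finset.sum_map, Finset.sum_apply]
  simp only [data, Function.Embedding.inl_apply, Sum.elim_inl]
  rw [Finset.sum_range_sub (fun k => M.T k ω), M.T_zero, sub_zero]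

/-- `T k` is the sum of the interarrival times with index below k, a block of the independent family
that omits the k-th one. -/
lemma indepFun_T_gap (k : ℕ) :
    IndepFun (M.T k) (fun ω => M.T (k + 1) ω - M.T k ω) M.P := by
  have h : (Sum.inl k : ℕ ⊕ ℕ) ∉ (Finset.range k).map Function.Embedding.inl := by simp
  have := iIndepFun.indepFun_finsetSum_of_notMem M.indep M.measurable_data h
  rwa [show ∑ i ∈ (Finset.range k).map Function.Embedding.inl,
    (Sum.elim (fun k ω => M.T (k + 1) ω - M.T k ω) M.Y) i = M.T k from M.sum_data k] at this

lemma indepFun_T_Y (k j : ℕ) : IndepFun (M.T k) (M.Y j) M.P := by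
  have h : (Sum.inr j : ℕ ⊕ ℕ) ∉ (Finset.range k).map Function.Embedding.inl := by simp
  have := iIndepFun.indepFun_finsetSum_of_notMem M.indep M.measurable_data h
  rwa [show ∑ i ∈ (Finset.range k).map Function.Embedding.inl,
    (Sum.elim (fun k ω => M.T (k + 1) ω - M.T k ω) M.Y) i = M.T k from M.sum_data k] at this

lemma lintegral_comp_gap (k : ℕ) {f : ℝ → ℝ≥0∞} (hf : Measurable f) :
    ∫⁻ ω, f (M.T (k + 1) ω - M.T k ω) ∂M.P = ∫⁻ t, exponentialPDF M.lam t * f t := by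
  rw [← lintegral_map (f := f) (g := fun ω => M.T (k + 1) ω - M.T k ω) hf
    (M.measurable_data (Sum.inl k)), M.gap_law, expMeasure, gammaMeasure,
    lintegral_withDensity_eq_lintegral_mul _ _ hf]
  · rfl
  · exact (measurable_exponentialPDFReal _).ennreal_ofReal

/-- By induction, the law of the next claim time is the convolution of the Erlang law with the
exponential law. Translation invariance moves the shift into the exponential density, and Tonelli
exposes the convolution of densities. -/
lemma lintegral_comp_T (k : ℕ) : ∀ {f : ℝ → ℝ≥0∞}, Measurable f →
    ∫⁻ ω, f (M.T (k + 1) ω) ∂M.P = ∫⁻ t, erlangPDF M.lam k t * f t := by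
  induction k with
  | zero =>
    intro f hf
    have := M.lintegral_comp_gap 0 hf
    simpa [M.T_zero, erlangPDF_zero] using this
  | succ k ih =>
    intro f hf
    have hg : Measurable (fun ω => M.T (k + 1 + 1) ω - M.T (k + 1) ω) :=
      M.measurable_data (Sum.inl (k + 1))
    have hE : Measurable (exponentialPDF M.lam) :=
      (measurable_exponentialPDFReal _).ennreal_ofReal
    have h1 : ∫⁻ ω, f (M.T (k + 1 + 1) ω) ∂M.P = ∫⁻ ω, (fun z : ℝ × ℝ => f (z.1 + z.2))
        (M.T (k + 1) ω, M.T (k + 1 + 1) ω - M.T (k + 1) ω) ∂M.P := by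
      simp
    have hm : Measurable (fun z : ℝ × ℝ => f (z.1 + z.2)) := by fun_prop
    rw [h1, ← lintegral_map hm ((M.T_measurable _).prodMk hg),
      (indepFun_iff_map_prod_eq_prod_map_map (M.T_measurable _).aemeasurable
        hg.aemeasurable).1 (M.indepFun_T_gap (k + 1)), lintegral_prod _ hm.aemeasurable,
      lintegral_map (hm.lintegral_prod_right') (M.T_measurable _)]
    have h2 : ∀ t, ∫⁻ y, f (t + y) ∂(M.P.map fun ω => M.T (k + 1 + 1) ω - M.T (k + 1) ω)
        = ∫⁻ u, exponentialPDF M.lam (u - t) * f u := by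
      intro t
      rw [lintegral_map (by fun_prop) hg, M.lintegral_comp_gap (k + 1)
        (f := fun y => f (t + y)) (by fun_prop)]
      rw [← lintegral_sub_right_eq_self (fun y => exponentialPDF M.lam y * f (t + y)) t]
      simp only [add_sub_cancel]
    simp only [h2]
    rw [ih (f := fun t => ∫⁻ u, exponentialPDF M.lam (u - t) * f u)]
    · have h3 : ∀ t, erlangPDF M.lam k t * ∫⁻ u, exponentialPDF M.lam (u - t) * f u =
          ∫⁻ u, erlangPDF M.lam k t * (exponentialPDF M.lam (u - t) * f u) := by
        intro t
        rw [lintegral_const_mul]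
        fun_prop
      have hk := measurable_erlangPDF M.lam k
      simp only [h3]
      rw [lintegral_lintegral_swap]
      · refine lintegral_congr fun u => ?_
        rw [← lintegral_erlangPDF_mul_exponentialPDF M.lam_pos, ← lintegral_mul_const]
        · simp only [mul_assoc]
        · fun_prop
      · refine Measurable.aemeasurable ?_
        fun_prop
    · refine Measurable.lintegral_prod_right' (f := fun z : ℝ × ℝ =>
        exponentialPDF M.lam (z.2 - z.1) * f z.2) ?_
      fun_prop

/-- The mean measure of the marked claim process is `lam` times Lebesgue measure times `Q`. -/
lemma tsum_measure_claim {s t : ℝ} (hs : 0 ≤ s) {B : Set ℝ} (hB : MeasurableSet B) :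
    ∑' k, M.P {ω | M.T (k + 1) ω ∈ Set.Ioc s t ∧ M.Y k ω ∈ B} =
      ENNReal.ofReal M.lam * ENNReal.ofReal (t - s) * M.Q B := by
  have h1 : ∀ k, M.P {ω | M.T (k + 1) ω ∈ Set.Ioc s t ∧ M.Y k ω ∈ B} =
      (∫⁻ u in Set.Ioc s t, erlangPDF M.lam k u) * M.Q B := by
    intro k
    have hi := (indepFun_iff_measure_inter_preimage_eq_mul.1 (M.indepFun_T_Y (k + 1) k))
      (Set.Ioc s t) B measurableSet_Ioc hB
    have hY : M.P (M.Y k ⁻¹' B) = M.Q B := by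
      rw [← M.Y_law k, Measure.map_apply (M.Y_measurable k) hB]
    have hT : M.P (M.T (k + 1) ⁻¹' Set.Ioc s t) = ∫⁻ u in Set.Ioc s t, erlangPDF M.lam k u := by
      have := M.lintegral_comp_T k (f := (Set.Ioc s t).indicator 1)
        (measurable_one.indicator measurableSet_Ioc)
      rw [← lintegral_indicator_one (M.T_measurable _ measurableSet_Ioc),
        ← lintegral_indicator measurableSet_Ioc]
      rw [show (fun ω => (M.T (k + 1) ⁻¹' Set.Ioc s t).indicator (1 : Ω → ℝ≥0∞) ω) =
        fun ω => (Set.Ioc s t).indicator 1 (M.T (k + 1) ω) from rfl, this]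
      refine lintegral_congr fun u => ?_
      by_cases hu : u ∈ Set.Ioc s t <;> simp [hu]
    rw [← hY, ← hT, ← hi]
    rfl
  simp_rw [h1]
  rw [ENNReal.tsum_mul_right, ← lintegral_tsum
    (fun k => (measurable_erlangPDF _ _).aemeasurable)]
  congr 1
  -- The Erlang densities sum to `lam` at nonnegative times only; this is where 0 ≤ s enters.
  rw [setLIntegral_congr_fun (g := fun _ => ENNReal.ofReal M.lam) measurableSet_Ioc]
  · simp
  · intro u hu
    exact tsum_erlangPDF M.lam_pos (hs.trans hu.1.le)

lemma ae_T_lt_succ : ∀ᵐ ω ∂M.P, ∀ k, M.T k ω < M.T (k + 1) ω := by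
  rw [ae_all_iff]
  intro k
  have h := M.lintegral_comp_gap k (f := (Set.Iic 0).indicator 1)
    (measurable_one.indicator measurableSet_Iic)
  have h0 : ∫⁻ t, exponentialPDF M.lam t * (Set.Iic 0).indicator 1 t = 0 := by
    have h2 : (fun t => exponentialPDF M.lam t * (Set.Iic (0 : ℝ)).indicator 1 t) =ᵐ[volume] 0 := by
      have : ∀ᵐ t : ℝ, t ≠ 0 := by simp [ae_iff]
      filter_upwards [this] with t ht
      rcases lt_or_gt_of_ne ht with h | h
      · simp [exponentialPDF_of_neg h]
      · simp [h]
    rw [lintegral_congr_ae h2]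
    simp
  rw [h0, lintegral_eq_zero_iff] at h
  · filter_upwards [h] with ω hω
    by_contra hc
    have : M.T (k + 1) ω - M.T k ω ∈ Set.Iic (0 : ℝ) := by
      simp only [Set.mem_Iic]; linarith
    simp [Set.indicator_of_mem this] at hω
  · exact (measurable_one.indicator measurableSet_Iic).comp (M.measurable_data (Sum.inl k))

lemma ae_Y_nonneg : ∀ᵐ ω ∂M.P, ∀ k, 0 ≤ M.Y k ω := by
  rw [ae_all_iff]
  intro k
  have : ∀ᵐ y ∂(M.P.map (M.Y k)), 0 ≤ y := by
    rw [M.Y_law k, ae_iff]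
    simpa [Set.Iio] using M.Q_nonneg
  exact ae_of_ae_map (M.Y_measurable k).aemeasurable this

/-- Borel–Cantelli: the probabilities that the individual claims fall into (0, n] have the finite
sum `lam` * n, so almost surely only finitely many claims do. -/
lemma ae_T_unbounded : ∀ᵐ ω ∂M.P, ∀ t, ∃ k, t < M.T k ω := by
  have h : ∀ n : ℕ, ∀ᵐ ω ∂M.P, ∃ k, (n : ℝ) < M.T (k + 1) ω := by
    intro n
    have h1 := M.tsum_measure_claim (s := 0) (t := n) le_rfl MeasurableSet.univ
    have h2 : ∑' k, M.P {ω | M.T (k + 1) ω ∈ Set.Ioc (0 : ℝ) n ∧ M.Y k ω ∈ Set.univ} ≠ ∞ := by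
      rw [h1]
      simp [ENNReal.mul_eq_top]
    have h3 := measure_limsup_atTop_eq_zero h2
    have h4 := measure_eq_zero_iff_ae_notMem.1 h3
    filter_upwards [h4, M.ae_T_lt_succ] with ω hω hT
    by_contra! hc
    apply hω
    rw [limsup_eq_iInf_iSup_of_nat]
    simp only [Set.iSup_eq_iUnion, Set.iInf_eq_iInter, Set.mem_iInter, Set.mem_iUnion]
    intro j
    refine ⟨j, le_rfl, ⟨?_, hc j⟩, trivial⟩
    have : StrictMono (fun k => M.T k ω) := strictMono_nat_of_lt_succ hT
    have := this (Nat.succ_pos j)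
    simpa [M.T_zero] using this
  rw [← ae_all_iff] at h
  filter_upwards [h] with ω hω t
  obtain ⟨n, hn⟩ := exists_nat_gt t
  obtain ⟨k, hk⟩ := hω n
  exact ⟨k + 1, hn.trans hk⟩

end RiskModel

end Dividend

/-! ### Predictable σ-algebra and the compensation formula -/

namespace Dividend

namespace RiskModel

variable {Ω : Type*} [mΩ : MeasurableSpace Ω] (M : RiskModel Ω)

/-- The measurable rectangles `(s, t] × A × B` with `A ∈ ℱ_{s⁺}` generating the predictable
σ-algebra with marks. -/
def predictableRect : Set (Set (ℝ × Ω × ℝ)) :=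
  {R | ∃ (s t : ℝ) (A : Set Ω) (B : Set ℝ), MeasurableSet[M.ℱ s.toNNReal] A ∧ MeasurableSet B ∧
    R = Set.Ioc s t ×ˢ (A ×ˢ B)}

/-- The predictable σ-algebra with marks: the product of the predictable σ-algebra on `ℝ × Ω` and
the Borel σ-algebra of the marks. -/
@[reducible] def predictable : MeasurableSpace (ℝ × Ω × ℝ) := MeasurableSpace.generateFrom M.predictableRect

lemma measurableSet_predictable_rect (s t : ℝ) {A : Set Ω} (hA : MeasurableSet[M.ℱ s.toNNReal] A)
    {B : Set ℝ} (hB : MeasurableSet B) :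
    MeasurableSet[M.predictable] (Set.Ioc s t ×ˢ (A ×ˢ B)) :=
  MeasurableSpace.measurableSet_generateFrom ⟨s, t, A, B, hA, hB, rfl⟩

lemma predictable_le : M.predictable ≤ (inferInstance : MeasurableSpace (ℝ × Ω × ℝ)) := by
  refine MeasurableSpace.generateFrom_le ?_
  rintro _ ⟨s, t, A, B, hA, hB, rfl⟩
  exact measurableSet_Ioc.prod ((M.ℱ.le _ _ hA).prod hB)

lemma isPiSystem_predictableRect : IsPiSystem M.predictableRect := by
  rintro _ ⟨s, t, A, B, hA, hB, rfl⟩ _ ⟨s', t', A', B', hA', hB', rfl⟩ -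
  refine ⟨max s s', min t t', A ∩ A', B ∩ B', ?_, hB.inter hB', ?_⟩
  · exact MeasurableSet.inter
      (M.ℱ.mono (Real.toNNReal_mono (le_max_left s s')) _ hA)
      (M.ℱ.mono (Real.toNNReal_mono (le_max_right s s')) _ hA')
  · rw [Set.prod_inter_prod, Set.prod_inter_prod, Set.Ioc_inter_Ioc]

lemma measurable_claimCount_future (s t : ℝ) {B : Set ℝ} (hB : MeasurableSet B) :
    Measurable[futureClaims M.T M.Y s] (claimCount M.T M.Y s t B) := by
  have h : MeasurableSpace.comap (claimCount M.T M.Y s t B) inferInstance ≤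
      futureClaims M.T M.Y s :=
    le_iSup_of_le t (le_iSup_of_le B (le_iSup_of_le hB le_rfl))
  exact (comap_measurable _).mono h le_rfl

lemma claimCount_eq (s t : ℝ) (B : Set ℝ) (ω : Ω) : claimCount M.T M.Y s t B ω =
    ∑' k, {ω | M.T (k + 1) ω ∈ Set.Ioc s t ∧ M.Y k ω ∈ B}.indicator 1 ω := by
  classical
  refine tsum_congr fun k => ?_
  simp only [Set.indicator_apply, Set.mem_ofPred_eq, Set.mem_Ioc, and_assoc, Pi.one_apply]

lemma measurableSet_claim (k : ℕ) (s t : ℝ) {B : Set ℝ} (hB : MeasurableSet B) :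
    MeasurableSet {ω | M.T (k + 1) ω ∈ Set.Ioc s t ∧ M.Y k ω ∈ B} :=
  (M.T_measurable _ measurableSet_Ioc).inter (M.Y_measurable _ hB)

lemma measurable_claimCount (s t : ℝ) {B : Set ℝ} (hB : MeasurableSet B) :
    Measurable (claimCount M.T M.Y s t B) := by
  rw [show claimCount M.T M.Y s t B = _ from funext (M.claimCount_eq s t B)]
  exact Measurable.tsum fun k =>
    measurable_one.indicator (M.measurableSet_claim k s t hB)

lemma futureClaims_le (s : ℝ) : futureClaims M.T M.Y s ≤ mΩ := by
  refine iSup_le fun t => iSup_le fun B => iSup_le fun hB => ?_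
  exact (M.measurable_claimCount s t hB).comap_le

lemma lintegral_claimCount {s : ℝ} (hs : 0 ≤ s) (t : ℝ) {B : Set ℝ} (hB : MeasurableSet B) :
    ∫⁻ ω, claimCount M.T M.Y s t B ω ∂M.P =
      ENNReal.ofReal M.lam * ENNReal.ofReal (t - s) * M.Q B := by
  simp_rw [claimCount_eq]
  rw [lintegral_tsum fun k =>
    (measurable_one.indicator (M.measurableSet_claim k s t hB)).aemeasurable,
    ← M.tsum_measure_claim hs hB]
  exact tsum_congr fun k => lintegral_indicator_one (M.measurableSet_claim k s t hB)

/-- The claims as a random marked point measure, integrated against `P`. -/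
noncomputable def claimMeasure : Measure (ℝ × Ω × ℝ) :=
  Measure.sum fun k => M.P.map fun ω => (M.T (k + 1) ω, ω, M.Y k ω)

/-- The compensator of the claims, integrated against `P`. -/
noncomputable def compensator : Measure (ℝ × Ω × ℝ) :=
  ENNReal.ofReal M.lam • (volume.restrict (Set.Ioi 0)).prod (M.P.prod M.Q)

lemma measurable_claimPoint (k : ℕ) : Measurable fun ω => (M.T (k + 1) ω, ω, M.Y k ω) :=
  (M.T_measurable _).prodMk (measurable_id.prodMk (M.Y_measurable k))

/-- An event of the σ-algebra at time s is independent of the number of later claims with marks in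
B, so the mean of the product factors; the mean count is the intensity times length times Q(B). -/
lemma claimMeasure_rect (s t : ℝ) {A : Set Ω} (hA : MeasurableSet[M.ℱ s.toNNReal] A)
    {B : Set ℝ} (hB : MeasurableSet B) :
    M.claimMeasure (Set.Ioc s t ×ˢ (A ×ˢ B)) = M.compensator (Set.Ioc s t ×ˢ (A ×ˢ B)) := by
  have hA' : MeasurableSet A := M.ℱ.le _ _ hA
  have hm : MeasurableSet (Set.Ioc s t ×ˢ (A ×ˢ B)) := measurableSet_Ioc.prod (hA'.prod hB)
  -- The filtration starts at 0, so a rectangle with s < 0 is treated through max s 0. Nothing is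
  -- lost, because almost surely all claims occur at positive times.
  have hmax : ((s.toNNReal : ℝ≥0) : ℝ) = max s 0 := Real.coe_toNNReal' s
  have h1 : M.claimMeasure (Set.Ioc s t ×ˢ (A ×ˢ B)) =
      ∫⁻ ω, A.indicator 1 ω * claimCount M.T M.Y (max s 0) t B ω ∂M.P := by
    rw [claimMeasure, Measure.sum_apply _ hm]
    simp_rw [claimCount_eq, ← ENNReal.tsum_mul_left]
    rw [lintegral_tsum]
    · refine tsum_congr fun k => ?_
      rw [Measure.map_apply (M.measurable_claimPoint k) hm,
        ← lintegral_indicator_one (M.measurable_claimPoint k hm)]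
      refine lintegral_congr_ae ?_
      filter_upwards [M.ae_T_lt_succ] with ω hT
      have hpos : 0 < M.T (k + 1) ω := by
        have := strictMono_nat_of_lt_succ hT (Nat.succ_pos k)
        simpa [M.T_zero] using this
      classical
      by_cases hω : ω ∈ A <;>
        simp [Set.indicator_apply, hω, hpos, and_assoc]
    · intro k
      exact ((measurable_one.indicator hA').mul
        (measurable_one.indicator (M.measurableSet_claim k _ t hB))).aemeasurable
  have hmA : Measurable[M.ℱ s.toNNReal] (A.indicator (1 : Ω → ℝ≥0∞)) :=
    Measurable.indicator (m := M.ℱ s.toNNReal) (@measurable_one _ _ _ (M.ℱ s.toNNReal) _) hA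
  have hmC := M.measurable_claimCount_future (max s 0) t hB
  have hind := M.nonanticipating s.toNNReal
  rw [hmax] at hind
  rw [h1, lintegral_mul_eq_lintegral_mul_lintegral_of_independent_measurableSpace
    (M.ℱ.le _) (M.futureClaims_le _) hind hmA hmC, lintegral_indicator_one hA',
    M.lintegral_claimCount (le_max_right _ _) t hB, compensator, Measure.smul_apply,
    Measure.prod_prod, Measure.prod_prod, Measure.restrict_apply measurableSet_Ioc,
    Set.Ioc_inter_Ioi, Real.volume_Ioc, smul_eq_mul]
  ring

/-- **Compensation formula**: on the predictable σ-algebra with marks, the point measure of the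
claims and its compensator agree. -/
lemma trim_claimMeasure :
    M.claimMeasure.trim M.predictable_le = M.compensator.trim M.predictable_le := by
  have hB : ∀ n : ℕ, (Set.Ioc (-(n : ℝ)) n ×ˢ (Set.univ ×ˢ Set.univ) : Set (ℝ × Ω × ℝ)) ∈
      M.predictableRect := fun n => ⟨_, _, _, _, MeasurableSet.univ, MeasurableSet.univ, rfl⟩
  refine @Measure.ext_of_generateFrom_of_iUnion _ M.predictable _ _ M.predictableRect
    (fun n : ℕ => Set.Ioc (-(n : ℝ)) n ×ˢ (Set.univ ×ˢ Set.univ)) rfl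
    M.isPiSystem_predictableRect ?_ hB ?_ ?_
  · ext ⟨s, ω, y⟩
    simp only [Set.mem_iUnion, Set.mem_prod, Set.mem_univ, and_true, iff_true, Set.mem_Ioc]
    obtain ⟨n, hn⟩ := exists_nat_gt |s|
    exact ⟨n, (abs_lt.1 hn).1, (abs_lt.1 hn).2.le⟩
  · intro n
    rw [trim_measurableSet_eq M.predictable_le (MeasurableSpace.measurableSet_generateFrom (hB n)),
      M.claimMeasure_rect _ _ MeasurableSet.univ MeasurableSet.univ, compensator,
      Measure.smul_apply, Measure.prod_prod, Measure.prod_prod,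
      Measure.restrict_apply measurableSet_Ioc, Set.Ioc_inter_Ioi, Real.volume_Ioc, smul_eq_mul]
    simp [ENNReal.mul_eq_top]
  · intro R hR
    rw [trim_measurableSet_eq M.predictable_le (MeasurableSpace.measurableSet_generateFrom hR),
      trim_measurableSet_eq M.predictable_le (MeasurableSpace.measurableSet_generateFrom hR)]
    obtain ⟨s, t, A, B, hA, hB, rfl⟩ := hR
    exact M.claimMeasure_rect s t hA hB

/-- This is the usable form of the compensation formula: predictable integrands are integrated
against the two measures that agree on the predictable σ-algebra, and Tonelli unfolds the
compensator. -/
lemma lintegral_tsum_claims {f : ℝ × Ω × ℝ → ℝ≥0∞} (hf : Measurable[M.predictable] f) :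
    ∫⁻ ω, ∑' k, f (M.T (k + 1) ω, ω, M.Y k ω) ∂M.P =
      ENNReal.ofReal M.lam * ∫⁻ ω, ∫⁻ s in Set.Ioi 0, ∫⁻ y, f (s, ω, y) ∂M.Q ∂volume ∂M.P := by
  have hf' : Measurable f := hf.mono M.predictable_le le_rfl
  have h1 : ∫⁻ z, f z ∂M.claimMeasure = ∫⁻ z, f z ∂M.compensator := by
    rw [← lintegral_trim M.predictable_le hf, M.trim_claimMeasure, lintegral_trim _ hf]
  rw [claimMeasure, lintegral_sum_measure, compensator, lintegral_smul_measure] at h1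
  rw [lintegral_tsum (f := fun k ω => f (M.T (k + 1) ω, ω, M.Y k ω))
    fun k => (hf'.comp (M.measurable_claimPoint k)).aemeasurable]
  simp_rw [lintegral_map hf' (M.measurable_claimPoint _)] at h1
  rw [h1, smul_eq_mul, lintegral_prod _ hf'.aemeasurable]
  congr 1
  rw [lintegral_lintegral_swap (f := fun ω s => ∫⁻ y, f (s, ω, y) ∂M.Q)]
  · refine lintegral_congr fun s => ?_
    rw [lintegral_prod]
    exact (hf'.comp measurable_prodMk_left).aemeasurable
  · have : Measurable fun z : (Ω × ℝ) × ℝ => f (z.1.2, z.1.1, z.2) := by fun_prop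
    exact (this.lintegral_prod_right' (ν := M.Q)).aemeasurable

end RiskModel

end Dividend

/-! ### Chain rule for paths of finite variation -/

namespace Dividend

section ChainRule

/-- The `k`-th point of the partition of `[a, b]` into `n + 1` intervals of equal length. -/
noncomputable def gridPoint (a b : ℝ) (n : ℕ) (k : ℤ) : ℝ := a + k * ((b - a) / (n + 1))

/-- The index of the right endpoint of the cell of the partition that contains `u`. -/
noncomputable def gridIndex (a b : ℝ) (n : ℕ) (u : ℝ) : ℤ := ⌈(u - a) / ((b - a) / (n + 1))⌉

variable {a b : ℝ}

lemma gridPoint_zero (n : ℕ) : gridPoint a b n 0 = a := by simp [gridPoint]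

lemma gridPoint_last (n : ℕ) : gridPoint a b n ((n + 1 : ℕ) : ℤ) = b := by
  simp only [gridPoint]; push_cast; field_simp; ring

lemma gridPoint_mono (hab : a < b) (n : ℕ) : Monotone (gridPoint a b n) := by
  intro i j hij
  have : (i : ℝ) ≤ j := by exact_mod_cast hij
  have h0 : 0 ≤ (b - a) / (n + 1) := div_nonneg (by linarith) (by positivity)
  simp only [gridPoint]
  nlinarith

lemma gridIndex_eq (hab : a < b) {n : ℕ} {k : ℤ} {u : ℝ}
    (hu : u ∈ Set.Ioc (gridPoint a b n k) (gridPoint a b n (k + 1))) :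
    gridIndex a b n u = k + 1 := by
  have h0 : 0 < (b - a) / (n + 1) := div_pos (by linarith) (by positivity)
  obtain ⟨h1, h2⟩ := hu
  simp only [gridPoint] at h1 h2
  rw [gridIndex, Int.ceil_eq_iff, lt_div_iff₀ h0, div_le_iff₀ h0]
  push_cast at h1 h2 ⊢
  constructor <;> nlinarith

lemma mem_Ioc_gridIndex (hab : a < b) (n : ℕ) (u : ℝ) :
    u ∈ Set.Ioc (gridPoint a b n (gridIndex a b n u - 1)) (gridPoint a b n (gridIndex a b n u)) := by
  have h0 : 0 < (b - a) / (n + 1) := div_pos (by linarith) (by positivity)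
  have h1 := Int.ceil_lt_add_one ((u - a) / ((b - a) / (n + 1)))
  have h2 := Int.le_ceil ((u - a) / ((b - a) / (n + 1)))
  rw [← sub_lt_iff_lt_add, lt_div_iff₀ h0] at h1
  rw [div_le_iff₀ h0] at h2
  simp only [gridPoint, gridIndex, Set.mem_Ioc]
  push_cast
  constructor <;> linarith

lemma gridIndex_bounds (hab : a < b) (n : ℕ) {u : ℝ} (hu : u ∈ Set.Ioc a b) :
    1 ≤ gridIndex a b n u ∧ gridIndex a b n u ≤ (n + 1 : ℕ) := by
  have h0 : 0 < (b - a) / (n + 1) := div_pos (by linarith) (by positivity)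
  constructor
  · rw [gridIndex, Int.one_le_ceil_iff]
    exact div_pos (by linarith [hu.1]) h0
  · rw [gridIndex, Int.ceil_le, div_le_iff₀ h0]
    push_cast
    have : ((n : ℝ) + 1) * ((b - a) / (n + 1)) = b - a := by field_simp
    linarith [hu.2]

lemma gridPoint_succ_sub (n : ℕ) (k : ℤ) :
    gridPoint a b n k - gridPoint a b n (k - 1) = (b - a) / (n + 1) := by
  simp only [gridPoint]; push_cast; ring

lemma tendsto_gridPoint (hab : a < b) (u : ℝ) :
    Tendsto (fun n => gridPoint a b n (gridIndex a b n u)) atTop (𝓝 u) ∧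
    Tendsto (fun n => gridPoint a b n (gridIndex a b n u - 1)) atTop (𝓝 u) := by
  have h0 : Tendsto (fun n : ℕ => (b - a) / ((n : ℝ) + 1)) atTop (𝓝 0) :=
    tendsto_const_nhds.div_atTop (tendsto_natCast_atTop_atTop.atTop_add tendsto_const_nhds)
  constructor
  · refine tendsto_of_tendsto_of_tendsto_of_le_of_le (g := fun _ => u)
      (h := fun n : ℕ => u + (b - a) / ((n : ℝ) + 1)) tendsto_const_nhds (by simpa using h0.const_add u) ?_ ?_
    · exact fun n => (mem_Ioc_gridIndex hab n u).2
    · intro n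
      have h1 := (mem_Ioc_gridIndex hab n u).1
      have h2 := gridPoint_succ_sub (a := a) (b := b) n (gridIndex a b n u)
      simp only; linarith
  · refine tendsto_of_tendsto_of_tendsto_of_le_of_le (h := fun _ => u)
      (g := fun n : ℕ => u - (b - a) / ((n : ℝ) + 1)) (by simpa using h0.const_sub u) tendsto_const_nhds ?_ ?_
    · intro n
      have h1 := (mem_Ioc_gridIndex hab n u).2
      have h2 := gridPoint_succ_sub (a := a) (b := b) n (gridIndex a b n u)
      simp only; linarith
    · exact fun n => (mem_Ioc_gridIndex hab n u).1.le

/-- The sum is the integral of f times a step function constant on the cells; dominated convergence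
applies, since the step functions are uniformly bounded and converge at each point of (a, b]. -/
lemma tendsto_riemann_sum {ρ : Measure ℝ} (hab : a < b) {f Φ : ℝ → ℝ}
    (hf : IntervalIntegrable f ρ a b) (F : ℕ → ℤ → ℝ) {C : ℝ}
    (hC : ∀ (n : ℕ) (k : ℤ), 1 ≤ k → k ≤ (n + 1 : ℕ) → |F n k| ≤ C)
    (hlim : ∀ u ∈ Set.Ioc a b, Tendsto (fun n => F n (gridIndex a b n u)) atTop (𝓝 (Φ u))) :
    IntervalIntegrable (fun u => f u * Φ u) ρ a b ∧
    Tendsto (fun n : ℕ => ∑ i ∈ Finset.range (n + 1), F n ((i : ℤ) + 1) *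
      ∫ u in gridPoint a b n i..gridPoint a b n ((i : ℤ) + 1), f u ∂ρ) atTop
      (𝓝 (∫ u in a..b, f u * Φ u ∂ρ)) := by
  have hmeas : ∀ n, Measurable fun u => F n (gridIndex a b n u) := fun n =>
    (measurable_from_top (f := F n)).comp (Int.measurable_ceil.comp (by fun_prop))
  have hfm : AEStronglyMeasurable f (ρ.restrict (Set.uIoc a b)) := by
    rw [Set.uIoc_of_le hab.le]; exact hf.1.1
  have hbd : ∀ n, ∀ u ∈ Set.Ioc a b, |F n (gridIndex a b n u)| ≤ C := fun n u hu =>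
    hC n _ (gridIndex_bounds hab n hu).1 (gridIndex_bounds hab n hu).2
  have hsum : ∀ n : ℕ, ∑ i ∈ Finset.range (n + 1), F n ((i : ℤ) + 1) *
      ∫ u in gridPoint a b n i..gridPoint a b n ((i : ℤ) + 1), f u ∂ρ =
      ∫ u in a..b, f u * F n (gridIndex a b n u) ∂ρ := by
    intro n
    have hint : IntervalIntegrable (fun u => f u * F n (gridIndex a b n u)) ρ a b := by
      rw [intervalIntegrable_iff] at hf ⊢
      refine Integrable.mul_bdd (c := C) hf (hmeas n).aestronglyMeasurable ?_
      rw [Set.uIoc_of_le hab.le]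
      filter_upwards [ae_restrict_mem measurableSet_Ioc] with u hu
      exact hbd n u hu
    have hsub : ∀ i : ℕ, i < n + 1 → Set.uIcc (gridPoint a b n i) (gridPoint a b n ((i : ℤ) + 1)) ⊆
        Set.uIcc a b := by
      intro i hi
      rw [Set.uIcc_of_le (gridPoint_mono hab n (by omega)), Set.uIcc_of_le hab.le]
      refine Set.Icc_subset_Icc ?_ ?_
      · calc a = gridPoint a b n 0 := (gridPoint_zero n).symm
          _ ≤ _ := gridPoint_mono hab n (by omega)
      · calc _ ≤ gridPoint a b n ((n + 1 : ℕ) : ℤ) := gridPoint_mono hab n (by omega)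
          _ = b := gridPoint_last n
    have key := intervalIntegral.sum_integral_adjacent_intervals (μ := ρ)
      (f := fun u => f u * F n (gridIndex a b n u)) (a := fun i : ℕ => gridPoint a b n i) (n := n + 1)
      (fun i hi => hint.mono_set (by push_cast; exact hsub i hi))
    rw [gridPoint_last, Nat.cast_zero, gridPoint_zero] at key
    rw [← key]
    refine Finset.sum_congr rfl fun i hi => ?_
    push_cast
    rw [← intervalIntegral.integral_const_mul]
    refine intervalIntegral.integral_congr_ae (ae_of_all _ fun u hu => ?_)
    rw [Set.uIoc_of_le (gridPoint_mono hab n (by omega))] at hu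
    rw [gridIndex_eq hab hu, mul_comm]
  have hbound : IntervalIntegrable (fun u => |f u| * C) ρ a b := by
    exact hf.abs.mul_const C
  constructor
  · rw [intervalIntegrable_iff] at hf ⊢
    rw [Set.uIoc_of_le hab.le] at hf ⊢
    have hΦ : AEStronglyMeasurable Φ (ρ.restrict (Set.Ioc a b)) := by
      refine aestronglyMeasurable_of_tendsto_ae atTop
        (fun n => (hmeas n).aestronglyMeasurable) ?_
      filter_upwards [ae_restrict_mem measurableSet_Ioc] with u hu
      exact hlim u hu
    refine Integrable.mul_bdd (c := C) hf hΦ ?_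
    filter_upwards [ae_restrict_mem measurableSet_Ioc] with u hu
    exact le_of_tendsto (hlim u hu).abs (Eventually.of_forall fun n => hbd n u hu)
  · simp_rw [hsum]
    refine intervalIntegral.tendsto_integral_filter_of_dominated_convergence
      (fun u => |f u| * C) (Eventually.of_forall fun n => ?_)
      (Eventually.of_forall fun n => ae_of_all _ fun u hu => ?_) hbound
      (ae_of_all _ fun u hu => ?_)
    · exact hfm.mul (hmeas n).aestronglyMeasurable
    · rw [Set.uIoc_of_le hab.le] at hu
      rw [norm_mul, Real.norm_eq_abs, Real.norm_eq_abs]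
      exact mul_le_mul_of_nonneg_left (hbd n u hu) (abs_nonneg _)
    · rw [Set.uIoc_of_le hab.le] at hu
      exact (hlim u hu).const_mul _

/-- The half-open cells contain u and shrink to it, so their masses tend to the atom at u. This is
how jumps appear in the limit of the Riemann sums. -/
lemma tendsto_measureReal_Ioc {μ : Measure ℝ} [IsLocallyFiniteMeasure μ] {u : ℝ} {l r : ℕ → ℝ}
    (hl : Tendsto l atTop (𝓝 u)) (hlu : ∀ n, l n < u) (hr : Tendsto r atTop (𝓝 u))
    (hur : ∀ n, u ≤ r n) :
    Tendsto (fun n => μ.real (Set.Ioc (l n) (r n))) atTop (𝓝 (μ.real {u})) := by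
  have h : Tendsto (fun n => μ (Set.Ioc (l n) (r n))) atTop (𝓝 (μ {u})) := by
    refine tendsto_measure_of_tendsto_indicator atTop (fun n => measurableSet_Ioc)
      (B := Set.Icc (u - 1) (u + 1)) measurableSet_Icc isCompact_Icc.measure_lt_top.ne ?_ ?_
    · filter_upwards [hl.eventually_const_lt (show u - 1 < u by linarith),
        hr.eventually_lt_const (show u < u + 1 by linarith)] with n h1 h2
      exact Set.Ioc_subset_Icc_self.trans (Set.Icc_subset_Icc h1.le h2.le)
    · intro x
      rcases lt_trichotomy x u with hx | rfl | hx
      · filter_upwards [hl.eventually_const_lt hx] with n hn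
        simp only [Set.mem_Ioc, Set.mem_singleton_iff, hx.ne, iff_false]
        intro h; linarith [h.1]
      · exact Eventually.of_forall fun n => by simp [hlu n, hur n]
      · filter_upwards [hr.eventually_lt_const hx] with n hn
        simp only [Set.mem_Ioc, Set.mem_singleton_iff, hx.ne', iff_false]
        intro h; linarith [h.2]
  exact (ENNReal.tendsto_toReal (by simpa using (measure_singleton_lt_top (μ := μ)).ne)).comp h

/-- **Chain rule** along a path of finite variation with drift `γ` that decreases by the increments
of `μ` first and by the increments of `ν` afterwards; `m` is the divided difference of `ψ`. -/
theorem chain_rule {X γ ψ h h' : ℝ → ℝ} {m : ℝ → ℝ → ℝ} (hab : a < b) {μ ν : Measure ℝ}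
    [IsLocallyFiniteMeasure μ] [IsLocallyFiniteMeasure ν]
    (hγ : IntervalIntegrable γ volume a b)
    (hX : ∀ s t, a ≤ s → s ≤ t → t ≤ b →
      X t = X s + (∫ u in s..t, γ u) - μ.real (Set.Ioc s t) - ν.real (Set.Ioc s t))
    (hm : Continuous (Function.uncurry m)) (hmψ : ∀ x y, m x y * (y - x) = ψ y - ψ x)
    (hψ : Continuous ψ) (hh : Continuous h) (hh' : IntervalIntegrable h' volume a b)
    (hhh' : ∀ s t, a ≤ s → s ≤ t → t ≤ b → h t - h s = ∫ u in s..t, h' u) :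
    IntervalIntegrable (fun u => h' u * ψ (X u)) volume a b ∧
    IntervalIntegrable (fun u => γ u * (h u * m (X u) (X u))) volume a b ∧
    IntervalIntegrable (fun u => h u * m (X u + ν.real {u}) (X u)) ν a b ∧
    h b * ψ (X b) - h a * ψ (X a) = (∫ u in a..b, h' u * ψ (X u)) +
      (∫ u in a..b, γ u * (h u * m (X u) (X u))) -
      (∫ u in a..b, h u * m (X u + ν.real {u}) (X u) ∂ν) -
      ∫ u in a..b, h u * m (X u + ν.real {u} + μ.real {u}) (X u + ν.real {u}) ∂μ := by
  set t := gridPoint a b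
  -- Across a cell the path is moved in three stages: by the μ-mass to `P₁`, by the ν-mass to `P₂`,
  -- and by the drift to the right endpoint value. For the cell around u the four successive values
  -- tend to X(u-), X(u) + ν{u}, X(u) and X(u).
  set P₁ : ℕ → ℤ → ℝ := fun n k => X (t n (k - 1)) - μ.real (Set.Ioc (t n (k - 1)) (t n k))
  set P₂ : ℕ → ℤ → ℝ := fun n k => P₁ n k - ν.real (Set.Ioc (t n (k - 1)) (t n k))
  have htab : ∀ (n : ℕ) (k : ℤ), 0 ≤ k → k ≤ (n + 1 : ℕ) → a ≤ t n k ∧ t n k ≤ b := by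
    intro n k h0 h1
    exact ⟨(gridPoint_zero n).symm.le.trans (gridPoint_mono hab n h0),
      (gridPoint_mono hab n h1).trans (gridPoint_last n).le⟩
  -- convergence at a fixed time
  have hlim : ∀ u ∈ Set.Ioc a b,
      Tendsto (fun n => X (t n (gridIndex a b n u))) atTop (𝓝 (X u)) ∧
      Tendsto (fun n => X (t n (gridIndex a b n u - 1))) atTop
        (𝓝 (X u + ν.real {u} + μ.real {u})) ∧
      Tendsto (fun n => P₁ n (gridIndex a b n u)) atTop (𝓝 (X u + ν.real {u})) ∧
      Tendsto (fun n => P₂ n (gridIndex a b n u)) atTop (𝓝 (X u)) := by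
    intro u hu
    obtain ⟨hr, hl⟩ := tendsto_gridPoint hab u
    have hlu : ∀ n, t n (gridIndex a b n u - 1) < u := fun n => (mem_Ioc_gridIndex hab n u).1
    have hur : ∀ n, u ≤ t n (gridIndex a b n u) := fun n => (mem_Ioc_gridIndex hab n u).2
    have hla : ∀ n, a ≤ t n (gridIndex a b n u - 1) := fun n => by
      have := gridIndex_bounds hab n hu
      exact (htab n _ (by omega) (by omega)).1
    have hrb : ∀ n, t n (gridIndex a b n u) ≤ b := fun n => by
      have := gridIndex_bounds hab n hu
      exact (htab n _ (by omega) (by omega)).2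
    have hprim := intervalIntegral.continuousOn_primitive_interval' hγ Set.left_mem_uIcc
    rw [Set.uIcc_of_le hab.le] at hprim
    have hcu := hprim u ⟨hu.1.le, hu.2⟩
    have hint : ∀ {c d}, c ∈ Set.Icc a b → d ∈ Set.Icc a b → (∫ u in c..d, γ u) =
        (∫ u in a..d, γ u) - ∫ u in a..c, γ u := by
      intro c d hc hd
      rw [intervalIntegral.integral_interval_sub_left]
      · exact hγ.mono_set (by rw [Set.uIcc_of_le hab.le, Set.uIcc_of_le hd.1]; exact Set.Icc_subset_Icc le_rfl hd.2)
      · exact hγ.mono_set (by rw [Set.uIcc_of_le hab.le, Set.uIcc_of_le hc.1]; exact Set.Icc_subset_Icc le_rfl hc.2)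
    have hGr : Tendsto (fun n => ∫ x in u..t n (gridIndex a b n u), γ x) atTop (𝓝 0) := by
      have : Tendsto (fun n => ∫ x in a..t n (gridIndex a b n u), γ x) atTop (𝓝 (∫ x in a..u, γ x)) :=
        hcu.tendsto.comp (tendsto_nhdsWithin_iff.2 ⟨hr, Eventually.of_forall fun n =>
          ⟨hu.1.le.trans (hur n), hrb n⟩⟩)
      have := this.sub_const (∫ x in a..u, γ x)
      rw [sub_self] at this
      refine this.congr fun n => ?_
      rw [hint ⟨hu.1.le, hu.2⟩ ⟨hu.1.le.trans (hur n), hrb n⟩]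
    have hGl : Tendsto (fun n => ∫ x in t n (gridIndex a b n u - 1)..u, γ x) atTop (𝓝 0) := by
      have : Tendsto (fun n => ∫ x in a..t n (gridIndex a b n u - 1), γ x) atTop (𝓝 (∫ x in a..u, γ x)) :=
        hcu.tendsto.comp (tendsto_nhdsWithin_iff.2 ⟨hl, Eventually.of_forall fun n =>
          ⟨hla n, (hlu n).le.trans hu.2⟩⟩)
      have := this.const_sub (∫ x in a..u, γ x)
      rw [sub_self] at this
      refine this.congr fun n => ?_
      rw [hint ⟨hla n, (hlu n).le.trans hu.2⟩ ⟨hu.1.le, hu.2⟩]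
    have hμ := tendsto_measureReal_Ioc (μ := μ) hl hlu hr hur
    have hν := tendsto_measureReal_Ioc (μ := ν) hl hlu hr hur
    have hμl := tendsto_measureReal_Ioc (μ := μ) hl hlu tendsto_const_nhds (fun _ => le_rfl)
    have hνl := tendsto_measureReal_Ioc (μ := ν) hl hlu tendsto_const_nhds (fun _ => le_rfl)
    have hXl : Tendsto (fun n => X (t n (gridIndex a b n u - 1))) atTop
        (𝓝 (X u + ν.real {u} + μ.real {u})) := by
      have := ((hGl.const_sub (X u)).add hνl).add hμl
      rw [sub_zero] at this
      refine this.congr fun n => ?_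
      rw [hX _ u (hla n) (hlu n).le hu.2]
      ring
    have hXp : Tendsto (fun n => P₁ n (gridIndex a b n u)) atTop (𝓝 (X u + ν.real {u})) := by
      simpa using hXl.sub hμ
    have hXp' : Tendsto (fun n => P₂ n (gridIndex a b n u)) atTop (𝓝 (X u)) := by
      simpa using hXp.sub hν
    refine ⟨?_, hXl, hXp, hXp'⟩
    have := hXp'.add (hGl.add hGr)
    simp only [add_zero] at this
    refine this.congr fun n => ?_
    rw [hX (t n (gridIndex a b n u - 1)) (t n (gridIndex a b n u)) (hla n)
      ((hlu n).le.trans (hur n)) (hrb n), hint ⟨hla n, (hlu n).le.trans hu.2⟩ ⟨hu.1.le, hu.2⟩,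
      hint ⟨hu.1.le, hu.2⟩ ⟨hu.1.le.trans (hur n), hrb n⟩,
      hint ⟨hla n, (hlu n).le.trans hu.2⟩ ⟨hu.1.le.trans (hur n), hrb n⟩]
    ring
  -- uniform bounds
  obtain ⟨R, hR⟩ : ∃ R, ∀ (n : ℕ) (k : ℤ), 1 ≤ k → k ≤ (n + 1 : ℕ) → X (t n k) ∈ Set.Icc (-R) R ∧
      X (t n (k - 1)) ∈ Set.Icc (-R) R ∧ P₁ n k ∈ Set.Icc (-R) R ∧ P₂ n k ∈ Set.Icc (-R) R := by
    set R₀ := |X a| + (∫ u in a..b, |γ u|) + μ.real (Set.Ioc a b) + ν.real (Set.Ioc a b)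
    have hsub : ∀ (ρ : Measure ℝ) [IsLocallyFiniteMeasure ρ] (c d : ℝ), a ≤ c → d ≤ b →
        ρ.real (Set.Ioc c d) ≤ ρ.real (Set.Ioc a b) := fun ρ _ c d hc hd =>
      measureReal_mono (Set.Ioc_subset_Ioc hc hd) measure_Ioc_lt_top.ne
    have hXb : ∀ s ∈ Set.Icc a b, |X s| ≤ R₀ := by
      intro s hs
      rw [hX a s le_rfl hs.1 hs.2]
      have h1 : |∫ u in a..s, γ u| ≤ ∫ u in a..b, |γ u| :=
        (intervalIntegral.abs_integral_le_integral_abs hs.1).trans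
          (intervalIntegral.integral_mono_interval le_rfl hs.1 hs.2
            (ae_of_all _ fun u => abs_nonneg _) hγ.abs)
      have h2 := hsub μ a s le_rfl hs.2
      have h3 := hsub ν a s le_rfl hs.2
      have h4 : 0 ≤ μ.real (Set.Ioc a s) := measureReal_nonneg
      have h5 : 0 ≤ ν.real (Set.Ioc a s) := measureReal_nonneg
      have h6 := abs_le.1 h1
      have h7 := abs_le.1 (le_refl |X a|)
      rw [abs_le]
      constructor <;> simp only [R₀] <;> linarith [h6.1, h6.2, h7.1, h7.2]
    -- The path is bounded by `R₀`, and the intermediate values subtract at most two masses, each at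
    -- most `R₀`.
    refine ⟨3 * R₀, fun n k h1 h2 => ?_⟩
    have hk := htab n k (by omega) h2
    have hk' := htab n (k - 1) (by omega) (by omega)
    have b1 := abs_le.1 (hXb _ hk)
    have b2 := abs_le.1 (hXb _ hk')
    have h2 := hsub μ (t n (k - 1)) (t n k) hk'.1 hk.2
    have h3 := hsub ν (t n (k - 1)) (t n k) hk'.1 hk.2
    have h4 : 0 ≤ μ.real (Set.Ioc (t n (k - 1)) (t n k)) := measureReal_nonneg
    have h5 : 0 ≤ ν.real (Set.Ioc (t n (k - 1)) (t n k)) := measureReal_nonneg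
    have h6 : 0 ≤ ∫ u in a..b, |γ u| :=
      intervalIntegral.integral_nonneg hab.le fun u _ => abs_nonneg _
    have h7 : μ.real (Set.Ioc a b) ≤ R₀ := by
      have : 0 ≤ ν.real (Set.Ioc a b) := measureReal_nonneg
      simp only [R₀]; linarith [abs_nonneg (X a)]
    have h8 : ν.real (Set.Ioc a b) ≤ R₀ := by
      have : 0 ≤ μ.real (Set.Ioc a b) := measureReal_nonneg
      simp only [R₀]; linarith [abs_nonneg (X a)]
    simp only [P₂, P₁, Set.mem_Icc]
    refine ⟨⟨?_, ?_⟩, ⟨?_, ?_⟩, ⟨?_, ?_⟩, ?_, ?_⟩ <;> linarith [b1.1, b1.2, b2.1, b2.2]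
  obtain ⟨Cm, hCm⟩ := ((isCompact_Icc (a := -R) (b := R)).prod
    (isCompact_Icc (a := -R) (b := R))).exists_bound_of_continuousOn hm.continuousOn
  obtain ⟨Ch, hCh⟩ := (isCompact_Icc (a := a) (b := b)).exists_bound_of_continuousOn hh.continuousOn
  obtain ⟨Cψ, hCψ⟩ := (isCompact_Icc (a := -R) (b := R)).exists_bound_of_continuousOn
    hψ.continuousOn
  have hprod : ∀ {n : ℕ} {k : ℤ} {p q : ℝ}, 1 ≤ k → k ≤ (n + 1 : ℕ) → p ∈ Set.Icc (-R) R → q ∈ Set.Icc (-R) R →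
      |h (t n (k - 1)) * m p q| ≤ Ch * Cm := by
    intro n k p q h1 h2 hp hq
    have hh1 := hCh _ (htab n (k - 1) (by omega) (by omega))
    have hm1 := hCm (p, q) ⟨hp, hq⟩
    rw [abs_mul]
    exact mul_le_mul hh1 hm1 (abs_nonneg _) ((abs_nonneg _).trans hh1)
  have hhl : ∀ u ∈ Set.Ioc a b,
      Tendsto (fun n => h (t n (gridIndex a b n u - 1))) atTop (𝓝 (h u)) :=
    fun u _ => (hh.tendsto u).comp (tendsto_gridPoint hab u).2
  have I1 := tendsto_riemann_sum hab hh' (fun n k => ψ (X (t n k))) (C := Cψ) (Φ := fun u => ψ (X u))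
    (fun n k h1 h2 => hCψ _ (hR n k h1 h2).1)
    (fun u hu => (hψ.tendsto _).comp (hlim u hu).1)
  have I2 := tendsto_riemann_sum hab hγ (fun n k => h (t n (k - 1)) * m (P₂ n k) (X (t n k)))
    (Φ := fun u => h u * m (X u) (X u))
    (fun n k h1 h2 => hprod h1 h2 (hR n k h1 h2).2.2.2 (hR n k h1 h2).1)
    (fun u hu => (hhl u hu).mul ((hm.tendsto (X u, X u)).comp
      ((hlim u hu).2.2.2.prodMk_nhds (hlim u hu).1)))
  have I3 := tendsto_riemann_sum (ρ := ν) hab (f := fun _ => 1) intervalIntegrable_const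
    (fun n k => h (t n (k - 1)) * m (P₁ n k) (P₂ n k))
    (Φ := fun u => h u * m (X u + ν.real {u}) (X u))
    (fun n k h1 h2 => hprod h1 h2 (hR n k h1 h2).2.2.1 (hR n k h1 h2).2.2.2)
    (fun u hu => (hhl u hu).mul ((hm.tendsto (_, X u)).comp
      ((hlim u hu).2.2.1.prodMk_nhds (hlim u hu).2.2.2)))
  have I4 := tendsto_riemann_sum (ρ := μ) hab (f := fun _ => 1) intervalIntegrable_const
    (fun n k => h (t n (k - 1)) * m (X (t n (k - 1))) (P₁ n k))
    (Φ := fun u => h u * m (X u + ν.real {u} + μ.real {u}) (X u + ν.real {u}))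
    (fun n k h1 h2 => hprod h1 h2 (hR n k h1 h2).2.1 (hR n k h1 h2).2.2.1)
    (fun u hu => (hhl u hu).mul ((hm.tendsto (_, X u + ν.real {u})).comp
      ((hlim u hu).2.1.prodMk_nhds (hlim u hu).2.2.1)))
  simp only [one_mul] at I3 I4
  refine ⟨I1.1, I2.1, I3.1, tendsto_nhds_unique ?_ (((I1.2.add I2.2).sub I3.2).sub I4.2)⟩
  refine tendsto_const_nhds.congr fun n => ?_
  rw [← Finset.sum_add_distrib, ← Finset.sum_sub_distrib, ← Finset.sum_sub_distrib]
  -- The left side telescopes over the cells. In each cell the increment of hψ(X) is ψ at the right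
  -- endpoint times the increment of h, plus h at the left endpoint times the increment of ψ, and
  -- the latter splits over the three stages by `hmψ`.
  have htel := Finset.sum_range_sub (fun i : ℕ => h (t n i) * ψ (X (t n i))) (n + 1)
  simp only [t, gridPoint_last, Nat.cast_zero, gridPoint_zero] at htel
  rw [← htel]
  refine Finset.sum_congr rfl fun i hi => ?_
  have hi' := Finset.mem_range.1 hi
  have hmono : t n i ≤ t n ((i : ℤ) + 1) := gridPoint_mono hab n (by omega)
  have h1 := (htab n i (by omega) (by omega)).1
  have h2 := (htab n ((i : ℤ) + 1) (by omega) (by omega)).2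
  have hX' := hX (t n i) (t n ((i : ℤ) + 1)) h1 hmono h2
  have hh1 := hhh' (t n i) (t n ((i : ℤ) + 1)) h1 hmono h2
  have e1 : ∀ (ρ : Measure ℝ) [IsLocallyFiniteMeasure ρ],
      ∫ _ in t n i..t n ((i : ℤ) + 1), (1 : ℝ) ∂ρ = ρ.real (Set.Ioc (t n i) (t n ((i : ℤ) + 1))) := by
    intro ρ _
    rw [intervalIntegral.integral_of_le hmono]
    simp
  have hs : (i : ℤ) + 1 - 1 = i := by ring
  have a1 := hmψ (X (t n i)) (P₁ n ((i : ℤ) + 1))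
  have a2 := hmψ (P₁ n ((i : ℤ) + 1)) (P₂ n ((i : ℤ) + 1))
  have a3 := hmψ (P₂ n ((i : ℤ) + 1)) (X (t n ((i : ℤ) + 1)))
  have d1 : P₁ n ((i : ℤ) + 1) - X (t n i) = -μ.real (Set.Ioc (t n i) (t n ((i : ℤ) + 1))) := by
    simp only [P₁, hs]; ring
  have d2 : P₂ n ((i : ℤ) + 1) - P₁ n ((i : ℤ) + 1) =
      -ν.real (Set.Ioc (t n i) (t n ((i : ℤ) + 1))) := by
    simp only [P₂, hs]; ring
  have d3 : X (t n ((i : ℤ) + 1)) - P₂ n ((i : ℤ) + 1) =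
      ∫ u in t n i..t n ((i : ℤ) + 1), γ u := by
    simp only [P₂, P₁, hs]; linarith
  rw [d1] at a1
  rw [d2] at a2
  rw [d3] at a3
  push_cast
  change h (t n ((i : ℤ) + 1)) * ψ (X (t n ((i : ℤ) + 1))) - h (t n i) * ψ (X (t n i)) =
    ψ (X (t n ((i : ℤ) + 1))) * (∫ u in t n i..t n ((i : ℤ) + 1), h' u) +
    h (t n ((i : ℤ) + 1 - 1)) * m (P₂ n ((i : ℤ) + 1)) (X (t n ((i : ℤ) + 1))) *
      (∫ u in t n i..t n ((i : ℤ) + 1), γ u) -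
    h (t n ((i : ℤ) + 1 - 1)) * m (P₁ n ((i : ℤ) + 1)) (P₂ n ((i : ℤ) + 1)) *
      (∫ _ in t n i..t n ((i : ℤ) + 1), (1 : ℝ) ∂ν) -
    h (t n ((i : ℤ) + 1 - 1)) * m (X (t n ((i : ℤ) + 1 - 1))) (P₁ n ((i : ℤ) + 1)) *
      (∫ _ in t n i..t n ((i : ℤ) + 1), (1 : ℝ) ∂μ)
  rw [e1 μ, e1 ν, ← hh1, hs]
  linear_combination (-h (t n i)) * a1 - h (t n i) * a2 - h (t n i) * a3

end ChainRule

end Dividend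

/-! ### Measurable projection and hitting events -/

namespace Dividend

section Projection

/-- If every `c < μ E` is at most the measure of a measurable subset of `E`, then `E` is null
measurable. -/
lemma nullMeasurableSet_of_inner_approx {Ω : Type*} {mΩ : MeasurableSpace Ω} {μ : Measure Ω}
    [IsFiniteMeasure μ] {E : Set Ω}
    (h : ∀ c < μ E, ∃ F ⊆ E, MeasurableSet F ∧ c ≤ μ F) : NullMeasurableSet E μ := by
  rcases eq_or_ne (μ E) 0 with h0 | h0
  · exact NullMeasurableSet.of_null h0
  obtain ⟨c, -, hc, hlim⟩ := exists_seq_strictMono_tendsto' (pos_iff_ne_zero.2 h0)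
  choose F hFE hF hcF using fun n => h (c n) (hc n).2
  have hU : ⋃ n, F n ⊆ E := Set.iUnion_subset hFE
  have hUm : MeasurableSet (⋃ n, F n) := MeasurableSet.iUnion hF
  have hμ : μ E ≤ μ (⋃ n, F n) :=
    le_of_tendsto' hlim fun n => (hcF n).trans (measure_mono (Set.subset_iUnion F n))
  have h1 : (⋃ n, F n : Set Ω) =ᵐ[μ] toMeasurable μ E :=
    ae_eq_of_subset_of_measure_ge (hU.trans (subset_toMeasurable μ E))
      (by rw [measure_toMeasurable]; exact hμ) hUm.nullMeasurableSet (measure_ne_top _ _)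
  have h2 : (⋃ n, F n : Set Ω) =ᵐ[μ] E := by
    filter_upwards [h1] with ω hω
    refine propext ⟨fun h => hU h, fun h => ?_⟩
    exact (iff_of_eq hω).2 (subset_toMeasurable μ E h)
  exact hUm.nullMeasurableSet.congr h2

/-- **Measurable projection** of a countable intersection of countable unions of measurable
rectangles with closed first sides over a compact set of parameters. -/
theorem nullMeasurableSet_projection {Ω : Type*} {mΩ : MeasurableSpace Ω} (μ : Measure Ω)
    [IsFiniteMeasure μ] {K : Set ℝ} (hK : IsCompact K) {I : ℕ → ℕ → Set ℝ}
    (hI : ∀ n i, IsClosed (I n i)) {A : ℕ → ℕ → Set Ω} (hA : ∀ n i, MeasurableSet (A n i)) :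
    NullMeasurableSet {ω | ∃ u ∈ K, ∀ n, ∃ i, u ∈ I n i ∧ ω ∈ A n i} μ := by
  refine nullMeasurableSet_of_inner_approx fun c hc => ?_
  -- Capacity argument: in `S k n` the first n unions are cut off at the indices k j. As the next
  -- cut-off l grows, the sets increase to the uncut one, so continuity from below yields an l that
  -- keeps the measure above c.
  set S : (ℕ → ℕ) → ℕ → Set Ω := fun k n => {ω | ∃ u ∈ K,
    (∀ j < n, ∃ i ≤ k j, u ∈ I j i ∧ ω ∈ A j i) ∧ ∀ j, ∃ i, u ∈ I j i ∧ ω ∈ A j i} with hS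
  have hstep : ∀ k n, c < μ (S k n) → ∃ l, c < μ (S (Function.update k n l) (n + 1)) := by
    intro k n h
    have hU : S k n = ⋃ l, S (Function.update k n l) (n + 1) := by
      ext ω
      simp only [Set.mem_iUnion]
      constructor
      · rintro ⟨u, hu, h1, h2⟩
        obtain ⟨i, hi⟩ := h2 n
        refine ⟨i, u, hu, fun j hj => ?_, h2⟩
        rcases Nat.lt_succ_iff_lt_or_eq.1 hj with hj | rfl
        · rw [Function.update_of_ne hj.ne]; exact h1 j hj
        · exact ⟨i, by simp, hi⟩
      · rintro ⟨l, u, hu, h1, h2⟩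
        refine ⟨u, hu, fun j hj => ?_, h2⟩
        have := h1 j (by omega)
        rwa [Function.update_of_ne hj.ne] at this
    have hmono : Monotone fun l => S (Function.update k n l) (n + 1) := by
      rintro l l' hl ω ⟨u, hu, h1, h2⟩
      refine ⟨u, hu, fun j hj => ?_, h2⟩
      obtain ⟨i, hi, h3⟩ := h1 j hj
      refine ⟨i, hi.trans ?_, h3⟩
      by_cases hjn : j = n
      · subst hjn; simpa using hl
      · simp [Function.update_of_ne hjn]
    rw [hU, hmono.measure_iUnion] at h
    exact lt_iSup_iff.1 h
  classical
  choose! f hf using hstep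
  let g : ℕ → ℕ → ℕ := fun n => Nat.rec (fun _ => 0) (fun n k => Function.update k n (f k n)) n
  have hgs : ∀ n, g (n + 1) = Function.update (g n) n (f (g n) n) := fun n => rfl
  have hg : ∀ n, c < μ (S (g n) n) := by
    intro n
    induction n with
    | zero =>
      have : S (g 0) 0 = {ω | ∃ u ∈ K, ∀ n, ∃ i, u ∈ I n i ∧ ω ∈ A n i} := by
        ext ω; simp [hS]
      rw [this]; exact hc
    | succ n ih => rw [hgs]; exact hf _ _ ih
  set k : ℕ → ℕ := fun j => g (j + 1) j with hk
  have hgk : ∀ n, ∀ j < n, g n j = k j := by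
    intro n
    induction n with
    | zero => intro j hj; omega
    | succ n ih =>
      intro j hj
      rcases Nat.lt_succ_iff_lt_or_eq.1 hj with hj | rfl
      · rw [hgs, Function.update_of_ne hj.ne]; exact ih j hj
      · rfl
  -- Dropping the constraints that have not been cut gives a measurable superset of `S (g n) n`,
  -- decreasing in n, whose measure still exceeds c.
  set F : ℕ → Set Ω := fun n => {ω | ∃ u ∈ K, ∀ j < n, ∃ i ≤ k j, u ∈ I j i ∧ ω ∈ A j i} with hF
  have hSF : ∀ n, S (g n) n ⊆ F n := by
    rintro n ω ⟨u, hu, h1, -⟩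
    refine ⟨u, hu, fun j hj => ?_⟩
    rw [← hgk n j hj]
    exact h1 j hj
  have hFm : ∀ n, MeasurableSet (F n) := by
    intro n
    -- Once the indices are fixed, the conditions on u and on ω separate; the existence of u no
    -- longer depends on ω.
    have : F n = ⋃ φ : Fin n → ℕ, {ω | (∀ j, φ j ≤ k j) ∧ (∃ u ∈ K, ∀ j : Fin n, u ∈ I j (φ j)) ∧
        ∀ j : Fin n, ω ∈ A j (φ j)} := by
      ext ω
      simp only [Set.mem_iUnion]
      constructor
      · rintro ⟨u, hu, h1⟩
        choose φ hφ1 hφ2 using fun j : Fin n => h1 j j.2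
        exact ⟨φ, hφ1, ⟨u, hu, fun j => (hφ2 j).1⟩, fun j => (hφ2 j).2⟩
      · rintro ⟨φ, h1, ⟨u, hu, h2⟩, h3⟩
        exact ⟨u, hu, fun j hj => ⟨φ ⟨j, hj⟩, h1 ⟨j, hj⟩, h2 ⟨j, hj⟩, h3 ⟨j, hj⟩⟩⟩
    rw [this]
    refine MeasurableSet.iUnion fun φ => (MeasurableSet.const _).inter
      ((MeasurableSet.const _).inter ?_)
    have : {ω | ∀ j : Fin n, ω ∈ A j (φ j)} = ⋂ j : Fin n, A j (φ j) := by ext; simp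
    change MeasurableSet {ω | ∀ j : Fin n, ω ∈ A j (φ j)}
    rw [this]
    exact MeasurableSet.iInter fun j => hA _ _
  have hFanti : Antitone F := by
    rintro n n' hn ω ⟨u, hu, h1⟩
    exact ⟨u, hu, fun j hj => h1 j (hj.trans_le hn)⟩
  refine ⟨⋂ n, F n, ?_, MeasurableSet.iInter hFm, ?_⟩
  · intro ω hω
    rw [Set.mem_iInter] at hω
    -- For fixed ω the admissible parameters form decreasing nonempty compact sets: the cut-off
    -- leaves finite unions of closed sets. A common point of these sets is a parameter that works
    -- for all n at once.
    set C : ℕ → Set ℝ := fun n => K ∩ ⋂ j, ⋂ (_ : j < n), ⋃ i ∈ {i | i ≤ k j ∧ ω ∈ A j i}, I j i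
    have hCclosed : ∀ n, IsClosed (C n) := by
      intro n
      refine hK.isClosed.inter (isClosed_iInter fun j => isClosed_iInter fun _ => ?_)
      exact Set.Finite.isClosed_biUnion ((Set.finite_Iic (k j)).subset fun i hi => hi.1)
        fun i _ => hI j i
    have hCmem : ∀ n u, u ∈ C n ↔ u ∈ K ∧ ∀ j < n, ∃ i ≤ k j, u ∈ I j i ∧ ω ∈ A j i := by
      intro n u
      simp only [C, Set.mem_inter_iff, Set.mem_iInter, Set.mem_iUnion]
      refine and_congr_right fun _ => forall₂_congr fun j _ => ?_
      constructor
      · rintro ⟨i, ⟨h1, h2⟩, h3⟩; exact ⟨i, h1, h3, h2⟩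
      · rintro ⟨i, h1, h3, h2⟩; exact ⟨i, ⟨h1, h2⟩, h3⟩
    obtain ⟨u, hu⟩ := IsCompact.nonempty_iInter_of_sequence_nonempty_isCompact_isClosed C
      (fun n u hu => by
        rw [hCmem] at hu ⊢
        exact ⟨hu.1, fun j hj => hu.2 j (by omega)⟩)
      (fun n => by
        obtain ⟨u, hu, h1⟩ := hω n
        exact ⟨u, (hCmem n u).2 ⟨hu, h1⟩⟩)
      (hK.of_isClosed_subset (hCclosed 0) fun u hu => hu.1) hCclosed
    rw [Set.mem_iInter] at hu
    refine ⟨u, ((hCmem 0 u).1 (hu 0)).1, fun n => ?_⟩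
    obtain ⟨i, -, h⟩ := ((hCmem (n + 1) u).1 (hu (n + 1))).2 n (Nat.lt_succ_self n)
    exact ⟨i, h⟩
  · rw [hFanti.measure_iInter (fun n => (hFm n).nullMeasurableSet) ⟨0, measure_ne_top _ _⟩]
    exact le_iInf fun n => (hg n).le.trans (measure_mono (hSF n))

/-- The event that a right-continuous process, adapted up to time `q`, reaches `[c, ∞)` during
`[0, q]` agrees almost surely with an event of the σ-algebra at time `q`. -/
lemma exists_measurableSet_hitting {Ω : Type*} {m mΩ : MeasurableSpace Ω} (hm : m ≤ mΩ)
    (P : Measure Ω) [IsFiniteMeasure P] {Z : ℝ → Ω → ℝ} (q : ℚ)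
    (hZ : ∀ r, 0 ≤ r → r ≤ (q : ℝ) → Measurable[m] (Z r))
    (hrc : ∀ᵐ ω ∂P, ∀ u, 0 ≤ u → ContinuousWithinAt (fun t => Z t ω) (Set.Ici u) u) (c : ℝ) :
    ∃ A, MeasurableSet[m] A ∧ ∀ᵐ ω ∂P, (ω ∈ A ↔ ∃ u ∈ Set.Icc (0 : ℝ) q, c ≤ Z u ω) := by
  obtain ⟨e, he⟩ := exists_surjective_nat (ℚ × ℚ)
  -- With e i = (p, r), membership of u in [p, r] together with `A n i` says that u ≤ r < u +
  -- 1/(n+1) and Z(r) > c - 1/(n+1). By right continuity, such an r exists for every n exactly when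
  -- Z(u) ≥ c, or, when u = q, with r = q.
  set A : ℕ → ℕ → Set Ω := fun n i => {ω | 0 ≤ (e i).2 ∧ (e i).2 ≤ q ∧
    ((e i).2 : ℝ) - (e i).1 < 1 / ((n : ℝ) + 1) ∧ c - 1 / ((n : ℝ) + 1) < Z (e i).2 ω} with hA
  have hAm : ∀ n i, MeasurableSet[m] (A n i) := by
    intro n i
    by_cases h : 0 ≤ (e i).2 ∧ (e i).2 ≤ q ∧ ((e i).2 : ℝ) - (e i).1 < 1 / ((n : ℝ) + 1)
    · have h1 : A n i = (Z (e i).2) ⁻¹' Set.Ioi (c - 1 / ((n : ℝ) + 1)) := by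
        ext ω
        exact ⟨fun hω => hω.2.2.2, fun hω => ⟨h.1, h.2.1, h.2.2, hω⟩⟩
      rw [h1]
      exact hZ _ (by exact_mod_cast h.1) (by exact_mod_cast h.2.1) measurableSet_Ioi
    · have h1 : A n i = ∅ := by
        ext ω
        exact ⟨fun hω => h ⟨hω.1, hω.2.1, hω.2.2.1⟩, fun hω => hω.elim⟩
      rw [h1]
      exact @MeasurableSet.empty _ m
  -- Projecting with respect to the trimmed measure gives an approximating event in m itself, so the
  -- filtration need not be complete.
  have hnull := @nullMeasurableSet_projection Ω m (P.trim hm) _ _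
    (isCompact_Icc (a := (0 : ℝ)) (b := q)) (fun _ i => Set.Icc ((e i).1 : ℝ) (e i).2)
    (fun _ _ => isClosed_Icc) A hAm
  obtain ⟨T, -, hT, hTE⟩ := hnull.exists_measurable_superset_ae_eq
  refine ⟨T, hT, ?_⟩
  filter_upwards [ae_eq_of_ae_eq_trim hTE, hrc] with ω hω hc
  have hω' : ω ∈ T ↔ ∃ u ∈ Set.Icc (0 : ℝ) q, ∀ n, ∃ i,
      u ∈ Set.Icc ((e i).1 : ℝ) (e i).2 ∧ ω ∈ A n i := iff_of_eq hω
  rw [hω']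
  constructor
  · rintro ⟨u, hu, h⟩
    refine ⟨u, hu, ?_⟩
    choose i hi1 hi2 using h
    have h0 : Tendsto (fun n : ℕ => 1 / ((n : ℝ) + 1)) atTop (𝓝 0) :=
      tendsto_one_div_add_atTop_nhds_zero_nat
    have hr : Tendsto (fun n => ((e (i n)).2 : ℝ)) atTop (𝓝 u) := by
      refine tendsto_of_tendsto_of_tendsto_of_le_of_le (g := fun _ => u)
        (h := fun n : ℕ => u + 1 / ((n : ℝ) + 1)) tendsto_const_nhds (by simpa using h0.const_add u)
        (fun n => (hi1 n).2) (fun n => ?_)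
      have h1 := (hi1 n).1
      have h2 := (hi2 n).2.2.1
      simp only; linarith
    have hlim : Tendsto (fun n => Z (e (i n)).2 ω) atTop (𝓝 (Z u ω)) :=
      (hc u hu.1).tendsto.comp (tendsto_nhdsWithin_iff.2
        ⟨hr, Eventually.of_forall fun n => (hi1 n).2⟩)
    have h3 : Tendsto (fun n : ℕ => c - 1 / ((n : ℝ) + 1)) atTop (𝓝 c) := by
      simpa using h0.const_sub c
    exact le_of_tendsto_of_tendsto' h3 hlim fun n => (hi2 n).2.2.2.le
  · rintro ⟨u, hu, h⟩
    refine ⟨u, hu, fun n => ?_⟩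
    have hn : 0 < 1 / ((n : ℝ) + 1) := by positivity
    obtain ⟨r, hur, hrq, hr1, hr2⟩ : ∃ r : ℚ, u ≤ r ∧ r ≤ q ∧ (r : ℝ) < u + 1 / ((n : ℝ) + 1) ∧
        c - 1 / ((n : ℝ) + 1) < Z r ω := by
      rcases hu.2.eq_or_lt with huq | huq
      · exact ⟨q, huq.le, le_rfl, by linarith, by rw [← huq]; linarith⟩
      · have h1 : ∀ᶠ t in 𝓝[>] u, c - 1 / ((n : ℝ) + 1) < Z t ω :=
          ((hc u hu.1).mono Set.Ioi_subset_Ici_self).tendsto.eventually_const_lt (by linarith)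
        have h2 : ∀ᶠ t in 𝓝[>] u, t < min (q : ℝ) (u + 1 / ((n : ℝ) + 1)) :=
          eventually_nhdsWithin_of_eventually_nhds
            (eventually_lt_nhds (lt_min huq (by linarith)))
        obtain ⟨b, hb, hsub⟩ := mem_nhdsGT_iff_exists_Ioo_subset.1 (h1.and h2)
        obtain ⟨r, hr1, hr2⟩ := exists_rat_btwn (Set.mem_Ioi.1 hb)
        have := hsub ⟨hr1, hr2⟩
        have h3 := lt_min_iff.1 this.2
        exact ⟨r, hr1.le, by exact_mod_cast h3.1.le, h3.2, this.1⟩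
    obtain ⟨p, hp1, hp2⟩ := exists_rat_btwn (show (r : ℝ) - 1 / ((n : ℝ) + 1) < u by linarith)
    obtain ⟨i, hi⟩ := he (p, r)
    refine ⟨i, ?_, ?_⟩
    · rw [hi]; exact ⟨hp2.le, hur⟩
    · have h0r : (0 : ℝ) ≤ r := hu.1.trans hur
      simp only [hA, hi]
      exact ⟨by exact_mod_cast h0r, hrq, by linarith, hr2⟩

end Projection

end Dividend

/-! ### C¹ extension of φ and the quasi-variational inequality -/

namespace Dividend

/-- The derivative of `φ` on `[0, ∞)`, extended to `ℝ` by the constant `φ'(0)`. -/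
noncomputable def extDeriv (φ : ℝ → ℝ) (x : ℝ) : ℝ := dplus φ (max x 0)

/-- The extension of `φ` from `[0, ∞)` to a continuously differentiable function on `ℝ`. -/
noncomputable def extend (φ : ℝ → ℝ) (x : ℝ) : ℝ := φ 0 + ∫ t in (0 : ℝ)..x, extDeriv φ t

/-- The divided difference of `extend φ`. -/
noncomputable def dividedDiff (φ : ℝ → ℝ) (x y : ℝ) : ℝ :=
  ∫ θ in (0 : ℝ)..1, extDeriv φ (x + θ * (y - x))

lemma extDeriv_of_nonneg (φ : ℝ → ℝ) {x : ℝ} (hx : 0 ≤ x) : extDeriv φ x = dplus φ x := by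
  rw [extDeriv, max_eq_left hx]

lemma dividedDiff_self (φ : ℝ → ℝ) (x : ℝ) : dividedDiff φ x x = extDeriv φ x := by
  simp [dividedDiff]

section Smooth

variable {φ : ℝ → ℝ} (hC1 : ContDiffOn ℝ 1 φ (Set.Ici 0))

include hC1

lemma continuousOn_dplus : ContinuousOn (dplus φ) (Set.Ici 0) :=
  hC1.continuousOn_derivWithin (uniqueDiffOn_Ici 0) le_rfl

lemma continuous_extDeriv : Continuous (extDeriv φ) :=
  (continuousOn_dplus hC1).comp_continuous (by fun_prop) fun _ =>
    Set.mem_Ici.2 (le_max_right _ _)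

lemma continuous_extend : Continuous (extend φ) :=
  continuous_const.add
    (intervalIntegral.continuous_primitive (fun _ _ => (continuous_extDeriv hC1).intervalIntegrable _ _) 0)

lemma extend_of_nonneg {x : ℝ} (hx : 0 ≤ x) : extend φ x = φ x := by
  have h : ∫ t in (0 : ℝ)..x, extDeriv φ t = φ x - φ 0 := by
    refine intervalIntegral.integral_eq_sub_of_hasDeriv_right_of_le hx
      (hC1.continuousOn.mono Set.Icc_subset_Ici_self) (fun t ht => ?_)
      ((continuous_extDeriv hC1).intervalIntegrable _ _)
    rw [extDeriv_of_nonneg φ ht.1.le]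
    have h1 : HasDerivWithinAt φ (dplus φ t) (Set.Ici 0) t :=
      (hC1.differentiableOn one_ne_zero t ht.1.le).hasDerivWithinAt
    exact h1.mono fun s hs => ht.1.le.trans (Set.mem_Ioi.1 hs).le
  rw [extend, h]; ring

lemma extend_sub (x y : ℝ) : extend φ y - extend φ x = ∫ t in x..y, extDeriv φ t := by
  have hi := fun a b => (continuous_extDeriv hC1).intervalIntegrable (μ := volume) a b
  rw [extend, extend, add_sub_add_left_eq_sub,
    intervalIntegral.integral_interval_sub_left (hi _ _) (hi _ _)]

lemma dividedDiff_mul (x y : ℝ) : dividedDiff φ x y * (y - x) = extend φ y - extend φ x := by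
  rw [extend_sub hC1, dividedDiff]
  have := intervalIntegral.mul_integral_comp_add_mul (f := extDeriv φ) (a := 0) (b := 1) (y - x) x
  rw [mul_zero, mul_one, add_zero, add_sub_cancel] at this
  rw [mul_comm, ← this]
  simp only [mul_comm]

lemma continuous_dividedDiff : Continuous (Function.uncurry (dividedDiff φ)) := by
  have := continuous_extDeriv hC1
  refine intervalIntegral.continuous_parametric_intervalIntegral_of_continuous'
    (f := fun (z : ℝ × ℝ) θ => extDeriv φ (z.1 + θ * (z.2 - z.1))) ?_ 0 1
  fun_prop

lemma one_le_dividedDiff (h1 : ∀ x, 1 ≤ extDeriv φ x) (x y : ℝ) : 1 ≤ dividedDiff φ x y := by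
  have hc := continuous_extDeriv hC1
  have h : ∫ _ in (0 : ℝ)..1, (1 : ℝ) ≤ dividedDiff φ x y := by
    refine intervalIntegral.integral_mono_on zero_le_one intervalIntegrable_const
      (Continuous.intervalIntegrable (by fun_prop) _ _) fun θ _ => h1 _
  simpa using h

end Smooth

namespace RiskModel

variable {Ω : Type*} [MeasurableSpace Ω] (M : RiskModel Ω)

/-- A nonnegative solution of the quasi-variational inequality that vanishes on `(-∞, 0)` and is
continuously differentiable on `[0, ∞)`. -/
structure IsQVISolution (φ : ℝ → ℝ) : Prop where
  nonneg : ∀ y, 0 ≤ φ y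
  neg : ∀ y < 0, φ y = 0
  contDiffOn : ContDiffOn ℝ 1 φ (Set.Ici 0)
  qvi : ∀ x > 0, max (M.generator φ x - M.δ * φ x) (1 - dplus φ x) = 0

/-- The expected value `∫ h(x - y) dQ(y)` of `h` after a claim. -/
noncomputable def claimMean (h : ℝ → ℝ) (x : ℝ) : ℝ := ∫ y in Set.Ici 0, h (x - y) ∂M.Q

/-- The part `g φ' - δ φ` of `(𝒜 - δ) φ` that does not involve claims. -/
noncomputable def drift (φ : ℝ → ℝ) (x : ℝ) : ℝ := M.g x * dplus φ x - M.δ * φ x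

lemma continuous_g : Continuous M.g := by
  obtain ⟨K, hK⟩ := M.g_lipschitz
  exact hK.continuous

lemma ae_nonneg_Q : ∀ᵐ y ∂M.Q, 0 ≤ y := by
  rw [ae_iff]
  simpa [Set.Iio] using M.Q_nonneg

lemma restrict_Q : M.Q.restrict (Set.Ici 0) = M.Q :=
  Measure.restrict_eq_self_of_ae_mem M.ae_nonneg_Q

namespace IsQVISolution

variable {M} {φ : ℝ → ℝ} (hφ : M.IsQVISolution φ)

include hφ

/-- The inequality is given for x > 0 only; the right derivative at 0 inherits it because φ' is
continuous on [0, ∞). -/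
lemma one_le_dplus {x : ℝ} (hx : 0 ≤ x) : 1 ≤ dplus φ x := by
  have hpos : ∀ y > 0, 1 ≤ dplus φ y := fun y hy => by
    have := (le_max_right _ _).trans_eq (hφ.qvi y hy)
    linarith
  rcases hx.eq_or_lt with rfl | hx
  · have h1 : Tendsto (dplus φ) (𝓝[>] 0) (𝓝 (dplus φ 0)) :=
      ((continuousOn_dplus hφ.contDiffOn) 0 Set.self_mem_Ici).mono_left
        (nhdsWithin_mono _ Set.Ioi_subset_Ici_self)
    exact ge_of_tendsto h1 (eventually_nhdsWithin_of_forall fun y hy => hpos y hy)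
  · exact hpos x hx

lemma one_le_extDeriv (x : ℝ) : 1 ≤ extDeriv φ x := hφ.one_le_dplus (le_max_right _ _)

lemma one_le_dividedDiff (x y : ℝ) : 1 ≤ dividedDiff φ x y :=
  Dividend.one_le_dividedDiff hφ.contDiffOn hφ.one_le_extDeriv x y

lemma monotone : Monotone φ := by
  intro x y hxy
  rcases lt_or_ge x 0 with hx | hx
  · rw [hφ.neg x hx]; exact hφ.nonneg y
  · rw [← extend_of_nonneg hφ.contDiffOn hx, ← extend_of_nonneg hφ.contDiffOn (hx.trans hxy)]
    have h1 := dividedDiff_mul hφ.contDiffOn x y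
    have h2 := hφ.one_le_dividedDiff x y
    nlinarith

lemma measurable : Measurable φ := hφ.monotone.measurable

lemma integrable_sub (x : ℝ) : Integrable (fun y => φ (x - y)) M.Q := by
  refine Integrable.of_bound (C := φ x)
    (hφ.measurable.comp (by fun_prop)).aestronglyMeasurable ?_
  filter_upwards [M.ae_nonneg_Q] with y hy
  rw [Real.norm_eq_abs, abs_of_nonneg (hφ.nonneg _)]
  exact hφ.monotone (by linarith)

omit hφ in
lemma _root_.Dividend.RiskModel.claimMean_eq (h : ℝ → ℝ) (x : ℝ) :
    M.claimMean h x = ∫ y, h (x - y) ∂M.Q := by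
  rw [claimMean, restrict_Q]

lemma claimMean_nonneg (x : ℝ) : 0 ≤ M.claimMean φ x :=
  integral_nonneg fun _ => hφ.nonneg _

lemma claimMean_mono : Monotone (M.claimMean φ) := by
  intro x y hxy
  rw [claimMean_eq, claimMean_eq]
  exact integral_mono (hφ.integrable_sub x) (hφ.integrable_sub y) fun z =>
    hφ.monotone (by linarith)

lemma lintegral_claim (x : ℝ) :
    ∫⁻ y, ENNReal.ofReal (φ (x - y)) ∂M.Q = ENNReal.ofReal (M.claimMean φ x) := by
  rw [claimMean_eq, ofReal_integral_eq_lintegral_ofReal (hφ.integrable_sub x)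
    (ae_of_all _ fun _ => hφ.nonneg _)]

/-- At 0, φ may jump up from the value 0, so continuity holds from the right only. Limits involving
the mean after a claim are therefore always taken from the right. -/
lemma tendsto_right (x : ℝ) : Tendsto φ (𝓝[>] x) (𝓝 (φ x)) := by
  rcases lt_or_ge x 0 with hx | hx
  · rw [hφ.neg x hx]
    refine tendsto_const_nhds.congr' ?_
    filter_upwards [eventually_nhdsWithin_of_eventually_nhds (eventually_lt_nhds hx)] with y hy
    exact (hφ.neg y hy).symm
  · exact (hφ.contDiffOn.continuousOn x hx).mono_left
      (nhdsWithin_mono _ fun y hy => hx.trans (Set.mem_Ioi.1 hy).le)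

lemma tendsto_claimMean (x : ℝ) : Tendsto (M.claimMean φ) (𝓝[>] x) (𝓝 (M.claimMean φ x)) := by
  simp only [funext (claimMean_eq (M := M) φ)]
  refine tendsto_integral_filter_of_dominated_convergence (fun _ => φ (x + 1))
    (Eventually.of_forall fun z =>
      (hφ.measurable.comp (by fun_prop)).aestronglyMeasurable) ?_ (integrable_const _)
    (ae_of_all _ fun y => ?_)
  · filter_upwards [eventually_nhdsWithin_of_eventually_nhds
      (eventually_lt_nhds (lt_add_one x))] with z hz
    filter_upwards [M.ae_nonneg_Q] with y hy
    rw [Real.norm_eq_abs, abs_of_nonneg (hφ.nonneg _)]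
    exact hφ.monotone (by linarith)
  · refine (hφ.tendsto_right (x - y)).comp (tendsto_nhdsWithin_iff.2 ⟨?_, ?_⟩)
    · exact ((continuous_sub_right y).tendsto x).mono_left nhdsWithin_le_nhds
    · filter_upwards [self_mem_nhdsWithin] with z hz
      simp only [Set.mem_Ioi] at hz ⊢; linarith

lemma continuousOn_drift : ContinuousOn (M.drift φ) (Set.Ici 0) :=
  (M.continuous_g.continuousOn.mul (continuousOn_dplus hφ.contDiffOn)).sub
    (continuousOn_const.mul hφ.contDiffOn.continuousOn)

omit hφ in
lemma _root_.Dividend.RiskModel.generator_sub_eq (φ : ℝ → ℝ) (x : ℝ) :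
    M.generator φ x - M.δ * φ x = M.drift φ x - M.lam * φ x + M.lam * M.claimMean φ x := by
  simp only [generator, drift, claimMean]; ring

/-- For x > 0 this is the first half of the quasi-variational inequality; a limit from the right
adds x = 0. -/
lemma generator_le {x : ℝ} (hx : 0 ≤ x) :
    M.drift φ x + M.lam * M.claimMean φ x ≤ M.lam * φ x := by
  have hpos : ∀ y > 0, M.drift φ y + M.lam * M.claimMean φ y ≤ M.lam * φ y := by
    intro y hy
    have := (le_max_left _ _).trans_eq (hφ.qvi y hy)
    rw [generator_sub_eq] at this
    linarith
  have hle : 𝓝[>] x ≤ 𝓝[Set.Ici 0] x :=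
    nhdsWithin_mono _ fun y hy => hx.trans (Set.mem_Ioi.1 hy).le
  refine le_of_tendsto_of_tendsto
    ((((hφ.continuousOn_drift x hx).mono_left hle).add
      ((hφ.tendsto_claimMean x).const_mul M.lam)))
    ((hφ.tendsto_right x).const_mul M.lam)
    (eventually_nhdsWithin_of_forall fun y hy => hpos y (hx.trans_lt hy))

/-- At positive points of the continuation region, 1 - φ' < 0 forces the other term of the maximum
to vanish. Passing to the closure is delicate, since `claimMean` is only right-continuous and the
approximating points y n may lie to the left of x. Monotonicity helps: in the limit, λφ(x) -
drift(x) ≤ λ `claimMean`(z) for every z > x, and z ↓ x gives the missing inequality. -/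
lemma generator_eq {x : ℝ} (hx : x ∈ closure (continuationRegion φ)) :
    M.drift φ x + M.lam * M.claimMean φ x = M.lam * φ x := by
  have hx0 : 0 ≤ x := by
    have : closure (continuationRegion φ) ⊆ Set.Ici 0 :=
      closure_minimal (fun y hy => hy.1) isClosed_Ici
    exact this hx
  refine le_antisymm (hφ.generator_le hx0) ?_
  -- the positive points of the continuation region are dense in it
  have hpos : x ∈ closure {y | 0 < y ∧ M.lam * φ y - M.drift φ y = M.lam * M.claimMean φ y} := by
    refine closure_minimal ?_ isClosed_closure hx
    rintro y ⟨hy0, hy⟩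
    have hcont := continuousOn_dplus hφ.contDiffOn y hy0
    have h1 : ∀ᶠ z in 𝓝[>] y, 1 - dplus φ z < 0 :=
      (((hcont.mono_left (nhdsWithin_mono _ fun z hz => hy0.trans (Set.mem_Ioi.1 hz).le)).const_sub
        1).eventually_lt_const hy)
    have hev : ∀ᶠ z in 𝓝[>] y,
        z ∈ {y | 0 < y ∧ M.lam * φ y - M.drift φ y = M.lam * M.claimMean φ y} := by
      filter_upwards [h1, self_mem_nhdsWithin] with z hz hyz
      have hz0 : 0 < z := hy0.trans_lt hyz
      refine ⟨hz0, ?_⟩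
      have h2 := hφ.qvi z hz0
      have h3 : M.generator φ z - M.δ * φ z = 0 := by
        rcases max_choice (M.generator φ z - M.δ * φ z) (1 - dplus φ z) with h | h
        · rw [← h2, h]
        · rw [h] at h2; linarith
      rw [generator_sub_eq] at h3
      linarith
    exact mem_closure_of_tendsto (b := 𝓝[>] y) (f := id)
      (tendsto_id.mono_left nhdsWithin_le_nhds) hev
  obtain ⟨y, hy, hlim⟩ := mem_closure_iff_seq_limit.1 hpos
  have hlim' : Tendsto y atTop (𝓝[Set.Ici 0] x) :=
    tendsto_nhdsWithin_iff.2 ⟨hlim, Eventually.of_forall fun n => (hy n).1.le⟩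
  have hE : Tendsto (fun n => M.lam * φ (y n) - M.drift φ (y n)) atTop
      (𝓝 (M.lam * φ x - M.drift φ x)) :=
    (((hφ.contDiffOn.continuousOn x hx0).tendsto.comp hlim').const_mul M.lam).sub
      ((hφ.continuousOn_drift x hx0).tendsto.comp hlim')
  have hz : ∀ z > x, M.lam * φ x - M.drift φ x ≤ M.lam * M.claimMean φ z := by
    intro z hz
    refine le_of_tendsto hE ?_
    filter_upwards [hlim.eventually_lt_const hz] with n hn
    rw [(hy n).2]
    exact mul_le_mul_of_nonneg_left (hφ.claimMean_mono hn.le) M.lam_pos.le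
  have := ge_of_tendsto ((hφ.tendsto_claimMean x).const_mul M.lam)
    (eventually_nhdsWithin_of_forall fun z (hz' : x < z) => hz z hz')
  linarith

end IsQVISolution

end RiskModel

end Dividend

/-! ### Local times and path properties of the surplus -/

namespace Dividend

lemma le_ruinTime_iff {X : ℝ → ℝ} {s : ℝ} :
    ENNReal.ofReal s ≤ ruinTime X ↔ ∀ t, 0 ≤ t → X t < 0 → s ≤ t := by
  simp only [ruinTime, le_iInf_iff, and_imp]
  exact forall₃_congr fun t ht _ => ENNReal.ofReal_le_ofReal_iff ht

lemma le_exitTime_iff {X : ℝ → ℝ} {N : ℕ} {s : ℝ} :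
    ENNReal.ofReal s ≤ exitTime X N ↔ ∀ t, 0 ≤ t → (N : ℝ) ≤ |X t| → s ≤ t := by
  simp only [exitTime, le_iInf_iff, and_imp]
  exact forall₃_congr fun t ht _ => ENNReal.ofReal_le_ofReal_iff ht

lemma localTime_nonneg (X : ℝ → ℝ) (N : ℕ) : 0 ≤ localTime X N := ENNReal.toReal_nonneg

lemma ofReal_localTime (X : ℝ → ℝ) (N : ℕ) :
    ENNReal.ofReal (localTime X N) = min (ruinTime X) (min (N : ℝ≥0∞) (exitTime X N)) :=
  ENNReal.ofReal_toReal (((min_le_right _ _).trans (min_le_left _ _)).trans_lt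
    (ENNReal.natCast_lt_top N)).ne

lemma le_localTime_iff {X : ℝ → ℝ} {N : ℕ} {s : ℝ} :
    s ≤ localTime X N ↔
      s ≤ N ∧ ∀ t, 0 ≤ t → (X t < 0 ∨ (N : ℝ) ≤ |X t|) → s ≤ t := by
  rw [← ENNReal.ofReal_le_ofReal_iff (localTime_nonneg X N), ofReal_localTime, le_min_iff,
    le_min_iff, le_ruinTime_iff, le_exitTime_iff, ← ENNReal.ofReal_natCast,
    ENNReal.ofReal_le_ofReal_iff (Nat.cast_nonneg N)]
  constructor
  · rintro ⟨h1, h2, h3⟩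
    exact ⟨h2, fun t ht h => h.elim (h1 t ht) (h3 t ht)⟩
  · rintro ⟨h2, h⟩
    exact ⟨fun t ht h' => h t ht (Or.inl h'), h2, fun t ht h' => h t ht (Or.inr h')⟩

lemma localTime_le (X : ℝ → ℝ) (N : ℕ) : localTime X N ≤ N := (le_localTime_iff.1 le_rfl).1

lemma ofReal_localTime_le_ruinTime (X : ℝ → ℝ) (N : ℕ) :
    ENNReal.ofReal (localTime X N) ≤ ruinTime X := by
  rw [ofReal_localTime]; exact min_le_left _ _

lemma mem_Ico_of_lt_localTime {X : ℝ → ℝ} {N : ℕ} {t : ℝ} (ht : 0 ≤ t) (h : t < localTime X N) :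
    0 ≤ X t ∧ X t < N := by
  have := (le_localTime_iff (X := X) (N := N) (s := localTime X N)).1 le_rfl
  have h2 : ¬(X t < 0 ∨ (N : ℝ) ≤ |X t|) := fun hc => not_le.2 h (this.2 t ht hc)
  rw [not_or, not_lt, not_le] at h2
  exact ⟨h2.1, (abs_lt.1 h2.2).2⟩

lemma localTime_mono (X : ℝ → ℝ) : Monotone (localTime X) := by
  intro N N' hN
  have hN' : (N : ℝ) ≤ N' := by exact_mod_cast hN
  obtain ⟨h1, h2⟩ := (le_localTime_iff (X := X) (N := N) (s := localTime X N)).1 le_rfl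
  exact le_localTime_iff.2 ⟨h1.trans hN', fun t ht h =>
    h2 t ht (h.imp_right fun h => hN'.trans h)⟩

lemma measureReal_stieltjes_singleton (D : StieltjesFunction ℝ) (u : ℝ) :
    D.measure.real {u} = jump D u := by
  rw [measureReal_def, StieltjesFunction.measure_singleton, ENNReal.toReal_ofReal, jump]
  exact sub_nonneg.2 (D.mono.leftLim_le le_rfl)

lemma jump_nonneg (D : StieltjesFunction ℝ) (u : ℝ) : 0 ≤ jump D u :=
  sub_nonneg.2 (D.mono.leftLim_le le_rfl)

namespace RiskModel

variable {Ω : Type*} [MeasurableSpace Ω] (M : RiskModel Ω)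

/-- The properties of the path of the surplus that hold almost surely under an admissible
dividend scheme. -/
structure IsRegularPath (x : ℝ) (ω : Ω) (D : StieltjesFunction ℝ) (X : ℝ → ℝ) : Prop where
  T_lt : ∀ k, M.T k ω < M.T (k + 1) ω
  T_unbounded : ∀ t, ∃ k, t < M.T k ω
  Y_nonneg : ∀ k, 0 ≤ M.Y k ω
  D_neg : ∀ t < 0, D t = 0
  X_neg : ∀ t < 0, X t = x
  X_integrable : ∀ t, 0 ≤ t → IntervalIntegrable (fun s => M.g (X s)) volume 0 t
  X_eq : ∀ t, 0 ≤ t → X t = x + (∫ s in (0 : ℝ)..t, M.g (X s)) - M.claims ω t - D t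
  payment_le : ∀ t, 0 ≤ t → ENNReal.ofReal t ≤ ruinTime X →
    jump D t ≤ max (Function.leftLim X t - jump (M.claims ω) t) 0

lemma IsAdmissible.ae_isRegularPath {M : RiskModel Ω} {x : ℝ} {D : Ω → StieltjesFunction ℝ}
    {X : Ω → ℝ → ℝ} (h : M.IsAdmissible x D X) :
    ∀ᵐ ω ∂M.P, M.IsRegularPath x ω (D ω) (X ω) := by
  filter_upwards [M.ae_T_lt_succ, M.ae_T_unbounded, M.ae_Y_nonneg, h.X_neg, h.X_integrable,
    h.X_eq, h.payment_le] with ω h1 h2 h3 h4 h5 h6 h7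
  exact ⟨h1, h2, h3, h.D_neg ω, h4, h5, h6, h7⟩

/-- The measure with an atom of size `Y k` at the time of the `k`-th claim, for the first `K`
claims. -/
noncomputable def claimSum (ω : Ω) (K : ℕ) : Measure ℝ :=
  ∑ k ∈ Finset.range K, ENNReal.ofReal (M.Y k ω) • Measure.dirac (M.T (k + 1) ω)

instance (ω : Ω) (K : ℕ) : IsFiniteMeasure (M.claimSum ω K) := by
  refine ⟨?_⟩
  simp [claimSum, ENNReal.sum_lt_top]

namespace IsRegularPath

variable {M} {x : ℝ} {ω : Ω} {D : StieltjesFunction ℝ} {X : ℝ → ℝ} (h : M.IsRegularPath x ω D X)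

include h

lemma strictMono_T : StrictMono fun k => M.T k ω := strictMono_nat_of_lt_succ h.T_lt

lemma T_pos (k : ℕ) : 0 < M.T (k + 1) ω := by
  have := h.strictMono_T (Nat.succ_pos k)
  simpa [M.T_zero] using this

lemma measureReal_claimSum (K : ℕ) {s : Set ℝ} (hs : MeasurableSet s) :
    (M.claimSum ω K).real s =
      ∑ k ∈ Finset.range K, s.indicator (fun _ => M.Y k ω) (M.T (k + 1) ω) := by
  classical
  rw [measureReal_def, claimSum, Measure.finsetSum_apply, ENNReal.toReal_sum]
  · refine Finset.sum_congr rfl fun k _ => ?_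
    rw [Measure.smul_apply, Measure.dirac_apply' _ hs, smul_eq_mul]
    by_cases hT : M.T (k + 1) ω ∈ s <;> simp [hT, h.Y_nonneg k]
  · intro k _
    rw [Measure.smul_apply, Measure.dirac_apply' _ hs, smul_eq_mul]
    by_cases hT : M.T (k + 1) ω ∈ s <;> simp [hT]

lemma claims_eq {t : ℝ} {K : ℕ} (hK : t < M.T K ω) :
    M.claims ω t = ∑ k ∈ Finset.range K, (Set.Iic t).indicator (fun _ => M.Y k ω) (M.T (k + 1) ω) := by
  classical
  have h1 : ∀ k, Set.indicator {k : ℕ | M.T (k + 1) ω ≤ t} (fun k => M.Y k ω) k =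
      (Set.Iic t).indicator (fun _ => M.Y k ω) (M.T (k + 1) ω) := by
    intro k
    simp only [Set.indicator_apply, Set.mem_ofPred_eq, Set.mem_Iic]
  rw [claims, tsum_congr h1]
  refine tsum_eq_sum fun k hk => ?_
  rw [Finset.mem_range, not_lt] at hk
  refine Set.indicator_of_notMem ?_ _
  have : M.T K ω < M.T (k + 1) ω := h.strictMono_T (Nat.lt_succ_of_le hk)
  simp only [Set.mem_Iic, not_le]; linarith

lemma measureReal_claimSum_Ioc {s t : ℝ} {K : ℕ} (hst : s ≤ t) (hK : t < M.T K ω) :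
    (M.claimSum ω K).real (Set.Ioc s t) = M.claims ω t - M.claims ω s := by
  classical
  rw [h.measureReal_claimSum K measurableSet_Ioc, h.claims_eq hK, h.claims_eq (hst.trans_lt hK),
    ← Finset.sum_sub_distrib]
  refine Finset.sum_congr rfl fun k _ => ?_
  simp only [Set.indicator_apply, Set.mem_Ioc, Set.mem_Iic]
  by_cases h1 : M.T (k + 1) ω ≤ s
  · simp [h1, h1.trans hst, not_lt.2 h1]
  · simp [h1, not_le.1 h1]

lemma claims_mono : Monotone (M.claims ω) := by
  intro s t hst
  obtain ⟨K, hK⟩ := h.T_unbounded t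
  have := h.measureReal_claimSum_Ioc hst hK
  have : 0 ≤ (M.claimSum ω K).real (Set.Ioc s t) := measureReal_nonneg
  linarith

lemma jump_claims {u : ℝ} {K : ℕ} (hK : u < M.T K ω) :
    jump (M.claims ω) u = (M.claimSum ω K).real {u} := by
  have hl : Tendsto (fun n : ℕ => u - 1 / ((n : ℝ) + 1)) atTop (𝓝 u) := by
    simpa using tendsto_one_div_add_atTop_nhds_zero_nat.const_sub u
  have hlt : ∀ n : ℕ, u - 1 / ((n : ℝ) + 1) < u := fun n => by
    have : 0 < 1 / ((n : ℝ) + 1) := by positivity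
    linarith
  have h1 := tendsto_measureReal_Ioc (μ := M.claimSum ω K) hl hlt tendsto_const_nhds
    (fun _ => le_rfl)
  have h2 : Tendsto (fun n : ℕ => M.claims ω (u - 1 / ((n : ℝ) + 1))) atTop
      (𝓝 (Function.leftLim (M.claims ω) u)) :=
    (h.claims_mono.tendsto_leftLim u).comp
      (tendsto_nhdsWithin_iff.2 ⟨hl, Eventually.of_forall hlt⟩)
  refine tendsto_nhds_unique (h2.const_sub (M.claims ω u)) (h1.congr fun n => ?_)
  rw [h.measureReal_claimSum_Ioc (hlt n).le hK]

lemma jump_claims_T (k : ℕ) : jump (M.claims ω) (M.T (k + 1) ω) = M.Y k ω := by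
  rw [h.jump_claims (K := k + 2) (h.T_lt _), h.measureReal_claimSum _ (measurableSet_singleton _),
    Finset.sum_eq_single k]
  · simp
  · intro j _ hj
    refine Set.indicator_of_notMem ?_ _
    rw [Set.mem_singleton_iff]
    exact fun hc => hj (by simpa using h.strictMono_T.injective hc)
  · simp

lemma exists_claim_of_jump {u : ℝ} (hu : jump (M.claims ω) u ≠ 0) : ∃ k, M.T (k + 1) ω = u := by
  obtain ⟨K, hK⟩ := h.T_unbounded u
  rw [h.jump_claims hK, h.measureReal_claimSum _ (measurableSet_singleton _)] at hu
  obtain ⟨k, _, hk⟩ := Finset.exists_ne_zero_of_sum_ne_zero hu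
  by_contra! hc
  exact hk (Set.indicator_of_notMem (s := {u}) (a := M.T (k + 1) ω) (fun h' => hc k h') _)

lemma claims_of_neg {t : ℝ} (ht : t ≤ 0) : M.claims ω t = 0 := by
  have : t < M.T 1 ω := ht.trans_lt (h.T_pos 0)
  rw [h.claims_eq this]
  simp only [Finset.range_one, Finset.sum_singleton, zero_add]
  exact Set.indicator_of_notMem (by simpa using this) _

lemma intervalIntegrable_drift (a b : ℝ) :
    IntervalIntegrable ((Set.Ioi (0 : ℝ)).indicator fun s => M.g (X s)) volume a b := by
  have h0 : ∀ t, IntervalIntegrable ((Set.Ioi (0 : ℝ)).indicator fun s => M.g (X s)) volume 0 t := by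
    intro t
    rcases le_total 0 t with ht | ht
    · have := h.X_integrable t ht
      rw [intervalIntegrable_iff] at this ⊢
      refine this.congr_fun (fun s hs => ?_) measurableSet_uIoc
      rw [Set.uIoc_of_le ht] at hs
      exact (Set.indicator_of_mem (s := Set.Ioi 0) hs.1 fun s => M.g (X s)).symm
    · rw [intervalIntegrable_iff]
      refine (integrableOn_zero (ε' := ℝ)).congr_fun (fun s hs => ?_) measurableSet_uIoc
      rw [Set.uIoc_of_ge ht] at hs
      exact (Set.indicator_of_notMem (s := Set.Ioi 0) (fun h' => not_lt.2 hs.2 h')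
        fun s => M.g (X s)).symm
  exact (h0 a).symm.trans (h0 b)

/-- With the drift switched off on (-∞, 0], the surplus equation holds on all of ℝ. A payment at
time 0 then becomes an ordinary atom inside (-1, σ]. -/
lemma X_eq' (t : ℝ) : X t = x + (∫ s in (0 : ℝ)..t, (Set.Ioi (0 : ℝ)).indicator
    (fun s => M.g (X s)) s) - M.claims ω t - D t := by
  rcases lt_or_ge t 0 with ht | ht
  · rw [h.X_neg t ht, h.D_neg t ht, h.claims_of_neg ht.le, intervalIntegral.integral_symm,
      intervalIntegral.integral_of_le ht.le, setIntegral_congr_fun (g := fun _ => 0) measurableSet_Ioc]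
    · simp
    · intro s hs
      exact Set.indicator_of_notMem (s := Set.Ioi 0) (fun h' => not_lt.2 hs.2 h')
        fun s => M.g (X s)
  · rw [h.X_eq t ht, intervalIntegral.integral_of_le ht, intervalIntegral.integral_of_le ht,
      setIntegral_congr_fun measurableSet_Ioc]
    intro s hs
    exact (Set.indicator_of_mem (s := Set.Ioi 0) hs.1 fun s => M.g (X s)).symm

lemma X_increment {s t : ℝ} {K : ℕ} (hst : s ≤ t) (hK : t < M.T K ω) :
    X t = X s + (∫ u in s..t, (Set.Ioi (0 : ℝ)).indicator (fun s => M.g (X s)) u) -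
      (M.claimSum ω K).real (Set.Ioc s t) - D.measure.real (Set.Ioc s t) := by
  rw [h.measureReal_claimSum_Ioc hst hK, measureReal_def, StieltjesFunction.measure_Ioc,
    ENNReal.toReal_ofReal (sub_nonneg.2 (D.mono hst)), h.X_eq' t, h.X_eq' s,
    ← intervalIntegral.integral_interval_sub_left (h.intervalIntegrable_drift 0 t)
      (h.intervalIntegrable_drift 0 s)]
  ring

lemma continuous_primitive_drift : Continuous fun t => ∫ s in (0 : ℝ)..t,
    (Set.Ioi (0 : ℝ)).indicator (fun s => M.g (X s)) s :=
  intervalIntegral.continuous_primitive (fun a b => h.intervalIntegrable_drift a b) 0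

lemma continuousWithinAt_claims (u : ℝ) : ContinuousWithinAt (M.claims ω) (Set.Ici u) u := by
  obtain ⟨K, hK⟩ := h.T_unbounded u
  have h1 : ∀ᶠ t in 𝓝[≥] u, ∀ k ∈ Finset.range K,
      (Set.Iic u).indicator (fun _ => M.Y k ω) (M.T (k + 1) ω) =
        (Set.Iic t).indicator (fun _ => M.Y k ω) (M.T (k + 1) ω) := by
    rw [Filter.eventually_all_finset]
    intro k _
    rcases le_or_gt (M.T (k + 1) ω) u with hk | hk
    · filter_upwards [self_mem_nhdsWithin] with t ht
      rw [Set.indicator_of_mem (Set.mem_Iic.2 hk), Set.indicator_of_mem]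
      exact hk.trans ht
    · filter_upwards [eventually_nhdsWithin_of_eventually_nhds (eventually_lt_nhds hk)] with t ht
      rw [Set.indicator_of_notMem (by simpa using hk), Set.indicator_of_notMem (by simpa using ht)]
  refine (tendsto_const_nhds (x := M.claims ω u)).congr' ?_
  filter_upwards [h1, eventually_nhdsWithin_of_eventually_nhds (eventually_lt_nhds hK)] with t ht htK
  rw [h.claims_eq hK, h.claims_eq htK]
  exact Finset.sum_congr rfl ht

lemma continuousWithinAt_X (u : ℝ) : ContinuousWithinAt X (Set.Ici u) u := by
  rw [show X = _ from funext h.X_eq']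
  exact (((continuousWithinAt_const.add h.continuous_primitive_drift.continuousWithinAt).sub
    (h.continuousWithinAt_claims u)).sub (D.right_continuous u))

lemma tendsto_left_X (u : ℝ) :
    Tendsto X (𝓝[<] u) (𝓝 (X u + jump D u + jump (M.claims ω) u)) := by
  have h1 := ((tendsto_const_nhds (x := x)).add
    ((h.continuous_primitive_drift.tendsto u).mono_left (nhdsWithin_le_nhds (s := Set.Iio u)))).sub
    (h.claims_mono.tendsto_leftLim u) |>.sub (D.mono.tendsto_leftLim u)
  rw [show X = _ from funext h.X_eq']
  convert! h1 using 2
  simp only [jump]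
  ring

lemma leftLim_X (u : ℝ) : Function.leftLim X u = X u + jump D u + jump (M.claims ω) u :=
  leftLim_eq_of_tendsto (h.tendsto_left_X u)

/-- The surplus before payment is X(u) + ΔD(u), so the payment constraint reads ΔD ≤ max(X + ΔD, 0):
a lump sum never makes the surplus negative. -/
lemma X_nonneg_or {u : ℝ} (hu : 0 ≤ u) (hτ : ENNReal.ofReal u ≤ ruinTime X) :
    0 ≤ X u ∨ jump D u = 0 := by
  have h1 := h.payment_le u hu hτ
  rw [h.leftLim_X, add_sub_cancel_right] at h1
  rcases le_total 0 (X u + jump D u) with h2 | h2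
  · rw [max_eq_left h2] at h1
    left; linarith
  · rw [max_eq_right h2] at h1
    exact Or.inr (le_antisymm h1 (jump_nonneg D u))

/-- Before the local time the left limits of the surplus are in `[0, N]`. -/
lemma leftLim_mem {N : ℕ} (hx : 0 ≤ x) (hxN : x ≤ N) {u : ℝ} (hu0 : 0 ≤ u) (hu : u ≤ localTime X N) :
    X u + jump D u + jump (M.claims ω) u ∈ Set.Icc (0 : ℝ) N := by
  refine isClosed_Icc.mem_of_tendsto (h.tendsto_left_X u) ?_
  rcases hu0.eq_or_lt with rfl | hu0
  · filter_upwards [self_mem_nhdsWithin] with t ht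
    rw [h.X_neg t ht]
    exact ⟨hx, hxN⟩
  · filter_upwards [self_mem_nhdsWithin,
      eventually_nhdsWithin_of_eventually_nhds (eventually_gt_nhds hu0)] with t ht ht0
    have := mem_Ico_of_lt_localTime ht0.le (lt_of_lt_of_le ht hu)
    exact ⟨this.1, this.2.le⟩

lemma countable_jump : {u | jump D u + jump (M.claims ω) u ≠ 0}.Countable := by
  refine ((D.countable_leftLim_ne).union (Set.countable_range fun k => M.T (k + 1) ω)).mono ?_
  intro u hu
  by_contra hc
  rw [Set.mem_union, not_or] at hc
  have h1 : jump D u = 0 := by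
    by_contra h1
    exact hc.1 fun h2 => h1 (by rw [jump, h2, sub_self])
  have h2 : jump (M.claims ω) u = 0 := by
    by_contra h2
    exact hc.2 (h.exists_claim_of_jump h2)
  exact hu (by rw [h1, h2, add_zero])

end IsRegularPath

end RiskModel

end Dividend

/-! ### Discounting and the pathwise change of variables -/

namespace Dividend

/-- The discount factor, extended by `1` to negative times. -/
noncomputable def discount (δ u : ℝ) : ℝ := Real.exp (-δ * max u 0)

lemma discount_of_nonneg (δ : ℝ) {u : ℝ} (hu : 0 ≤ u) : discount δ u = Real.exp (-δ * u) := by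
  rw [discount, max_eq_left hu]

lemma discount_pos (δ u : ℝ) : 0 < discount δ u := Real.exp_pos _

lemma continuous_discount (δ : ℝ) : Continuous (discount δ) := by
  unfold discount; fun_prop

/-- The derivative of the discount factor. -/
noncomputable def discountDeriv (δ : ℝ) : ℝ → ℝ :=
  (Set.Ioi (0 : ℝ)).indicator fun u => -δ * Real.exp (-δ * u)

lemma intervalIntegrable_discountDeriv (δ a b : ℝ) :
    IntervalIntegrable (discountDeriv δ) volume a b := by
  have : IntervalIntegrable (fun u => -δ * Real.exp (-δ * u)) volume a b :=
    Continuous.intervalIntegrable (by fun_prop) _ _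
  rw [intervalIntegrable_iff] at this ⊢
  exact this.indicator measurableSet_Ioi

lemma discount_sub (δ s t : ℝ) : discount δ t - discount δ s = ∫ u in s..t, discountDeriv δ u := by
  refine (integral_eq_of_hasDerivAt_off_countable _ _ (Set.countable_singleton (0 : ℝ))
    (continuous_discount δ).continuousOn (fun u hu => ?_)
    (intervalIntegrable_discountDeriv δ s t)).symm
  have hu0 : u ≠ 0 := hu.2
  rcases lt_or_gt_of_ne hu0 with hneg | hpos
  · rw [discountDeriv, Set.indicator_of_notMem (by simpa using hneg.le)]
    refine (hasDerivAt_const u (1 : ℝ)).congr_of_eventuallyEq ?_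
    filter_upwards [eventually_lt_nhds hneg] with v hv
    simp [discount, max_eq_right hv.le]
  · rw [discountDeriv, Set.indicator_of_mem (Set.mem_Ioi.2 hpos)]
    have h1 : HasDerivAt (fun u => Real.exp (-δ * u)) (-δ * Real.exp (-δ * u)) u := by
      have := ((hasDerivAt_id u).const_mul (-δ)).exp
      simpa [mul_comm] using this
    refine h1.congr_of_eventuallyEq ?_
    filter_upwards [eventually_gt_nhds hpos] with v hv
    exact discount_of_nonneg δ hv.le

namespace RiskModel

variable {Ω : Type*} [MeasurableSpace Ω] {M : RiskModel Ω}

lemma setIntegral_claimSum (ω : Ω) (hY : ∀ k, 0 ≤ M.Y k ω) (K : ℕ) (F : ℝ → ℝ) {s : Set ℝ}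
    (hs : MeasurableSet s) :
    ∫ u in s, F u ∂M.claimSum ω K =
      ∑ k ∈ Finset.range K, s.indicator (fun u => F u * M.Y k ω) (M.T (k + 1) ω) := by
  classical
  rw [← integral_indicator hs, claimSum, integral_finsetSum_measure]
  · refine Finset.sum_congr rfl fun k _ => ?_
    rw [integral_smul_measure, integral_dirac, ENNReal.toReal_ofReal (hY k), smul_eq_mul, mul_comm]
    by_cases h : M.T (k + 1) ω ∈ s <;> simp [h]
  · intro k _
    exact (integrable_dirac (by simp)).smul_measure (by simp)

namespace IsRegularPath

variable {φ : ℝ → ℝ} {x : ℝ} {ω : Ω} {D : StieltjesFunction ℝ} {X : ℝ → ℝ}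

/-- The discounted change of value at the `k`-th claim. -/
lemma sum_claims_extend (h : M.IsRegularPath x ω D X) (hφ : M.IsQVISolution φ) (hx : 0 ≤ x) {N : ℕ}
    (hxN : x ≤ N) {K : ℕ} (hK : localTime X N < M.T K ω) :
    (∑ k ∈ Finset.range K, (Set.Ioc (-1) (localTime X N)).indicator
      (fun u => discount M.δ u * dividedDiff φ (X u + jump D u + jump (M.claims ω) u)
        (X u + jump D u) * M.Y k ω) (M.T (k + 1) ω)) =
    (∑ k ∈ Finset.range K, (Set.Iic (localTime X N)).indicator
      (fun u => Real.exp (-M.δ * u) *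
        (φ (Function.leftLim X u) - φ (Function.leftLim X u - M.Y k ω))) (M.T (k + 1) ω)) -
    Real.exp (-M.δ * localTime X N) * (extend φ (X (localTime X N)) - φ (X (localTime X N))) := by
  classical
  set σ := localTime X N
  -- the correction at each claim
  set e : ℝ → ℝ := fun y => extend φ y - φ y with he
  have he0 : ∀ y, 0 ≤ y → e y = 0 := fun y hy => by
    rw [he]; simp only [extend_of_nonneg hφ.contDiffOn hy, sub_self]
  have hterm : ∀ k, (Set.Ioc (-1) σ).indicator
      (fun u => discount M.δ u * dividedDiff φ (X u + jump D u + jump (M.claims ω) u)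
        (X u + jump D u) * M.Y k ω) (M.T (k + 1) ω) =
      (Set.Iic σ).indicator
      (fun u => Real.exp (-M.δ * u) *
        (φ (Function.leftLim X u) - φ (Function.leftLim X u - M.Y k ω))) (M.T (k + 1) ω) -
      if M.T (k + 1) ω = σ then Real.exp (-M.δ * σ) * e (X σ) else 0 := by
    intro k
    have hT := h.T_pos k
    by_cases hTσ : M.T (k + 1) ω ≤ σ
    · rw [Set.indicator_of_mem (Set.mem_Ioc.2 ⟨by linarith, hTσ⟩),
        Set.indicator_of_mem (Set.mem_Iic.2 hTσ), discount_of_nonneg _ hT.le]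
      have hj := h.jump_claims_T k
      have hl := h.leftLim_X (M.T (k + 1) ω)
      have hmem := h.leftLim_mem hx hxN hT.le hTσ
      rw [hj] at hl hmem
      rw [hl, hj]
      set p := X (M.T (k + 1) ω) + jump D (M.T (k + 1) ω) with hp
      have h1 := dividedDiff_mul hφ.contDiffOn (p + M.Y k ω) p
      rw [extend_of_nonneg hφ.contDiffOn hmem.1] at h1
      -- Here p is the surplus after the claim and before the payment. Before σ it is nonnegative,
      -- so φ and its extension agree. At σ, either X(σ) ≥ 0 and both corrections vanish, or there
      -- is no payment and p = X(σ).
      have h2 : extend φ p = φ p + if M.T (k + 1) ω = σ then e (X σ) else 0 := by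
        have hep : e p = if M.T (k + 1) ω = σ then e (X σ) else 0 := by
          have hjn := jump_nonneg D (M.T (k + 1) ω)
          split_ifs with hc
          · have hτ : ENNReal.ofReal (M.T (k + 1) ω) ≤ ruinTime X := by
              rw [hc]; exact ofReal_localTime_le_ruinTime X N
            rcases h.X_nonneg_or hT.le hτ with h3 | h3
            · rw [he0 p (by linarith), ← hc, he0 _ h3]
            · rw [hp, h3, add_zero, hc]
          · have := (mem_Ico_of_lt_localTime hT.le (lt_of_le_of_ne hTσ hc)).1
            exact he0 p (by linarith)
        rw [← hep, he]; ring
      rw [add_sub_cancel_right]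
      split_ifs at h2 ⊢ with hc
      · rw [hc]; linear_combination (-Real.exp (-M.δ * σ)) * h1 - Real.exp (-M.δ * σ) * h2
      · linear_combination (-Real.exp (-M.δ * M.T (k + 1) ω)) * h1 -
          Real.exp (-M.δ * M.T (k + 1) ω) * h2
    · rw [Set.indicator_of_notMem (fun hc => hTσ hc.2),
        Set.indicator_of_notMem (s := Set.Iic σ) hTσ, if_neg (fun hc => hTσ hc.le), sub_zero]
  simp only [hterm]
  rw [Finset.sum_sub_distrib]
  congr 1
  by_cases hσ : ∃ k, M.T (k + 1) ω = σ
  · obtain ⟨k, hk⟩ := hσ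
    rw [Finset.sum_eq_single k]
    · rw [if_pos hk]
    · intro j _ hj
      refine if_neg fun hc => hj ?_
      have := h.strictMono_T.injective (hc.trans hk.symm)
      omega
    · intro hkK
      exfalso
      rw [Finset.mem_range, not_lt] at hkK
      have : M.T K ω < M.T (k + 1) ω := h.strictMono_T (Nat.lt_succ_of_le hkK)
      linarith
  -- Without a claim at σ the surplus cannot be negative there: its left limit is nonnegative and a
  -- lump sum does not cross 0.
  · rw [Finset.sum_eq_zero fun k _ => if_neg fun hc => hσ ⟨k, hc⟩]
    have hj : jump (M.claims ω) σ = 0 := by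
      by_contra hj
      exact hσ (h.exists_claim_of_jump hj)
    have hσ0 : 0 ≤ σ := localTime_nonneg X N
    have hmem := (h.leftLim_mem hx hxN hσ0 le_rfl).1
    have hX : 0 ≤ X σ := by
      rcases h.X_nonneg_or hσ0 (ofReal_localTime_le_ruinTime X N) with h3 | h3
      · exact h3
      · change 0 ≤ X σ + jump D σ + jump (M.claims ω) σ at hmem
        rwa [hj, h3, add_zero, add_zero] at hmem
    change 0 = Real.exp (-M.δ * σ) * e (X σ)
    rw [he0 _ hX, mul_zero]

/-- The change-of-variables formula for the discounted value along a regular path. -/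
theorem value_decomposition (h : M.IsRegularPath x ω D X) (hφ : M.IsQVISolution φ) (hx : 0 ≤ x)
    {N : ℕ} (hxN : x ≤ N) {K : ℕ} (hK : localTime X N < M.T K ω) :
    IntegrableOn (fun u => Real.exp (-M.δ * u) * M.drift φ (X u))
      (Set.Ioc 0 (localTime X N)) ∧
    IntegrableOn (fun u => discount M.δ u * dividedDiff φ (X u + jump D u) (X u))
      (Set.Ioc (-1) (localTime X N)) D.measure ∧
    Real.exp (-M.δ * localTime X N) * φ (X (localTime X N)) +
      (∫ u in Set.Ioc (-1) (localTime X N),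
        discount M.δ u * dividedDiff φ (X u + jump D u) (X u) ∂D.measure) +
      (∑ k ∈ Finset.range K, (Set.Iic (localTime X N)).indicator
        (fun u => Real.exp (-M.δ * u) *
          (φ (Function.leftLim X u) - φ (Function.leftLim X u - M.Y k ω))) (M.T (k + 1) ω)) =
      φ x + ∫ u in Set.Ioc 0 (localTime X N), Real.exp (-M.δ * u) * M.drift φ (X u) := by
  set σ := localTime X N
  have hσ0 : 0 ≤ σ := localTime_nonneg X N
  have hσ1 : (-1 : ℝ) < σ := by linarith
  -- Starting at -1, where X = x, includes the payment at time 0. Taking the claims as μ and the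
  -- dividends as ν means that claims are settled before dividends are paid.
  obtain ⟨i1, i2, i3, key⟩ := chain_rule (X := X) (ψ := extend φ) (h := discount M.δ)
    (h' := discountDeriv M.δ) (m := dividedDiff φ) (μ := M.claimSum ω K) (ν := D.measure) hσ1
    (h.intervalIntegrable_drift (-1) σ)
    (fun s t _ hst htσ => h.X_increment hst (htσ.trans_lt hK))
    (continuous_dividedDiff hφ.contDiffOn) (dividedDiff_mul hφ.contDiffOn)
    (continuous_extend hφ.contDiffOn) (continuous_discount M.δ)
    (intervalIntegrable_discountDeriv M.δ _ _) (fun s t _ _ _ => discount_sub M.δ s t)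
  simp only [measureReal_stieltjes_singleton] at i3 key
  have hae : ∀ᵐ u, u ∈ Set.uIoc (-1) σ →
      discountDeriv M.δ u * extend φ (X u) + (Set.Ioi (0 : ℝ)).indicator (fun s => M.g (X s)) u *
        (discount M.δ u * dividedDiff φ (X u) (X u)) =
      (Set.Ioi (0 : ℝ)).indicator (fun u => Real.exp (-M.δ * u) * M.drift φ (X u)) u := by
    -- The time σ is excluded because X(σ) may be negative, where φ differs from its extension.
    have : ∀ᵐ u : ℝ, u ≠ σ := by simp [ae_iff]
    filter_upwards [this] with u hu huI
    rw [Set.uIoc_of_le hσ1.le] at huI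
    by_cases hu0 : 0 < u
    · have hX := (mem_Ico_of_lt_localTime hu0.le (lt_of_le_of_ne huI.2 hu)).1
      rw [discountDeriv, Set.indicator_of_mem (Set.mem_Ioi.2 hu0),
        Set.indicator_of_mem (Set.mem_Ioi.2 hu0), Set.indicator_of_mem (Set.mem_Ioi.2 hu0),
        extend_of_nonneg hφ.contDiffOn hX, dividedDiff_self, extDeriv_of_nonneg φ hX,
        discount_of_nonneg _ hu0.le, drift]
      ring
    · rw [discountDeriv, Set.indicator_of_notMem (s := Set.Ioi 0) hu0,
        Set.indicator_of_notMem (s := Set.Ioi 0) hu0, Set.indicator_of_notMem (s := Set.Ioi 0) hu0]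
      ring
  have hset : Set.Ioi (0 : ℝ) ∩ Set.Ioc (-1) σ = Set.Ioc 0 σ := by
    ext u
    simp only [Set.mem_inter_iff, Set.mem_Ioi, Set.mem_Ioc]
    constructor
    · rintro ⟨h1, -, h2⟩; exact ⟨h1, h2⟩
    · rintro ⟨h1, h2⟩; exact ⟨h1, by linarith, h2⟩
  have hint : (∫ u in (-1)..σ, discountDeriv M.δ u * extend φ (X u)) +
      (∫ u in (-1)..σ, (Set.Ioi (0 : ℝ)).indicator (fun s => M.g (X s)) u *
        (discount M.δ u * dividedDiff φ (X u) (X u))) =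
      ∫ u in Set.Ioc 0 σ, Real.exp (-M.δ * u) * M.drift φ (X u) := by
    rw [← intervalIntegral.integral_add i1 i2, intervalIntegral.integral_congr_ae hae,
      intervalIntegral.integral_of_le hσ1.le, integral_indicator measurableSet_Ioi,
      Measure.restrict_restrict measurableSet_Ioi, hset]
  refine ⟨?_, ?_, ?_⟩
  · have i4 := (i1.add i2).congr_ae ((ae_restrict_iff' measurableSet_uIoc).2 hae)
    rw [intervalIntegrable_iff, Set.uIoc_of_le hσ1.le, IntegrableOn,
      integrable_indicator_iff measurableSet_Ioi, IntegrableOn,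
      Measure.restrict_restrict measurableSet_Ioi, hset] at i4
    exact i4
  · rwa [intervalIntegrable_iff, Set.uIoc_of_le hσ1.le] at i3
  · rw [hint, intervalIntegral.integral_of_le hσ1.le, intervalIntegral.integral_of_le hσ1.le,
      setIntegral_claimSum ω h.Y_nonneg K _ measurableSet_Ioc] at key
    have hcl : ∀ k, (Set.Ioc (-1) σ).indicator (fun u => discount M.δ u *
        dividedDiff φ (X u + jump D u + (M.claimSum ω K).real {u}) (X u + jump D u) * M.Y k ω)
          (M.T (k + 1) ω) =
        (Set.Ioc (-1) σ).indicator (fun u => discount M.δ u *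
        dividedDiff φ (X u + jump D u + jump (M.claims ω) u) (X u + jump D u) * M.Y k ω)
          (M.T (k + 1) ω) := by
      intro k
      by_cases hm : M.T (k + 1) ω ∈ Set.Ioc (-1) σ
      · rw [Set.indicator_of_mem hm, Set.indicator_of_mem hm, h.jump_claims (hm.2.trans_lt hK)]
      · rw [Set.indicator_of_notMem hm, Set.indicator_of_notMem hm]
    simp only [hcl] at key
    -- The correction at σ exactly converts the terminal value of the extension into that of φ.
    rw [h.sum_claims_extend hφ hx hxN hK, h.X_neg (-1) (by norm_num),
      extend_of_nonneg hφ.contDiffOn hx, discount_of_nonneg _ hσ0] at key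
    have hd1 : discount M.δ (-1) = 1 := by simp [discount]
    rw [hd1] at key
    linear_combination key

end IsRegularPath

end RiskModel

end Dividend

/-! ### Measurability at random times and predictability -/

namespace Dividend

/-- The value of a right-continuous process at a random time is measurable. -/
lemma aemeasurable_eval_of_rightContinuous {Ω : Type*} [MeasurableSpace Ω] {P : Measure Ω}
    {Z : Ω → ℝ → ℝ} (hZ : ∀ t, 0 ≤ t → Measurable fun ω => Z ω t)
    (hrc : ∀ᵐ ω ∂P, ∀ u, ContinuousWithinAt (Z ω) (Set.Ici u) u) {σ : Ω → ℝ}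
    (hσ : AEMeasurable σ P) (hσ0 : ∀ ω, 0 ≤ σ ω) : AEMeasurable (fun ω => Z ω (σ ω)) P := by
  obtain ⟨σ', hσ', hae⟩ := hσ
  -- The random time is approximated from the right by times with values in the grid of mesh
  -- 1/(n+1); evaluation at such a time involves only countably many deterministic times.
  refine aemeasurable_of_tendsto_metrizable_ae atTop
    (f := fun (n : ℕ) ω => Z ω (((⌊σ' ω * (n + 1)⌋₊ : ℝ) + 1) / (n + 1))) (fun n => ?_) ?_
  · have h1 : Measurable fun z : Ω × ℕ => Z z.1 (((z.2 : ℝ) + 1) / (n + 1)) :=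
      measurable_from_prod_countable_left fun k => hZ (((k : ℝ) + 1) / (n + 1)) (by positivity)
    have h2 : Measurable fun ω => (ω, ⌊σ' ω * (n + 1)⌋₊) :=
      measurable_id.prodMk (Nat.measurable_floor.comp (by fun_prop))
    exact (h1.comp h2).aemeasurable
  · filter_upwards [hrc, hae] with ω hω hσω
    rw [← hσω]
    refine (hω (σ ω)).tendsto.comp (tendsto_nhdsWithin_iff.2 ⟨?_, ?_⟩)
    · have h0 : Tendsto (fun n : ℕ => 1 / ((n : ℝ) + 1)) atTop (𝓝 0) :=
        tendsto_one_div_add_atTop_nhds_zero_nat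
      refine tendsto_of_tendsto_of_tendsto_of_le_of_le (g := fun _ => σ ω)
        (h := fun n : ℕ => σ ω + 1 / ((n : ℝ) + 1)) tendsto_const_nhds
        (by simpa using h0.const_add (σ ω)) (fun n => ?_) (fun n => ?_)
      · simp only
        rw [le_div_iff₀ (by positivity)]
        exact (Nat.lt_floor_add_one _).le
      · simp only
        rw [div_le_iff₀ (by positivity), add_mul, one_div, inv_mul_cancel₀ (by positivity)]
        have := Nat.floor_le (a := σ ω * ((n : ℝ) + 1)) (by have := hσ0 ω; positivity)
        linarith
    · refine Eventually.of_forall fun n => ?_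
      rw [Set.mem_Ici, le_div_iff₀ (by positivity)]
      exact (Nat.lt_floor_add_one _).le

/-- The left limit at a positive time along a sequence of partitions. -/
noncomputable def leftValue (X : ℝ → ℝ) (s : ℝ) : ℝ :=
  limsup (fun n : ℕ => X (max (((⌈s * (n + 1)⌉ : ℝ) - 1) / (n + 1)) 0)) atTop

/-- The grid times (⌈s(n+1)⌉ - 1)/(n+1) lie strictly below s and tend to s. The `limsup` in
`leftValue` keeps it measurable without regard to the existence of the limit. -/
lemma leftValue_eq {X : ℝ → ℝ} {s a : ℝ} (hs : 0 < s) (h : Tendsto X (𝓝[<] s) (𝓝 a)) :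
    leftValue X s = a := by
  refine Tendsto.limsup_eq (h.comp (tendsto_nhdsWithin_iff.2 ⟨?_, Eventually.of_forall fun n => ?_⟩))
  · have h0 : Tendsto (fun n : ℕ => 1 / ((n : ℝ) + 1)) atTop (𝓝 0) :=
      tendsto_one_div_add_atTop_nhds_zero_nat
    have h1 : Tendsto (fun n : ℕ => ((⌈s * ((n : ℝ) + 1)⌉ : ℝ) - 1) / (n + 1)) atTop (𝓝 s) := by
      refine tendsto_of_tendsto_of_tendsto_of_le_of_le (h := fun _ => s)
        (g := fun n : ℕ => s - 1 / ((n : ℝ) + 1)) (by simpa using h0.const_sub s)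
        tendsto_const_nhds (fun n => ?_) (fun n => ?_)
      · simp only
        rw [le_div_iff₀ (by positivity), sub_mul, one_div, inv_mul_cancel₀ (by positivity)]
        have := Int.le_ceil (s * ((n : ℝ) + 1))
        linarith
      · simp only
        rw [div_le_iff₀ (by positivity)]
        have := Int.ceil_lt_add_one (s * ((n : ℝ) + 1))
        linarith
    simpa [max_eq_left hs.le, max_comm] using h1.max (tendsto_const_nhds (x := (0 : ℝ)))
  · refine Set.mem_Iio.2 (max_lt ?_ hs)
    rw [div_lt_iff₀ (by positivity)]
    have := Int.ceil_lt_add_one (s * ((n : ℝ) + 1))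
    linarith

namespace RiskModel

variable {Ω : Type*} [mΩ : MeasurableSpace Ω] (M : RiskModel Ω)

lemma measurableSet_predictable_Ioi (a : ℝ) {A : Set Ω} (hA : MeasurableSet[M.ℱ a.toNNReal] A) :
    MeasurableSet[M.predictable] {z : ℝ × Ω × ℝ | a < z.1 ∧ z.2.1 ∈ A} := by
  have : {z : ℝ × Ω × ℝ | a < z.1 ∧ z.2.1 ∈ A} =
      ⋃ n : ℕ, Set.Ioc a n ×ˢ (A ×ˢ (Set.univ : Set ℝ)) := by
    ext ⟨s, ω, y⟩
    simp only [Set.mem_iUnion, Set.mem_prod, Set.mem_Ioc, Set.mem_univ, and_true]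
    constructor
    · rintro ⟨h1, h2⟩
      obtain ⟨n, hn⟩ := exists_nat_ge s
      exact ⟨n, ⟨h1, hn⟩, h2⟩
    · rintro ⟨n, ⟨h1, -⟩, h2⟩
      exact ⟨h1, h2⟩
  rw [this]
  exact @MeasurableSet.iUnion _ _ M.predictable _ _ fun n =>
    M.measurableSet_predictable_rect a n hA MeasurableSet.univ

lemma measurable_predictable_time : Measurable[M.predictable] fun z : ℝ × Ω × ℝ => z.1 := by
  refine @measurable_of_Ioi _ _ _ _ _ M.predictable _ _ _ _ fun a => ?_
  have := M.measurableSet_predictable_Ioi a (A := Set.univ) (@MeasurableSet.univ _ (M.ℱ a.toNNReal))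
  simpa [Set.preimage] using this

lemma measurable_predictable_mark : Measurable[M.predictable] fun z : ℝ × Ω × ℝ => z.2.2 := by
  intro B hB
  have : (fun z : ℝ × Ω × ℝ => z.2.2) ⁻¹' B =
      ⋃ n : ℕ, Set.Ioc (-(n : ℝ)) n ×ˢ ((Set.univ : Set Ω) ×ˢ B) := by
    ext ⟨s, ω, y⟩
    simp only [Set.mem_iUnion, Set.mem_prod, Set.mem_Ioc, Set.mem_univ, true_and, Set.mem_preimage]
    constructor
    · intro h2
      obtain ⟨n, hn⟩ := exists_nat_gt |s|
      exact ⟨n, ⟨(abs_lt.1 hn).1, (abs_lt.1 hn).2.le⟩, h2⟩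
    · rintro ⟨n, -, h2⟩
      exact h2
  rw [this]
  exact @MeasurableSet.iUnion _ _ M.predictable _ _ fun n =>
    M.measurableSet_predictable_rect _ n (@MeasurableSet.univ _ (M.ℱ _)) hB

variable {M} {x : ℝ} {D : Ω → StieltjesFunction ℝ} {X : Ω → ℝ → ℝ}

namespace IsAdmissible

variable (h : M.IsAdmissible x D X)

include h

lemma X_adapted' (t : ℝ) : Measurable[M.ℱ t.toNNReal] fun ω => X ω (max t 0) := by
  have := h.X_adapted t.toNNReal
  rwa [Real.coe_toNNReal'] at this

lemma measurable_X {t : ℝ} (ht : 0 ≤ t) : Measurable fun ω => X ω t := by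
  have := (h.X_adapted' t).mono (M.ℱ.le _) le_rfl
  rwa [max_eq_left ht] at this

/-- On a half-open grid cell the approximation is the surplus at the left endpoint, which is known
when the cell begins. Preimages are thus countable unions of predictable rectangles. -/
lemma measurable_leftValue :
    Measurable[M.predictable] fun z : ℝ × Ω × ℝ => leftValue (X z.2.1) z.1 := by
  unfold leftValue
  refine @Measurable.limsup _ _ _ _ _ M.predictable _ _ _ _ fun n => ?_
  intro B hB
  have : (fun z : ℝ × Ω × ℝ => X z.2.1 (max (((⌈z.1 * (n + 1)⌉ : ℝ) - 1) / (n + 1)) 0)) ⁻¹' B =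
      ⋃ j : ℤ, Set.Ioc (((j : ℝ) - 1) / (n + 1)) ((j : ℝ) / (n + 1)) ×ˢ
        (((fun ω => X ω (max (((j : ℝ) - 1) / (n + 1)) 0)) ⁻¹' B) ×ˢ (Set.univ : Set ℝ)) := by
    have hn : (0 : ℝ) < n + 1 := by positivity
    ext ⟨s, ω, y⟩
    simp only [Set.mem_iUnion, Set.mem_prod, Set.mem_Ioc, Set.mem_univ, and_true, Set.mem_preimage,
      div_lt_iff₀ hn, le_div_iff₀ hn]
    constructor
    · intro h2
      refine ⟨_, ⟨?_, Int.le_ceil _⟩, h2⟩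
      have := Int.ceil_lt_add_one (s * ((n : ℝ) + 1))
      linarith
    · rintro ⟨j, h1, h2⟩
      rwa [(Int.ceil_eq_iff (z := j)).2 h1]
  rw [this]
  exact @MeasurableSet.iUnion _ _ M.predictable _ _ fun j =>
    M.measurableSet_predictable_rect _ _ (h.X_adapted' _ hB) MeasurableSet.univ

/-- The event that the surplus leaves `[0, N)` by time `q` agrees almost surely with an event of
`ℱ_q`. -/
lemma exists_measurableSet_exit (N : ℕ) {q : ℚ} (hq : 0 ≤ q) :
    ∃ A, MeasurableSet[M.ℱ (q : ℝ).toNNReal] A ∧ ∀ᵐ ω ∂M.P, (ω ∈ A ↔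
      ∃ u ∈ Set.Icc (0 : ℝ) q, X ω u < 0 ∨ (N : ℝ) ≤ |X ω u|) := by
  have hX : ∀ r, 0 ≤ r → r ≤ (q : ℝ) → Measurable[M.ℱ (q : ℝ).toNNReal] fun ω => X ω r := by
    intro r hr hrq
    have := (h.X_adapted' r).mono (M.ℱ.mono (Real.toNNReal_mono hrq)) le_rfl
    rwa [max_eq_left hr] at this
  obtain ⟨A, hA, hAe⟩ := exists_measurableSet_hitting (M.ℱ.le (q : ℝ).toNNReal) M.P
    (Z := fun t ω => |X ω t|) q (fun r hr hrq => continuous_abs.measurable.comp (hX r hr hrq))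
    (by
      filter_upwards [h.ae_isRegularPath] with ω hω u _
      exact (hω.continuousWithinAt_X u).abs) N
  -- Entry into the open half-line X < 0 is seen at rational times by right continuity; only the
  -- closed condition |X| ≥ N needs the projection theorem.
  set B : Set Ω := ⋃ r : ℚ, {ω | (0 ≤ r ∧ r ≤ q) ∧ X ω r < 0}
  have hB : MeasurableSet[M.ℱ (q : ℝ).toNNReal] B := by
    refine MeasurableSet.iUnion fun r => ?_
    by_cases hr : 0 ≤ r ∧ r ≤ q
    · have : {ω | (0 ≤ r ∧ r ≤ q) ∧ X ω r < 0} = (fun ω => X ω r) ⁻¹' Set.Iio 0 := by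
        ext ω; exact ⟨fun h => h.2, fun h => ⟨hr, h⟩⟩
      rw [this]
      exact hX r (by exact_mod_cast hr.1) (by exact_mod_cast hr.2) measurableSet_Iio
    · have : {ω | (0 ≤ r ∧ r ≤ q) ∧ X ω r < 0} = ∅ := by
        ext ω; exact ⟨fun h => hr h.1, fun h => h.elim⟩
      rw [this]
      exact @MeasurableSet.empty _ (M.ℱ (q : ℝ).toNNReal)
  refine ⟨B ∪ A, hB.union hA, ?_⟩
  filter_upwards [hAe, h.ae_isRegularPath] with ω hω hreg
  rw [Set.mem_union, hω, Set.mem_iUnion]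
  constructor
  · rintro (⟨r, hr, hX⟩ | ⟨u, hu, hX⟩)
    · exact ⟨r, ⟨by exact_mod_cast hr.1, by exact_mod_cast hr.2⟩, Or.inl hX⟩
    · exact ⟨u, hu, Or.inr hX⟩
  · rintro ⟨u, hu, hX | hX⟩
    · left
      rcases hu.2.eq_or_lt with huq | huq
      · exact ⟨q, ⟨hq, le_rfl⟩, by rwa [← huq]⟩
      · have h1 : ∀ᶠ t in 𝓝[>] u, X ω t < 0 :=
          ((hreg.continuousWithinAt_X u).mono Set.Ioi_subset_Ici_self).tendsto.eventually_lt_const hX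
        have h2 : ∀ᶠ t in 𝓝[>] u, t < (q : ℝ) :=
          eventually_nhdsWithin_of_eventually_nhds (eventually_lt_nhds huq)
        obtain ⟨b, hb, hsub⟩ := mem_nhdsGT_iff_exists_Ioo_subset.1 (h1.and h2)
        obtain ⟨r, hr1, hr2⟩ := exists_rat_btwn (Set.mem_Ioi.1 hb)
        have := hsub ⟨hr1, hr2⟩
        exact ⟨r, ⟨by exact_mod_cast hu.1.trans hr1.le, by exact_mod_cast this.2.le⟩, this.1⟩
    · exact Or.inr ⟨u, hu, hX⟩

/-- The stochastic interval up to the local time is predictable up to a null set. -/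
lemma exists_predictable_interval (N : ℕ) : ∃ R : Set (ℝ × Ω),
    MeasurableSet[M.predictable] {z : ℝ × Ω × ℝ | (z.1, z.2.1) ∈ R} ∧
    ∀ᵐ ω ∂M.P, ∀ s, (s, ω) ∈ R ↔ s ≤ localTime (X ω) N := by
  choose! A hA hAe using fun q : ℚ => fun hq : 0 ≤ q => h.exists_measurableSet_exit N hq
  -- The local time is at least s iff s ≤ N and no exit has occurred by any rational q < s. For each
  -- q, the condition is the complement of the predictable set {q < s} × A q.
  refine ⟨{z | z.1 ≤ N ∧ ∀ q : ℚ, 0 ≤ q → ¬((q : ℝ) < z.1 ∧ z.2 ∈ A q)}, ?_, ?_⟩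
  · have : {z : ℝ × Ω × ℝ | (z.1, z.2.1) ∈ {z : ℝ × Ω | z.1 ≤ N ∧
        ∀ q : ℚ, 0 ≤ q → ¬((q : ℝ) < z.1 ∧ z.2 ∈ A q)}} =
        (fun z : ℝ × Ω × ℝ => z.1) ⁻¹' Set.Iic (N : ℝ) ∩
        ⋂ q : {q : ℚ // 0 ≤ q}, {z : ℝ × Ω × ℝ | ((q : ℚ) : ℝ) < z.1 ∧ z.2.1 ∈ A q}ᶜ := by
      ext z
      simp
    rw [this]
    exact @MeasurableSet.inter _ M.predictable _ _ (M.measurable_predictable_time measurableSet_Iic)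
      (@MeasurableSet.iInter _ _ M.predictable _ _ fun q =>
        @MeasurableSet.compl _ _ M.predictable (M.measurableSet_predictable_Ioi _ (hA q q.2)))
  · have hall : ∀ᵐ ω ∂M.P, ∀ q : ℚ, 0 ≤ q → (ω ∈ A q ↔
        ∃ u ∈ Set.Icc (0 : ℝ) q, X ω u < 0 ∨ (N : ℝ) ≤ |X ω u|) := by
      rw [ae_all_iff]
      intro q
      by_cases hq : 0 ≤ q
      · filter_upwards [hAe q hq] with ω hω _ using hω
      · exact ae_of_all _ fun ω hq' => absurd hq' hq
    filter_upwards [hall] with ω hω s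
    rw [le_localTime_iff]
    refine and_congr_right fun _ => ⟨fun h1 t ht hX => ?_, fun h1 q hq hc => ?_⟩
    · by_contra! hts
      obtain ⟨q, hq1, hq2⟩ := exists_rat_btwn hts
      have hq0 : 0 ≤ q := by exact_mod_cast ht.trans hq1.le
      exact h1 q hq0 ⟨hq2, (hω q hq0).2 ⟨t, ⟨ht, hq1.le⟩, hX⟩⟩
    · obtain ⟨u, hu, hX⟩ := (hω q hq).1 hc.2
      have := h1 u hu.1 hX
      linarith [hu.2, hc.1]

/-- Almost surely the local time is the length of the section of the predictable interval in (0, ∞),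
and section measures are measurable. -/
lemma aemeasurable_localTime (N : ℕ) : AEMeasurable (fun ω => localTime (X ω) N) M.P := by
  obtain ⟨R, hR, hRe⟩ := h.exists_predictable_interval N
  have hR' : MeasurableSet {z : Ω × ℝ | (z.2, z.1) ∈ R} :=
    (show Measurable fun z : Ω × ℝ => (z.2, z.1, (0 : ℝ)) by fun_prop) (M.predictable_le _ hR)
  have hm : Measurable fun ω => (volume.restrict (Set.Ioi (0 : ℝ)) {s | (s, ω) ∈ R}).toReal :=
    (measurable_measure_prodMk_left hR').ennreal_toReal
  refine ⟨_, hm, ?_⟩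
  filter_upwards [hRe] with ω hω
  have : {s | (s, ω) ∈ R} = Set.Iic (localTime (X ω) N) := by
    ext s; exact hω s
  rw [this, Measure.restrict_apply measurableSet_Iic, Set.inter_comm, Set.Ioi_inter_Iic,
    Real.volume_Ioc, sub_zero, ENNReal.toReal_ofReal (localTime_nonneg _ _)]

lemma aemeasurable_X_localTime (N : ℕ) :
    AEMeasurable (fun ω => X ω (localTime (X ω) N)) M.P := by
  refine aemeasurable_eval_of_rightContinuous (fun t ht => h.measurable_X ht) ?_
    (h.aemeasurable_localTime N) fun ω => localTime_nonneg _ _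
  filter_upwards [h.ae_isRegularPath] with ω hω u
  exact hω.continuousWithinAt_X u

end IsAdmissible

end RiskModel

end Dividend

/-! ### Decomposition of the value into nonnegative terms -/

namespace Dividend

/-- The discounted loss of value up to the local time that is caused by the dividends. -/
noncomputable def dividendLoss (δ : ℝ) (φ : ℝ → ℝ) (D : StieltjesFunction ℝ) (X : ℝ → ℝ) (N : ℕ) :
    ℝ≥0∞ :=
  ∫⁻ u in Set.Ioc (-1) (localTime X N),
    ENNReal.ofReal (discount δ u * dividedDiff φ (X u + jump D u) (X u)) ∂D.measure

/-- The discounted value at the local time. -/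
noncomputable def terminalValue (δ : ℝ) (φ : ℝ → ℝ) (X : ℝ → ℝ) (N : ℕ) : ℝ≥0∞ :=
  ENNReal.ofReal (Real.exp (-δ * localTime X N) * φ (X (localTime X N)))

namespace RiskModel

variable {Ω : Type*} [mΩ : MeasurableSpace Ω] {M : RiskModel Ω}

/-- The function `g φ' - δ φ` on `[0, ∞)`, extended measurably to `ℝ`. -/
noncomputable def driftExt (M : RiskModel Ω) (φ : ℝ → ℝ) (y : ℝ) : ℝ :=
  M.g y * extDeriv φ y - M.δ * φ y

lemma driftExt_of_nonneg (φ : ℝ → ℝ) {y : ℝ} (hy : 0 ≤ y) : M.driftExt φ y = M.drift φ y := by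
  rw [driftExt, drift, extDeriv_of_nonneg φ hy]

lemma IsQVISolution.measurable_driftExt {φ : ℝ → ℝ} (hφ : M.IsQVISolution φ) :
    Measurable (M.driftExt φ) :=
  (M.continuous_g.measurable.mul (continuous_extDeriv hφ.contDiffOn).measurable).sub
    (measurable_const.mul hφ.measurable)

namespace IsRegularPath

variable {φ : ℝ → ℝ} {x : ℝ} {ω : Ω} {D : StieltjesFunction ℝ} {X : ℝ → ℝ}

lemma leftValue_eq (h : M.IsRegularPath x ω D X) {u : ℝ} (hu : 0 < u) :
    leftValue X u = X u + jump D u + jump (M.claims ω) u :=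
  Dividend.leftValue_eq hu (h.tendsto_left_X u)

lemma leftValue_mem (h : M.IsRegularPath x ω D X) {N : ℕ} (hx : 0 ≤ x) (hxN : x ≤ N) {u : ℝ}
    (hu0 : 0 < u) (hu : u ≤ localTime X N) : leftValue X u ∈ Set.Icc (0 : ℝ) N := by
  rw [h.leftValue_eq hu0]
  exact h.leftLim_mem hx hxN hu0.le hu

lemma ae_leftValue_eq (h : M.IsRegularPath x ω D X) : ∀ᵐ u : ℝ, 0 < u → leftValue X u = X u := by
  filter_upwards [h.countable_jump.ae_notMem volume] with u hu hu0
  rw [h.leftValue_eq hu0, add_assoc, add_eq_left]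
  by_contra hc
  exact hu hc

lemma tsum_claims_eq (h : M.IsRegularPath x ω D X) {σ : ℝ} {K : ℕ} (hK : σ < M.T K ω)
    {F : ℕ → ℝ → ℝ} (hF : ∀ k u, 0 ≤ F k u) :
    ∑' k, (Set.Iic σ).indicator (fun u => ENNReal.ofReal (F k u)) (M.T (k + 1) ω) =
      ENNReal.ofReal (∑ k ∈ Finset.range K, (Set.Iic σ).indicator (F k) (M.T (k + 1) ω)) := by
  rw [ENNReal.ofReal_sum_of_nonneg fun k _ => Set.indicator_nonneg (fun u _ => hF k u) _,
    tsum_eq_sum (s := Finset.range K)]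
  · refine Finset.sum_congr rfl fun k _ => ?_
    by_cases hm : M.T (k + 1) ω ∈ Set.Iic σ
    · rw [Set.indicator_of_mem hm, Set.indicator_of_mem hm]
    · rw [Set.indicator_of_notMem hm, Set.indicator_of_notMem hm, ENNReal.ofReal_zero]
  · intro k hk
    rw [Finset.mem_range, not_lt] at hk
    refine Set.indicator_of_notMem ?_ _
    have : M.T K ω < M.T (k + 1) ω := h.strictMono_T (Nat.lt_succ_of_le hk)
    simp only [Set.mem_Iic, not_le]; linarith

/-- The decomposition of the value along a regular path into nonnegative terms, in terms of left
limits. -/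
theorem value_decomposition_ennreal (h : M.IsRegularPath x ω D X) (hφ : M.IsQVISolution φ)
    (hx : 0 ≤ x) {N : ℕ} (hxN : x ≤ N) :
    let σ := localTime X N
    let c₁ := ∑' k, (Set.Iic σ).indicator
      (fun u => ENNReal.ofReal (Real.exp (-M.δ * u) * φ (leftValue X u))) (M.T (k + 1) ω)
    let c₂ := ∑' k, (Set.Iic σ).indicator
      (fun u => ENNReal.ofReal (Real.exp (-M.δ * u) * φ (leftValue X u - M.Y k ω))) (M.T (k + 1) ω)
    let r₁ := ∫⁻ u in Set.Ioc 0 σ,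
      ENNReal.ofReal (-(Real.exp (-M.δ * u) * M.driftExt φ (leftValue X u)))
    let r₂ := ∫⁻ u in Set.Ioc 0 σ,
      ENNReal.ofReal (Real.exp (-M.δ * u) * M.driftExt φ (leftValue X u))
    c₁ ≠ ∞ ∧ r₁ ≠ ∞ ∧
      terminalValue M.δ φ X N + (c₁ + r₁) + dividendLoss M.δ φ D X N =
        ENNReal.ofReal (φ x) + (c₂ + r₂) := by
  intro σ c₁ c₂ r₁ r₂
  obtain ⟨K, hK⟩ := h.T_unbounded σ
  obtain ⟨i1, i2, key⟩ := h.value_decomposition hφ hx hxN hK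
  -- Jumps are countable, so the drift integral does not change when the surplus is replaced by its
  -- predictable left limit.
  have hae : ∀ᵐ u ∂volume.restrict (Set.Ioc 0 σ),
      Real.exp (-M.δ * u) * M.drift φ (X u) =
        Real.exp (-M.δ * u) * M.driftExt φ (leftValue X u) := by
    filter_upwards [ae_restrict_mem measurableSet_Ioc, ae_restrict_of_ae h.ae_leftValue_eq]
      with u hu hu2
    rw [driftExt_of_nonneg φ (h.leftValue_mem hx hxN hu.1 hu.2).1, hu2 hu.1]
  have i1' : IntegrableOn (fun u => Real.exp (-M.δ * u) * M.driftExt φ (leftValue X u))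
      (Set.Ioc 0 σ) := i1.congr hae
  rw [integral_congr_ae hae,
    integral_eq_lintegral_pos_part_sub_lintegral_neg_part i1'] at key
  have hr₁ : r₁ ≠ ∞ := ((lintegral_ofReal_le_lintegral_enorm _).trans_lt i1'.neg.2).ne
  have hr₂ : r₂ ≠ ∞ := ((lintegral_ofReal_le_lintegral_enorm _).trans_lt i1'.2).ne
  have hc₁ : c₁ = _ := h.tsum_claims_eq hK
    (F := fun _ u => Real.exp (-M.δ * u) * φ (leftValue X u))
    (fun _ u => mul_nonneg (Real.exp_pos _).le (hφ.nonneg _))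
  have hc₂ : c₂ = _ := h.tsum_claims_eq hK
    (F := fun k u => Real.exp (-M.δ * u) * φ (leftValue X u - M.Y k ω))
    (fun _ u => mul_nonneg (Real.exp_pos _).le (hφ.nonneg _))
  have hd : dividendLoss M.δ φ D X N = ENNReal.ofReal (∫ u in Set.Ioc (-1) σ,
      discount M.δ u * dividedDiff φ (X u + jump D u) (X u) ∂D.measure) := by
    rw [dividendLoss, ofReal_integral_eq_lintegral_ofReal i2]
    refine ae_of_all _ fun u => mul_nonneg (discount_pos _ _).le ?_
    exact zero_le_one.trans (hφ.one_le_dividedDiff _ _)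
  have hsum : (∑ k ∈ Finset.range K, (Set.Iic σ).indicator (fun u => Real.exp (-M.δ * u) *
        (φ (Function.leftLim X u) - φ (Function.leftLim X u - M.Y k ω))) (M.T (k + 1) ω)) =
      (∑ k ∈ Finset.range K, (Set.Iic σ).indicator (fun u => Real.exp (-M.δ * u) *
        φ (leftValue X u)) (M.T (k + 1) ω)) -
      ∑ k ∈ Finset.range K, (Set.Iic σ).indicator (fun u => Real.exp (-M.δ * u) *
        φ (leftValue X u - M.Y k ω)) (M.T (k + 1) ω) := by
    rw [← Finset.sum_sub_distrib]
    refine Finset.sum_congr rfl fun k _ => ?_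
    by_cases hm : M.T (k + 1) ω ∈ Set.Iic σ
    · rw [Set.indicator_of_mem hm, Set.indicator_of_mem hm, Set.indicator_of_mem hm,
        h.leftValue_eq (h.T_pos k), h.leftLim_X]
      ring
    · rw [Set.indicator_of_notMem hm, Set.indicator_of_notMem hm, Set.indicator_of_notMem hm,
        sub_zero]
  refine ⟨by rw [hc₁]; exact ENNReal.ofReal_ne_top, hr₁, ?_⟩
  have n1 : 0 ≤ Real.exp (-M.δ * σ) * φ (X σ) := mul_nonneg (Real.exp_pos _).le (hφ.nonneg _)
  have n2 : 0 ≤ ∫ u in Set.Ioc (-1) σ,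
      discount M.δ u * dividedDiff φ (X u + jump D u) (X u) ∂D.measure :=
    integral_nonneg fun u => mul_nonneg (discount_pos _ _).le
      (zero_le_one.trans (hφ.one_le_dividedDiff _ _))
  have n3 : 0 ≤ ∑ k ∈ Finset.range K, (Set.Iic σ).indicator (fun u => Real.exp (-M.δ * u) *
        φ (leftValue X u)) (M.T (k + 1) ω) :=
    Finset.sum_nonneg fun k _ => Set.indicator_nonneg
      (fun u _ => mul_nonneg (Real.exp_pos _).le (hφ.nonneg _)) _
  have n4 : 0 ≤ ∑ k ∈ Finset.range K, (Set.Iic σ).indicator (fun u => Real.exp (-M.δ * u) *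
        φ (leftValue X u - M.Y k ω)) (M.T (k + 1) ω) :=
    Finset.sum_nonneg fun k _ => Set.indicator_nonneg
      (fun u _ => mul_nonneg (Real.exp_pos _).le (hφ.nonneg _)) _
  -- All terms are finite and nonnegative, so `ENNReal.ofReal` is additive on them and the identity
  -- reduces to the real one.
  rw [hd, hc₁, hc₂, ← ENNReal.ofReal_toReal hr₁, ← ENNReal.ofReal_toReal hr₂, terminalValue,
    ← ENNReal.ofReal_add n3 ENNReal.toReal_nonneg, ← ENNReal.ofReal_add n1 (by positivity),
    ← ENNReal.ofReal_add (by positivity) n2, ← ENNReal.ofReal_add n4 ENNReal.toReal_nonneg,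
    ← ENNReal.ofReal_add (hφ.nonneg x) (by positivity)]
  congr 1
  rw [hsum] at key
  linear_combination key

end IsRegularPath

end RiskModel

end Dividend

/-! ### Expectation of the decomposition -/

namespace Dividend

namespace RiskModel

variable {Ω : Type*}

/-- The predictable integrand `F(s, X(s-), y)` on the stochastic interval `R`. -/
noncomputable def integrand (X : Ω → ℝ → ℝ) (R : Set (ℝ × Ω)) (F : ℝ → ℝ → ℝ → ℝ)
    (z : ℝ × Ω × ℝ) : ℝ≥0∞ :=
  {z : ℝ × Ω × ℝ | (z.1, z.2.1) ∈ R}.indicator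
    (fun z => ENNReal.ofReal (F z.1 (leftValue (X z.2.1) z.1) z.2.2)) z

lemma integrand_eq {X : Ω → ℝ → ℝ} {R : Set (ℝ × Ω)} {F : ℝ → ℝ → ℝ → ℝ} {ω : Ω} {σ : ℝ}
    (hR : ∀ s, (s, ω) ∈ R ↔ s ≤ σ) (s y : ℝ) : integrand X R F (s, ω, y) =
      (Set.Iic σ).indicator (fun s => ENNReal.ofReal (F s (leftValue (X ω) s) y)) s := by
  rw [integrand]
  by_cases hs : s ≤ σ
  · rw [Set.indicator_of_mem (Set.mem_Iic.2 hs), Set.indicator_of_mem]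
    exact (hR s).2 hs
  · rw [Set.indicator_of_notMem (s := Set.Iic σ) hs, Set.indicator_of_notMem]
    exact fun hc => hs ((hR s).1 hc)

lemma setLIntegral_integrand {X : Ω → ℝ → ℝ} {R : Set (ℝ × Ω)} {F : ℝ → ℝ → ℝ → ℝ} {ω : Ω} {σ : ℝ}
    (hR : ∀ s, (s, ω) ∈ R ↔ s ≤ σ) (y : ℝ) : ∫⁻ s in Set.Ioi 0, integrand X R F (s, ω, y) =
      ∫⁻ s in Set.Ioc 0 σ, ENNReal.ofReal (F s (leftValue (X ω) s) y) := by
  simp only [integrand_eq hR]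
  rw [lintegral_indicator measurableSet_Iic, Measure.restrict_restrict measurableSet_Iic,
    Set.inter_comm, Set.Ioi_inter_Iic]

variable [mΩ : MeasurableSpace Ω] {M : RiskModel Ω}

namespace IsAdmissible

variable {x : ℝ} {D : Ω → StieltjesFunction ℝ} {X : Ω → ℝ → ℝ} (h : M.IsAdmissible x D X)

include h

lemma measurable_integrand {R : Set (ℝ × Ω)}
    (hR : MeasurableSet[M.predictable] {z : ℝ × Ω × ℝ | (z.1, z.2.1) ∈ R}) {F : ℝ → ℝ → ℝ → ℝ}
    (hF : Measurable fun w : ℝ × ℝ × ℝ => F w.1 w.2.1 w.2.2) :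
    Measurable[M.predictable] (integrand X R F) := by
  have h1 : Measurable[M.predictable] fun z : ℝ × Ω × ℝ =>
      (z.1, leftValue (X z.2.1) z.1, z.2.2) :=
    @Measurable.prodMk _ M.predictable _ _ _ _ _ _ M.measurable_predictable_time
      (@Measurable.prodMk _ M.predictable _ _ _ _ _ _ h.measurable_leftValue
        M.measurable_predictable_mark)
  exact Measurable.indicator (m := M.predictable) (hF.ennreal_ofReal.comp h1) hR

/-- The expectation of the decomposition of the value up to the local time. -/
theorem lintegral_value {φ : ℝ → ℝ} (hφ : M.IsQVISolution φ) (hx : 0 ≤ x) {N : ℕ} (hxN : x ≤ N) :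
    AEMeasurable (fun ω => dividendLoss M.δ φ (D ω) (X ω) N) M.P ∧
    (∫⁻ ω, terminalValue M.δ φ (X ω) N ∂M.P) + (∫⁻ ω, dividendLoss M.δ φ (D ω) (X ω) N ∂M.P) ≤
      ENNReal.ofReal (φ x) ∧
    ((∀ᵐ ω ∂M.P, ∀ᵐ t ∂(volume : Measure ℝ), 0 ≤ t → ENNReal.ofReal t ≤ ruinTime (X ω) →
        X ω t ∈ closure (continuationRegion φ)) →
      (∫⁻ ω, terminalValue M.δ φ (X ω) N ∂M.P) + (∫⁻ ω, dividendLoss M.δ φ (D ω) (X ω) N ∂M.P) =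
      ENNReal.ofReal (φ x)) := by
  obtain ⟨R, hR, hRe⟩ := h.exists_predictable_interval N
  have hreg := h.ae_isRegularPath
  have hφm := hφ.measurable
  have hκm := hφ.measurable_driftExt
  have hNN : (0 : ℝ) ≤ N := Nat.cast_nonneg N
  have hex : ∀ {s : ℝ}, 0 < s → Real.exp (-M.δ * s) ≤ 1 := fun hs =>
    Real.exp_le_one_iff.2 (by nlinarith [M.δ_pos])
  -- the integrands
  set F₁ : ℝ → ℝ → ℝ → ℝ := fun s l _ => Real.exp (-M.δ * s) * φ l with hF₁
  set F₂ : ℝ → ℝ → ℝ → ℝ := fun s l y => Real.exp (-M.δ * s) * φ (l - y) with hF₂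
  set G₁ : ℝ → ℝ → ℝ → ℝ := fun s l _ => -(Real.exp (-M.δ * s) * M.driftExt φ l) with hG₁
  set G₂ : ℝ → ℝ → ℝ → ℝ := fun s l _ => Real.exp (-M.δ * s) * M.driftExt φ l with hG₂
  have mF₁ := h.measurable_integrand hR (F := F₁) (by fun_prop)
  have mF₂ := h.measurable_integrand hR (F := F₂) (by fun_prop)
  have mG₁ := (h.measurable_integrand hR (F := G₁) (by fun_prop)).mono M.predictable_le le_rfl
  have mG₂ := (h.measurable_integrand hR (F := G₂) (by fun_prop)).mono M.predictable_le le_rfl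
  have mF₁' := mF₁.mono M.predictable_le le_rfl
  have mF₂' := mF₂.mono M.predictable_le le_rfl
  -- the terms of the decomposition as random variables
  set c₁ : Ω → ℝ≥0∞ := fun ω => ∑' k, integrand X R F₁ (M.T (k + 1) ω, ω, M.Y k ω) with hc₁
  set c₂ : Ω → ℝ≥0∞ := fun ω => ∑' k, integrand X R F₂ (M.T (k + 1) ω, ω, M.Y k ω) with hc₂
  set w₁ : Ω → ℝ≥0∞ := fun ω => ∫⁻ s in Set.Ioi 0, integrand X R F₁ (s, ω, 0)
  set w₂ : Ω → ℝ≥0∞ := fun ω => ∫⁻ s in Set.Ioi 0, ∫⁻ y, integrand X R F₂ (s, ω, y) ∂M.Q ∂volume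
  set r₁ : Ω → ℝ≥0∞ := fun ω => ∫⁻ s in Set.Ioi 0, integrand X R G₁ (s, ω, 0)
  set r₂ : Ω → ℝ≥0∞ := fun ω => ∫⁻ s in Set.Ioi 0, integrand X R G₂ (s, ω, 0)
  have hswap : Measurable fun z : Ω × ℝ => (z.2, z.1, (0 : ℝ)) := by fun_prop
  have mc₁ : Measurable c₁ := Measurable.tsum fun k => mF₁'.comp (M.measurable_claimPoint k)
  have mc₂ : Measurable c₂ := Measurable.tsum fun k => mF₂'.comp (M.measurable_claimPoint k)
  have mw₁ : Measurable w₁ := (mF₁'.comp hswap).lintegral_prod_right'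
  have mr₁ : Measurable r₁ := (mG₁.comp hswap).lintegral_prod_right'
  have mr₂ : Measurable r₂ := (mG₂.comp hswap).lintegral_prod_right'
  -- the decomposition
  have hdec : ∀ᵐ ω ∂M.P, c₁ ω ≠ ∞ ∧ r₁ ω ≠ ∞ ∧
      terminalValue M.δ φ (X ω) N + (c₁ ω + r₁ ω) + dividendLoss M.δ φ (D ω) (X ω) N =
        ENNReal.ofReal (φ x) + (c₂ ω + r₂ ω) := by
    filter_upwards [hreg, hRe] with ω hω hRω
    have := hω.value_decomposition_ennreal hφ hx hxN
    simp only [hc₁, hc₂, r₁, r₂, setLIntegral_integrand hRω, integrand_eq hRω]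
    exact this
  have mterm : AEMeasurable (fun ω => terminalValue M.δ φ (X ω) N) M.P := by
    have h1 := h.aemeasurable_localTime N
    have h2 := hφm.comp_aemeasurable (h.aemeasurable_X_localTime N)
    exact ((Real.measurable_exp.comp_aemeasurable (h1.const_mul (-M.δ))).mul h2).ennreal_ofReal
  -- the compensators of the claim terms
  have hEc₁ : ∫⁻ ω, c₁ ω ∂M.P = ∫⁻ ω, ENNReal.ofReal M.lam * w₁ ω ∂M.P := by
    rw [hc₁, M.lintegral_tsum_claims mF₁, lintegral_const_mul _ mw₁]
    congr 1
    refine lintegral_congr_ae ?_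
    filter_upwards [hRe] with ω hRω
    refine lintegral_congr fun s => ?_
    simp only [integrand_eq hRω, hF₁]
    -- `F₁` ignores the mark, so Q contributes only its total mass 1.
    rw [lintegral_const, measure_univ, mul_one]
  have mw₂ : Measurable w₂ := by
    have : Measurable fun z : (Ω × ℝ) × ℝ => integrand X R F₂ (z.1.2, z.1.1, z.2) :=
      mF₂'.comp (by fun_prop)
    exact (this.lintegral_prod_right' (ν := M.Q)).lintegral_prod_right'
  have hEc₂ : ∫⁻ ω, c₂ ω ∂M.P = ∫⁻ ω, ENNReal.ofReal M.lam * w₂ ω ∂M.P := by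
    rw [hc₂, M.lintegral_tsum_claims mF₂, lintegral_const_mul _ mw₂]
  -- pathwise form of the compensator terms
  have hw₁ : ∀ᵐ ω ∂M.P, ENNReal.ofReal M.lam * w₁ ω + r₁ ω =
      ∫⁻ s in Set.Ioc 0 (localTime (X ω) N),
        (ENNReal.ofReal (Real.exp (-M.δ * s) * (M.lam * φ (leftValue (X ω) s))) +
        ENNReal.ofReal (-(Real.exp (-M.δ * s) * M.driftExt φ (leftValue (X ω) s)))) := by
    filter_upwards [hRe] with ω hRω
    have m1 : Measurable fun s => integrand X R F₁ (s, ω, 0) := mF₁'.comp (by fun_prop)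
    have m2 : Measurable fun s => integrand X R G₁ (s, ω, 0) := mG₁.comp (by fun_prop)
    simp only [w₁, r₁]
    rw [← lintegral_const_mul _ m1, ← lintegral_add_left (m1.const_mul _)]
    simp only [integrand_eq hRω]
    rw [← Set.Ioi_inter_Iic, Set.inter_comm, ← Measure.restrict_restrict measurableSet_Iic,
      ← lintegral_indicator measurableSet_Iic]
    refine lintegral_congr fun s => ?_
    by_cases hs : s ∈ Set.Iic (localTime (X ω) N)
    · simp only [Set.indicator_of_mem hs, hF₁, hG₁]
      rw [← ENNReal.ofReal_mul M.lam_pos.le]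
      congr 2; ring
    · simp only [Set.indicator_of_notMem hs, mul_zero, add_zero]
  have hw₂ : ∀ᵐ ω ∂M.P, ENNReal.ofReal M.lam * w₂ ω + r₂ ω =
      ∫⁻ s in Set.Ioc 0 (localTime (X ω) N),
        (ENNReal.ofReal (Real.exp (-M.δ * s) * (M.lam * M.claimMean φ (leftValue (X ω) s))) +
        ENNReal.ofReal (Real.exp (-M.δ * s) * M.driftExt φ (leftValue (X ω) s))) := by
    filter_upwards [hRe] with ω hRω
    have m1 : Measurable fun s => ∫⁻ y, integrand X R F₂ (s, ω, y) ∂M.Q := by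
      have : Measurable fun z : ℝ × ℝ => integrand X R F₂ (z.1, ω, z.2) := mF₂'.comp (by fun_prop)
      exact this.lintegral_prod_right'
    have m2 : Measurable fun s => integrand X R G₂ (s, ω, 0) := mG₂.comp (by fun_prop)
    simp only [w₂, r₂]
    rw [← lintegral_const_mul _ m1, ← lintegral_add_left (m1.const_mul _)]
    simp only [integrand_eq hRω]
    rw [← Set.Ioi_inter_Iic, Set.inter_comm, ← Measure.restrict_restrict measurableSet_Iic,
      ← lintegral_indicator measurableSet_Iic]
    refine lintegral_congr fun s => ?_
    by_cases hs : s ∈ Set.Iic (localTime (X ω) N)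
    · simp only [Set.indicator_of_mem hs, hF₂, hG₂]
      have hl : ∫⁻ y, ENNReal.ofReal (Real.exp (-M.δ * s) * φ (leftValue (X ω) s - y)) ∂M.Q =
          ENNReal.ofReal (Real.exp (-M.δ * s)) *
            ENNReal.ofReal (M.claimMean φ (leftValue (X ω) s)) := by
        rw [← hφ.lintegral_claim, ← lintegral_const_mul _ (by fun_prop)]
        exact lintegral_congr fun y => ENNReal.ofReal_mul (Real.exp_pos _).le
      rw [hl, ← ENNReal.ofReal_mul (Real.exp_pos _).le, ← ENNReal.ofReal_mul M.lam_pos.le]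
      congr 2; ring
    · simp only [Set.indicator_of_notMem hs, lintegral_zero, mul_zero, add_zero]
  -- comparison by the quasi-variational inequality
  have hcomb : ∀ {e a b c : ℝ}, 0 ≤ e → 0 ≤ a → 0 ≤ c → b + c ≤ a →
      ENNReal.ofReal (e * c) + ENNReal.ofReal (e * b) ≤
        ENNReal.ofReal (e * a) + ENNReal.ofReal (-(e * b)) := by
    intro e a b c he ha hc hle
    rcases le_total 0 b with hb | hb
    · rw [← ENNReal.ofReal_add (by positivity) (by positivity)]
      refine (ENNReal.ofReal_le_ofReal ?_).trans le_self_add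
      nlinarith
    · have hb' : e * b ≤ 0 := mul_nonpos_of_nonneg_of_nonpos he hb
      rw [ENNReal.ofReal_of_nonpos hb', add_zero,
        ← ENNReal.ofReal_add (by positivity) (by linarith)]
      refine ENNReal.ofReal_le_ofReal ?_
      nlinarith
  have hcomb' : ∀ {e a b c : ℝ}, 0 ≤ e → 0 ≤ a → 0 ≤ c → b + c = a →
      ENNReal.ofReal (e * c) + ENNReal.ofReal (e * b) =
        ENNReal.ofReal (e * a) + ENNReal.ofReal (-(e * b)) := by
    intro e a b c he ha hc hle
    refine le_antisymm (hcomb he ha hc hle.le) ?_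
    -- Exchanging a and c and replacing b by -b reverses the inequality.
    have := hcomb (b := -b) he hc ha (by linarith)
    rwa [mul_neg, neg_neg] at this
  have hle : ∀ᵐ ω ∂M.P, ENNReal.ofReal M.lam * w₂ ω + r₂ ω ≤ ENNReal.ofReal M.lam * w₁ ω + r₁ ω := by
    filter_upwards [hw₁, hw₂, hreg] with ω h1 h2 hω
    rw [h1, h2]
    refine setLIntegral_mono' measurableSet_Ioc fun s hs => ?_
    have hl := (hω.leftValue_mem hx hxN hs.1 hs.2).1
    refine hcomb (Real.exp_pos _).le (mul_nonneg M.lam_pos.le (hφ.nonneg _))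
      (mul_nonneg M.lam_pos.le (hφ.claimMean_nonneg _)) ?_
    rw [driftExt_of_nonneg φ hl]
    exact hφ.generator_le hl
  have hZ₁ : ∫⁻ ω, (c₁ ω + r₁ ω) ∂M.P = ∫⁻ ω, (ENNReal.ofReal M.lam * w₁ ω + r₁ ω) ∂M.P := by
    rw [lintegral_add_left mc₁, lintegral_add_left (mw₁.const_mul _), hEc₁]
  have hZ₂ : ∫⁻ ω, (c₂ ω + r₂ ω) ∂M.P = ∫⁻ ω, (ENNReal.ofReal M.lam * w₂ ω + r₂ ω) ∂M.P := by
    rw [lintegral_add_left mc₂, lintegral_add_left (mw₂.const_mul _), hEc₂]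
  -- finiteness
  have hfin : ∫⁻ ω, (c₁ ω + r₁ ω) ∂M.P ≠ ∞ := by
    -- On [0, N] the drift is bounded by C and φ by φ(N), and σ ≤ N; so the compensated sum has a
    -- deterministic bound even though the number of claims has none.
    obtain ⟨C, hC⟩ := (isCompact_Icc (a := (0 : ℝ)) (b := N)).exists_bound_of_continuousOn
      (hφ.continuousOn_drift.mono Set.Icc_subset_Ici_self)
    have hC0 : 0 ≤ C := (norm_nonneg _).trans (hC 0 ⟨le_rfl, hNN⟩)
    rw [hZ₁]
    have hb : ∀ᵐ ω ∂M.P, ENNReal.ofReal M.lam * w₁ ω + r₁ ω ≤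
        (ENNReal.ofReal (M.lam * φ N) + ENNReal.ofReal C) * ENNReal.ofReal N := by
      filter_upwards [hw₁, hreg] with ω h1 hω
      rw [h1]
      calc _ ≤ ∫⁻ _ in Set.Ioc 0 (localTime (X ω) N),
            (ENNReal.ofReal (M.lam * φ N) + ENNReal.ofReal C) := by
            refine setLIntegral_mono' measurableSet_Ioc fun s hs => ?_
            have hl := hω.leftValue_mem hx hxN hs.1 hs.2
            have he := hex hs.1
            have he0 := (Real.exp_pos (-M.δ * s)).le
            refine add_le_add (ENNReal.ofReal_le_ofReal ?_) (ENNReal.ofReal_le_ofReal ?_)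
            · have h2 : M.lam * φ (leftValue (X ω) s) ≤ M.lam * φ N :=
                mul_le_mul_of_nonneg_left (hφ.monotone hl.2) M.lam_pos.le
              have h3 : 0 ≤ M.lam * φ (leftValue (X ω) s) :=
                mul_nonneg M.lam_pos.le (hφ.nonneg _)
              nlinarith
            · rw [driftExt_of_nonneg φ hl.1]
              have h4 := hC _ hl
              rw [Real.norm_eq_abs] at h4
              have h5 := neg_abs_le (M.drift φ (leftValue (X ω) s))
              nlinarith [abs_nonneg (M.drift φ (leftValue (X ω) s))]
        _ ≤ _ := by
            rw [setLIntegral_const, Real.volume_Ioc, sub_zero]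
            exact mul_le_mul_right (ENNReal.ofReal_le_ofReal (localTime_le _ _)) _
    refine ((lintegral_mono_ae hb).trans_lt ?_).ne
    rw [lintegral_const, measure_univ, mul_one]
    exact ENNReal.mul_lt_top (by simp) ENNReal.ofReal_lt_top
  -- integration of the decomposition
  have hint : (∫⁻ ω, terminalValue M.δ φ (X ω) N ∂M.P) +
      (∫⁻ ω, dividendLoss M.δ φ (D ω) (X ω) N ∂M.P) + ∫⁻ ω, (c₁ ω + r₁ ω) ∂M.P =
      ENNReal.ofReal (φ x) + ∫⁻ ω, (c₂ ω + r₂ ω) ∂M.P := by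
    have h1 := lintegral_congr_ae (hdec.mono fun ω h => h.2.2)
    have h2 : AEMeasurable (fun ω => terminalValue M.δ φ (X ω) N + (c₁ ω + r₁ ω)) M.P :=
      mterm.add (mc₁.add mr₁).aemeasurable
    rw [lintegral_add_left' h2, lintegral_add_left' mterm,
      lintegral_add_left measurable_const, lintegral_const, measure_univ, mul_one] at h1
    rw [← h1]
    ring
  refine ⟨?_, ?_, fun hC => ?_⟩
  -- Measurability of the loss is not evident from the random measure dD. It follows by solving the
  -- decomposition for the loss, the subtracted terms being almost surely finite.
  · have : AEMeasurable (fun ω => (ENNReal.ofReal (φ x) + (c₂ ω + r₂ ω)) -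
        (terminalValue M.δ φ (X ω) N + (c₁ ω + r₁ ω))) M.P :=
      (measurable_const.add (mc₂.add mr₂)).aemeasurable.sub
        (mterm.add (mc₁.add mr₁).aemeasurable)
    refine this.congr ?_
    filter_upwards [hdec] with ω hω
    rw [← hω.2.2]
    exact ENNReal.add_sub_cancel_left (ENNReal.add_ne_top.2 ⟨ENNReal.ofReal_ne_top,
      ENNReal.add_ne_top.2 ⟨hω.1, hω.2.1⟩⟩)
  · have h2 : ∫⁻ ω, (c₂ ω + r₂ ω) ∂M.P ≤ ∫⁻ ω, (c₁ ω + r₁ ω) ∂M.P := by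
      rw [hZ₁, hZ₂]; exact lintegral_mono_ae hle
    refine (ENNReal.add_le_add_iff_right hfin).1 ?_
    rw [hint]
    exact add_le_add_right h2 _
  · have heq : ∫⁻ ω, (c₂ ω + r₂ ω) ∂M.P = ∫⁻ ω, (c₁ ω + r₁ ω) ∂M.P := by
      rw [hZ₁, hZ₂]
      refine lintegral_congr_ae ?_
      filter_upwards [hw₁, hw₂, hreg, hC] with ω h1 h2 hω hCω
      rw [h1, h2]
      -- Condition 1 concerns X(s) at almost every s, where X(s) agrees with the left limit in the
      -- integrand.
      refine setLIntegral_congr_fun_ae measurableSet_Ioc ?_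
      filter_upwards [hCω, hω.ae_leftValue_eq] with s hs hls hsσ
      have hl := (hω.leftValue_mem hx hxN hsσ.1 hsσ.2).1
      have hcl := hs hsσ.1.le
        ((ENNReal.ofReal_le_ofReal hsσ.2).trans (ofReal_localTime_le_ruinTime _ _))
      rw [← hls hsσ.1] at hcl
      refine hcomb' (Real.exp_pos _).le (mul_nonneg M.lam_pos.le (hφ.nonneg _))
        (mul_nonneg M.lam_pos.le (hφ.claimMean_nonneg _)) ?_
      rw [driftExt_of_nonneg φ hl]
      exact hφ.generator_eq hcl
    rw [heq] at hint
    exact (ENNReal.add_left_inj hfin).1 hint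

end IsAdmissible

end RiskModel

end Dividend

/-! ### Dividends up to ruin and verification -/

namespace Dividend

lemma dividendLoss_mono (δ : ℝ) (φ : ℝ → ℝ) (D : StieltjesFunction ℝ) (X : ℝ → ℝ) :
    Monotone (dividendLoss δ φ D X) := fun _ _ hN =>
  lintegral_mono_set (Set.Ioc_subset_Ioc_right (localTime_mono X hN))

/-- The discounted dividends up to the local time. -/
noncomputable def localDividends (δ : ℝ) (D : StieltjesFunction ℝ) (X : ℝ → ℝ) (N : ℕ) : ℝ≥0∞ :=
  ∫⁻ u in Set.Icc 0 (localTime X N), ENNReal.ofReal (Real.exp (-δ * u)) ∂D.measure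

lemma measurableSet_jump_eq_zero (D : StieltjesFunction ℝ) : MeasurableSet {t | jump D t = 0} := by
  have h : {t | jump D t = 0}ᶜ.Countable := by
    refine D.countable_leftLim_ne.mono fun t ht => ?_
    contrapose! ht
    simp only [Set.mem_ofPred_eq, not_not, Set.mem_compl_iff] at ht ⊢
    rw [jump, ht, sub_self]
  exact h.measurableSet.of_compl

namespace RiskModel

namespace IsRegularPath

variable {Ω : Type*} [MeasurableSpace Ω] {M : RiskModel Ω} {x : ℝ} {ω : Ω}
  {D : StieltjesFunction ℝ} {X : ℝ → ℝ} (h : M.IsRegularPath x ω D X)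

include h

/-- D vanishes on the negative half-line, so (-1, 0) is a null set of dD; the atom at 0 belongs to
both intervals. -/
lemma restrict_Ioc_eq {σ : ℝ} :
    D.measure.restrict (Set.Ioc (-1) σ) = D.measure.restrict (Set.Icc 0 σ) := by
  have h0 : Function.leftLim D 0 = 0 := by
    refine leftLim_eq_of_tendsto (tendsto_const_nhds.congr' ?_)
    filter_upwards [self_mem_nhdsWithin] with t ht
    exact (h.D_neg t ht).symm
  have h1 : D.measure (Set.Ioo (-1) 0) = 0 := by
    rw [StieltjesFunction.measure_Ioo, h0, h.D_neg (-1) (by norm_num), sub_zero,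
      ENNReal.ofReal_zero]
  refine Measure.restrict_congr_set ?_
  filter_upwards [measure_eq_zero_iff_ae_notMem.1 h1] with t ht
  refine propext ⟨fun h2 => ⟨?_, h2.2⟩, fun h2 => ⟨?_, h2.2⟩⟩
  · by_contra! hc
    exact ht ⟨h2.1, hc⟩
  · have := h2.1
    linarith

lemma dividendLoss_eq (δ : ℝ) (φ : ℝ → ℝ) (N : ℕ) : dividendLoss δ φ D X N =
    ∫⁻ u in Set.Icc 0 (localTime X N),
      ENNReal.ofReal (Real.exp (-δ * u) * dividedDiff φ (X u + jump D u) (X u)) ∂D.measure := by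
  rw [dividendLoss, h.restrict_Ioc_eq]
  refine setLIntegral_congr_fun measurableSet_Icc fun u hu => ?_
  simp only [discount_of_nonneg _ hu.1]

lemma localDividends_le {φ : ℝ → ℝ} (hφ : M.IsQVISolution φ) (δ : ℝ) (N : ℕ) :
    localDividends δ D X N ≤ dividendLoss δ φ D X N := by
  rw [h.dividendLoss_eq]
  exact lintegral_mono fun u => ENNReal.ofReal_le_ofReal
    (le_mul_of_one_le_right (Real.exp_pos _).le (hφ.one_le_dividedDiff _ _))

/-- Surpluses are bounded on bounded time intervals. -/
lemma exists_bound (t : ℝ) : ∃ C, ∀ u ∈ Set.Icc 0 t, |X u| ≤ C := by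
  obtain ⟨C, hC⟩ := (isCompact_Icc (a := (0 : ℝ)) (b := t)).exists_bound_of_continuousOn
    h.continuous_primitive_drift.continuousOn
  refine ⟨|x| + C + |M.claims ω 0| + |M.claims ω t| + |D 0| + |D t|, fun u hu => ?_⟩
  rw [h.X_eq' u]
  have h1 := abs_le.1 (hC u hu)
  have h2 := h.claims_mono hu.1
  have h3 := h.claims_mono hu.2
  have h4 := D.mono hu.1
  have h5 := D.mono hu.2
  rw [abs_le]
  constructor <;>
  linarith [neg_abs_le x, le_abs_self x, neg_abs_le (M.claims ω 0), le_abs_self (M.claims ω t),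
    neg_abs_le (D 0), le_abs_self (D t), abs_nonneg (M.claims ω 0), abs_nonneg (M.claims ω t),
    abs_nonneg (D 0), abs_nonneg (D t)]

/-- The local times exhaust the time up to ruin. -/
lemma exists_le_localTime {t : ℝ} (hτ : ENNReal.ofReal t ≤ ruinTime X) :
    ∃ N, t ≤ localTime X N := by
  obtain ⟨C, hC⟩ := h.exists_bound t
  obtain ⟨N, hN⟩ := exists_nat_gt (max C t)
  refine ⟨N, le_localTime_iff.2 ⟨(le_max_right _ _).trans hN.le, fun u hu hu' => ?_⟩⟩
  rcases hu' with hu' | hu'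
  · exact le_ruinTime_iff.1 hτ u hu hu'
  · by_contra! hc
    exact absurd ((hu'.trans (hC u ⟨hu, hc.le⟩)).trans (le_max_left C t)) (not_le.2 hN)

/-- The intervals up to the local times increase to [0, τ], so the integrals converge monotonically.
The shift by `N₀` later ensures x ≤ N for every member of the sequence. -/
lemma lintegral_dividends (δ : ℝ) (N₀ : ℕ) :
    ∫⁻ t in {t : ℝ | 0 ≤ t ∧ ENNReal.ofReal t ≤ ruinTime X}, ENNReal.ofReal (Real.exp (-δ * t))
      ∂D.measure = ⨆ n, localDividends δ D X (n + N₀) := by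
  have hU : {t : ℝ | 0 ≤ t ∧ ENNReal.ofReal t ≤ ruinTime X} =
      ⋃ n : ℕ, Set.Icc 0 (localTime X (n + N₀)) := by
    ext t
    simp only [Set.mem_ofPred_eq, Set.mem_iUnion, Set.mem_Icc]
    constructor
    · rintro ⟨h0, hτ⟩
      obtain ⟨N, hN⟩ := h.exists_le_localTime hτ
      exact ⟨N, h0, hN.trans (localTime_mono X (Nat.le_add_right _ _))⟩
    · rintro ⟨n, h0, hn⟩
      exact ⟨h0, (ENNReal.ofReal_le_ofReal hn).trans (ofReal_localTime_le_ruinTime _ _)⟩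
  rw [hU, setLIntegral_iUnion_of_directed]
  · rfl
  · exact Monotone.directed_le fun m n hmn =>
      Set.Icc_subset_Icc_right (localTime_mono X (Nat.add_le_add_right hmn _))

/-- If the continuous dividends are paid where `φ' = 1` and the lump sums are paid along lines of
slope one, the loss of value is the amount paid. -/
lemma dividendLoss_eq_localDividends {φ : ℝ → ℝ} (hφ : M.IsQVISolution φ) (hx : 0 ≤ x) {N : ℕ}
    (hxN : x ≤ N)
    (hcont : ∫ s in Set.Icc 0 (localTime X N), (dplus φ (X s) - 1) ∂(contMeasure D) = 0)
    (hjump : ∀ s, 0 ≤ s → ENNReal.ofReal s ≤ ruinTime X → jump D s ≠ 0 →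
      φ (X s) - φ (Function.leftLim X s - jump (M.claims ω) s) = -jump D s) :
    dividendLoss M.δ φ D X N = localDividends M.δ D X N := by
  set σ := localTime X N with hσ
  obtain ⟨K, hK⟩ := h.T_unbounded (localTime X N)
  have hi := (h.value_decomposition hφ hx hxN hK).2.1
  rw [IntegrableOn, ← hσ, h.restrict_Ioc_eq] at hi
  have hE := measurableSet_jump_eq_zero D
  have hμ : (contMeasure D).restrict (Set.Icc 0 σ) =
      (D.measure.restrict (Set.Icc 0 σ)).restrict {t | jump D t = 0} := by
    rw [contMeasure, Measure.restrict_restrict measurableSet_Icc, Measure.restrict_restrict hE,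
      Set.inter_comm]
  -- outside the jumps the surplus is nonnegative
  have hX : ∀ᵐ u ∂(contMeasure D).restrict (Set.Icc 0 σ),
      u ∈ Set.Icc 0 σ ∧ jump D u = 0 ∧ 0 ≤ X u := by
    have hne : ∀ᵐ u ∂(contMeasure D).restrict (Set.Icc 0 σ), jump D u = 0 := by
      rw [hμ]; exact ae_restrict_mem hE
    -- The surplus may be negative at σ, but the continuous part of dD does not charge this point.
    have hnσ : ∀ᵐ u ∂(contMeasure D).restrict (Set.Icc 0 σ), u ≠ σ := by
      refine ae_restrict_of_ae ?_
      rw [ae_iff]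
      simp only [ne_eq, not_not, Set.ofPred_eq_eq_singleton, contMeasure]
      rw [Measure.restrict_apply (measurableSet_singleton _)]
      by_cases hj : jump D σ = 0
      · refine measure_mono_null Set.inter_subset_left ?_
        rw [StieltjesFunction.measure_singleton]
        exact ENNReal.ofReal_of_nonpos hj.le
      · refine measure_mono_null (fun u hu => hj ?_) measure_empty
        rw [← Set.mem_singleton_iff.1 hu.1]
        exact hu.2
    filter_upwards [hne, hnσ, ae_restrict_mem measurableSet_Icc] with u h1 h2 h3
    exact ⟨h3, h1, (mem_Ico_of_lt_localTime h3.1 (lt_of_le_of_ne h3.2 h2)).1⟩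
  have hone : ∀ᵐ u ∂(contMeasure D).restrict (Set.Icc 0 σ), dplus φ (X u) - 1 = 0 := by
    -- A zero Bochner integral forces φ' = 1 almost everywhere only if the integrand is integrable.
    -- Integrability is inherited from the divided difference in the decomposition, with the
    -- discount removed by e^{δu} on the compact interval.
    have hint : Integrable (fun u => dplus φ (X u) - 1)
        ((contMeasure D).restrict (Set.Icc 0 σ)) := by
      have hfin : IsFiniteMeasure ((contMeasure D).restrict (Set.Icc 0 σ)) := by
        have : IsFiniteMeasure (D.measure.restrict (Set.Icc 0 σ)) :=
          isFiniteMeasure_restrict.2 isCompact_Icc.measure_lt_top.ne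
        rw [hμ]; infer_instance
      refine Integrable.sub ?_ (integrable_const _)
      have h1 : IntegrableOn (fun u => Real.exp (M.δ * u) *
          (discount M.δ u * dividedDiff φ (X u + jump D u) (X u))) (Set.Icc 0 σ) D.measure :=
        IntegrableOn.continuousOn_mul (by fun_prop) hi isCompact_Icc
      have h2 := Integrable.mono_measure h1 (Measure.restrict_le_self (s := {t | jump D t = 0}))
      rw [← hμ] at h2
      refine h2.congr ?_
      filter_upwards [hX] with u hu
      rw [discount_of_nonneg _ hu.1.1, hu.2.1, add_zero, dividedDiff_self,
        extDeriv_of_nonneg _ hu.2.2, ← mul_assoc, ← Real.exp_add]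
      simp
    refine (integral_eq_zero_iff_of_nonneg_ae ?_ hint).1 hcont
    filter_upwards [hX] with u hu
    exact sub_nonneg.2 (hφ.one_le_dplus hu.2.2)
  have hdd : ∀ᵐ u ∂D.measure.restrict (Set.Icc 0 σ),
      dividedDiff φ (X u + jump D u) (X u) = 1 := by
    refine ae_of_ae_restrict_of_ae_restrict_compl {t | jump D t = 0} ?_ ?_
    · rw [← hμ]
      filter_upwards [hX, hone] with u hu h1
      rw [hu.2.1, add_zero, dividedDiff_self, extDeriv_of_nonneg _ hu.2.2, sub_eq_zero.1 h1]
    -- At a lump sum, condition 3 says that φ drops by exactly ΔD between X + ΔD and X; both points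
    -- are nonnegative, so the divided difference is 1.
    · filter_upwards [ae_restrict_mem hE.compl, ae_restrict_of_ae (ae_restrict_mem measurableSet_Icc)]
        with u hu hA
      have hu' : jump D u ≠ 0 := hu
      have hτ : ENNReal.ofReal u ≤ ruinTime X :=
        (ENNReal.ofReal_le_ofReal hA.2).trans (ofReal_localTime_le_ruinTime _ _)
      have hXu := (h.X_nonneg_or hA.1 hτ).resolve_right hu'
      have h1 := hjump u hA.1 hτ hu'
      rw [h.leftLim_X, add_sub_cancel_right] at h1
      have h2 := dividedDiff_mul hφ.contDiffOn (X u + jump D u) (X u)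
      rw [extend_of_nonneg hφ.contDiffOn hXu,
        extend_of_nonneg hφ.contDiffOn (add_nonneg hXu (jump_nonneg D u)), h1,
        sub_add_cancel_left] at h2
      exact mul_right_cancel₀ (neg_ne_zero.2 hu') (h2.trans (one_mul _).symm)
  rw [h.dividendLoss_eq, localDividends]
  refine lintegral_congr_ae ?_
  filter_upwards [hdd] with u hu
  rw [hu, mul_one]

end IsRegularPath

variable {Ω : Type*} [MeasurableSpace Ω] {M : RiskModel Ω} {x : ℝ} {D : Ω → StieltjesFunction ℝ}
  {X : Ω → ℝ → ℝ} {φ : ℝ → ℝ}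

namespace IsAdmissible

lemma performance_eq_iSup (h : M.IsAdmissible x D X) (N₀ : ℕ) :
    M.performance D X = ∫⁻ ω, ⨆ n, localDividends M.δ (D ω) (X ω) (n + N₀) ∂M.P :=
  lintegral_congr_ae (h.ae_isRegularPath.mono fun _ hω => hω.lintegral_dividends M.δ N₀)

lemma lintegral_iSup_dividendLoss (h : M.IsAdmissible x D X) (hφ : M.IsQVISolution φ) (hx : 0 ≤ x)
    {N₀ : ℕ} (hN₀ : x ≤ N₀) : ∫⁻ ω, ⨆ n, dividendLoss M.δ φ (D ω) (X ω) (n + N₀) ∂M.P =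
      ⨆ n, ∫⁻ ω, dividendLoss M.δ φ (D ω) (X ω) (n + N₀) ∂M.P := by
  refine lintegral_iSup' (fun n => (h.lintegral_value hφ hx (hN₀.trans ?_)).1) (ae_of_all _ ?_)
  · exact_mod_cast Nat.le_add_left _ _
  · exact fun ω m n hmn => dividendLoss_mono _ _ _ _ (Nat.add_le_add_right hmn _)

/-- The dividends up to each local time are at most the loss, whose expectation is at most φ(x) once
the nonnegative terminal value is dropped; monotone convergence reaches ruin. -/
theorem performance_le (h : M.IsAdmissible x D X) (hφ : M.IsQVISolution φ) (hx : 0 ≤ x) :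
    M.performance D X ≤ ENNReal.ofReal (φ x) := by
  obtain ⟨N₀, hN₀⟩ := exists_nat_ge x
  rw [h.performance_eq_iSup N₀]
  calc _ ≤ ∫⁻ ω, ⨆ n, dividendLoss M.δ φ (D ω) (X ω) (n + N₀) ∂M.P :=
        lintegral_mono_ae (h.ae_isRegularPath.mono fun _ hω =>
          iSup_mono fun n => hω.localDividends_le hφ M.δ (n + N₀))
    _ ≤ ENNReal.ofReal (φ x) := by
        rw [h.lintegral_iSup_dividendLoss hφ hx hN₀]
        refine iSup_le fun n => le_add_self.trans (h.lintegral_value hφ hx (hN₀.trans ?_)).2.1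
        exact_mod_cast Nat.le_add_left _ _

/-- The verification of the optimality of a dividend scheme. -/
theorem le_performance (h : M.IsAdmissible x D X) (hφ : M.IsQVISolution φ) (hx : 0 ≤ x)
    (hregion : ∀ᵐ ω ∂M.P, ∀ᵐ t ∂(volume : Measure ℝ), 0 ≤ t → ENNReal.ofReal t ≤ ruinTime (X ω) →
      X ω t ∈ closure (continuationRegion φ))
    (hcont : ∀ᵐ ω ∂M.P, ∀ t, 0 ≤ t → ENNReal.ofReal t ≤ ruinTime (X ω) →
      ∫ s in Set.Icc 0 t, (dplus φ (X ω s) - 1) ∂(contMeasure (D ω)) = 0)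
    (hjump : ∀ᵐ ω ∂M.P, ∀ s, 0 ≤ s → ENNReal.ofReal s ≤ ruinTime (X ω) → jump (D ω) s ≠ 0 →
      φ (X ω s) - φ (M.surplusBeforePayment X ω s) = -jump (D ω) s)
    (hlim : Tendsto (fun N : ℕ => ∫⁻ ω, terminalValue M.δ φ (X ω) N ∂M.P) atTop (𝓝 0)) :
    ENNReal.ofReal (φ x) ≤ M.performance D X := by
  obtain ⟨N₀, hN₀⟩ := exists_nat_ge x
  have hN : ∀ n : ℕ, x ≤ (n + N₀ : ℕ) := fun n => hN₀.trans (by exact_mod_cast Nat.le_add_left _ _)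
  have hperf : M.performance D X = ⨆ n, ∫⁻ ω, dividendLoss M.δ φ (D ω) (X ω) (n + N₀) ∂M.P := by
    rw [h.performance_eq_iSup N₀, ← h.lintegral_iSup_dividendLoss hφ hx hN₀]
    refine lintegral_congr_ae ?_
    filter_upwards [h.ae_isRegularPath, hcont, hjump] with ω hω h2 h3
    exact iSup_congr fun n => (hω.dividendLoss_eq_localDividends hφ hx (hN n)
      (h2 _ (localTime_nonneg _ _) (ofReal_localTime_le_ruinTime _ _)) h3).symm
  -- The expected loss for each N is bounded by its supremum, the performance, so only the terminal
  -- value still depends on N.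
  have hle : ∀ n, ENNReal.ofReal (φ x) ≤
      (∫⁻ ω, terminalValue M.δ φ (X ω) (n + N₀) ∂M.P) + M.performance D X := fun n => by
    rw [← (h.lintegral_value hφ hx (hN n)).2.2 hregion, hperf]
    gcongr
    exact le_iSup (fun n => ∫⁻ ω, dividendLoss M.δ φ (D ω) (X ω) (n + N₀) ∂M.P) n
  have ht := ((tendsto_add_atTop_iff_nat N₀).2 hlim).add_const (M.performance D X)
  rw [zero_add] at ht
  exact ge_of_tendsto' ht hle

lemma performance_le_value (h : M.IsAdmissible x D X) : M.performance D X ≤ M.value x :=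
  le_iSup_of_le D (le_iSup_of_le X (le_iSup_of_le h le_rfl))

end IsAdmissible

theorem value_le (hφ : M.IsQVISolution φ) (hx : 0 ≤ x) : M.value x ≤ ENNReal.ofReal (φ x) :=
  iSup_le fun _ => iSup_le fun _ => iSup_le fun h => h.performance_le hφ hx

end RiskModel

end Dividend

theorem theorem4p2 {Ω : Type*} [MeasurableSpace Ω] (M : Dividend.RiskModel Ω) (φ : ℝ → ℝ)
    (hφ_nonneg : ∀ y, 0 ≤ φ y)
    (hφ_neg : ∀ y < 0, φ y = 0)
    (hφ_C1 : ContDiffOn ℝ 1 φ (Set.Ici 0))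
    (hφ_qvi : ∀ x > 0, max (M.generator φ x - M.δ * φ x) (1 - Dividend.dplus φ x) = 0) :
    (∀ x ≥ 0, M.value x ≤ ENNReal.ofReal (φ x)) ∧
    (∀ x ≥ 0, ∀ (D : Ω → StieltjesFunction ℝ) (X : Ω → ℝ → ℝ), M.IsAdmissible x D X →
      (∀ᵐ ω ∂M.P, ∀ᵐ t ∂(volume : Measure ℝ),
        0 ≤ t → ENNReal.ofReal t ≤ Dividend.ruinTime (X ω) →
          X ω t ∈ closure (Dividend.continuationRegion φ)) →
      (∀ᵐ ω ∂M.P, ∀ t, 0 ≤ t → ENNReal.ofReal t ≤ Dividend.ruinTime (X ω) →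
        ∫ s in Set.Icc 0 t, (Dividend.dplus φ (X ω s) - 1) ∂(Dividend.contMeasure (D ω)) = 0) →
      (∀ᵐ ω ∂M.P, ∀ s, 0 ≤ s → ENNReal.ofReal s ≤ Dividend.ruinTime (X ω) →
        Dividend.jump (D ω) s ≠ 0 →
          φ (X ω s) - φ (M.surplusBeforePayment X ω s) = -Dividend.jump (D ω) s) →
      Tendsto (fun N : ℕ => ∫⁻ ω, ENNReal.ofReal
          (Real.exp (-M.δ * Dividend.localTime (X ω) N) * φ (X ω (Dividend.localTime (X ω) N)))
          ∂M.P) atTop (𝓝 0) →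
      ENNReal.ofReal (φ x) = M.value x ∧ M.performance D X = M.value x) := by
  have hφ : M.IsQVISolution φ := ⟨hφ_nonneg, hφ_neg, hφ_C1, hφ_qvi⟩
  refine ⟨fun x hx => Dividend.RiskModel.value_le hφ hx, fun x hx D X h h1 h2 h3 h4 => ?_⟩
  have h5 := h.le_performance hφ hx h1 h2 h3 h4
  have h6 := h.performance_le_value
  have h7 := Dividend.RiskModel.value_le hφ hx
  exact ⟨le_antisymm (h5.trans h6) h7, le_antisymm h6 (h7.trans h5)⟩
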